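/- All graphs are finite and simple, and $\log$ is the natural logarithm. For a graph $G$ let $\mathcal I(G)$ be the collection of its independent sets and $Z_G(\lambda)=\sum_{I\in\mathcal I(G)}\lambda^{|I|}$. The hard-core model on $G$ at fugacity $\lambda>0$ is the random independent set $\mathbf I$ with $\Pr(\mathbf I=I)=\lambda^{|I|}/Z_G(\lambda)$, and its occupancy fraction is $\mathbb E|\mathbf I|/|V(G)|=\frac{1}{|V(G)|}\frac{\lambda Z_G'(\lambda)}{Z_G(\lambda)}$. A fractional colouring of $G$ assigns to the independent sets $I$ of $G$ pairwise disjoint intervals $w(I)=[a_I,b_I)\subset[0,\infty)$ such that $\sum_{I\ni u}|w(I)|=1$ for every vertex $u$; the vertex $u$ is then coloured with the set $\bigcup_{I\ni u}w(I)$. The fractional chromatic number $\chi_f(G)$ is the least $k$ for which there is a probability distribution on $\mathcal I(G)$ whose random set contains each given vertex with probability at least $1/k$. A cover of $G$ is a pair $\mathscr H=(L,H)$ of a graph $H$ and a map $L$ from $V(G)$ to the finite subsets of $V(H)$ such that the sets $L(u)$ partition $V(H)$, each $L(u)$ is a clique of $H$, edges of $H$ between $L(u)$ and $L(v)$ with $u\neq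 v$ exist only if $uv\in E(G)$, and if $uv\in E(G)$ then these edges form a (possibly empty) matching. $G$ is $\mathscr H$-colourable if $H$ has an independent set of size $|V(G)|$. The cover is $k$-fold if $|L(u)|=k$ for all $u$, and the correspondence chromatic number $\chi_c(G)$ is the least $k$ such that $G$ is $\mathscr H$-colourable for every $k$-fold cover $\mathscr H$. **Theorem.** Let $G$ be a graph of maximum degree $\Delta$, and for each $u\in V(G)$ let $\omega_u\ge 3$ be an integer such that every clique of $G$ containing $u$ has size at most $\omega_u$. Write $\omega=\max_{u}\omega_u$. In the following, each $o(1)$ is a function of $\Delta$ only (in (1), of $\Delta$ and $\lambda$, with $\lambda$ fixed) that tends to $0$ as $\Delta\to\infty$; thus it is uniform in $G$ and in the $\omega_u$. The constants $\delta_0,\Delta_0$ depend only on $\varepsilon$. 1. For any $\lambda>0$, the occupancy fraction of the hard-core model on $G$ at fugacity $\lambda$ satisfies, as $\Delta\to\infty$, $$\frac{1}{|V(G)|}\frac{\lambda Z_G'(\lambda)}{Z_G(\lambda)}\ge(1-o(1))\max\left\{\frac{\log\Delta}{(\omega-2)\Delta\log\log\Delta},\ \frac{1}{2\Delta}\sqrt{\frac{\log\Delta}{\log(\omega-1)}}\right\}.$$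 2. For any $\varepsilon>0$ there exists $\delta_0>e$ such that every such $G$ (of any maximum degree) has a fractional colouring in which each vertex $u$ is coloured with a subset of the smaller of the two intervals $$\left[0,\ (1+\varepsilon)(\omega_u-2)\frac{m_u\log\log m_u}{\log m_u}\right),\qquad \left[0,\ (1+\varepsilon)\,2m_u\sqrt{\frac{\log(\omega_u-1)}{\log m_u}}\right),\qquad\text{where } m_u=\max\{\deg(u),\delta_0\}.$$ Moreover, as $\Delta\to\infty$, $$\chi_f(G)\le(1+o(1))\min\left\{(\omega-2)\frac{\Delta\log\log\Delta}{\log\Delta},\ 2\Delta\sqrt{\frac{\log(\omega-1)}{\log\Delta}}\right\}.$$ 3. For all $\varepsilon>0$ there exist $\delta_0>e$ and $\Delta_0$ such that the following holds whenever $\Delta\ge\Delta_0$. Let $$k=\min\left\{\left(e^2\log(8\Delta^4)\right)^{\omega-1},\ \exp\left(\sqrt{4\log(\omega-1)\cdot(1+\varepsilon)\log(8\Delta^4)}\right)\right\},\qquad \delta=\delta_0k,\qquad m_u=\max\{\deg(u),\delta\}.$$ If $\mathscr H=(L,H)$ is a cover of $G$ such that for each $u\in V(G)$ the size of $L(u)$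 is at least the smaller of $$(1+\varepsilon)(\omega_u-2)\frac{m_u\log\log(m_u/k)}{\log(m_u/k)}\qquad\text{and}\qquad(1+\varepsilon)\,2m_u\sqrt{\frac{\log(\omega_u-1)}{\log(m_u/k)}},$$ then $G$ is $\mathscr H$-colourable. Moreover, as $\Delta\to\infty$, $$\chi_c(G)\le(1+o(1))\min\left\{(\omega-2)\frac{\Delta\log\log\Delta}{\log\Delta},\ 5\Delta\sqrt{\frac{\log(\omega-1)}{\log\Delta}}\right\}.$$ -/

import Mathlib

open scoped Classical

universe u v

namespace LocalOcc

noncomputable section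

/-- The finset of independent sets of `G`, including the empty set. -/
def indepSets {V : Type u} [Fintype V] (G : SimpleGraph V) : Finset (Finset V) :=
  Finset.univ.filter (fun I : Finset V => G.IsIndepSet (I : Set V))

/-- The partition function (independence polynomial) `Z_G(x) = ∑ x ^ |I|`,
the sum being over the independent sets `I` of `G`. -/
def partitionFunction {V : Type u} [Fintype V] (G : SimpleGraph V) (x : ℝ) : ℝ :=
  ∑ I ∈ indepSets G, x ^ I.card

/-- The probability of the set `I` in the hard-core model on `G` at fugacity `lam`. -/
def hardCoreProb {V : Type u} [Fintype V] (G : SimpleGraph V) (lam : ℝ) (I : Finset V) : ℝ :=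
  if I ∈ indepSets G then lam ^ I.card / partitionFunction G lam else 0

/-- The occupancy fraction `𝔼|I| / |V(G)|` of the hard-core model on `G` at fugacity `lam`. -/
def occupancyFraction {V : Type u} [Fintype V] (G : SimpleGraph V) (lam : ℝ) : ℝ :=
  (∑ I : Finset V, hardCoreProb G lam I * (I.card : ℝ)) / (Fintype.card V : ℝ)

/-- The familiar expression of the occupancy fraction, `λ Z'(λ) / (|V| Z(λ))`. -/
theorem occupancyFraction_eq {V : Type u} [Fintype V] (G : SimpleGraph V) (lam : ℝ) :
    occupancyFraction G lam =
      1 / (Fintype.card V : ℝ) *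
        (lam * deriv (partitionFunction G) lam / partitionFunction G lam) := by
  have hd : HasDerivAt (partitionFunction G)
      (∑ I ∈ indepSets G, (I.card : ℝ) * lam ^ (I.card - 1)) lam := by
    have h := HasDerivAt.fun_sum (u := indepSets G) (x := lam)
      (A := fun I x => x ^ I.card) (A' := fun I => (I.card : ℝ) * lam ^ (I.card - 1))
      (fun I _ => hasDerivAt_pow I.card lam)
    exact h
  have hs : (∑ I : Finset V, hardCoreProb G lam I * (I.card : ℝ)) =
      lam * (∑ I ∈ indepSets G, (I.card : ℝ) * lam ^ (I.card - 1)) / partitionFunction G lam := by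
    simp only [hardCoreProb, ite_mul, zero_mul]
    rw [Finset.sum_ite_mem, Finset.univ_inter, Finset.mul_sum, Finset.sum_div]
    refine Finset.sum_congr rfl fun I _ => ?_
    rcases Nat.eq_zero_or_pos I.card with h | h
    · simp [h]
    · obtain ⟨n, hn⟩ := Nat.exists_eq_succ_of_ne_zero h.ne'
      rw [hn, Nat.succ_eq_add_one, Nat.add_sub_cancel, pow_succ]
      ring
  rw [occupancyFraction, hs, hd.deriv]
  ring

/-- A fractional colouring of `G`: every independent set `I` is assigned an interval
`w(I) = [left I, right I)` of nonnegative reals, intervals of distinct independent sets being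
disjoint, such that for each vertex `x` the intervals of the independent sets containing `x` have
total length `1`. (The values of `left` and `right` on other sets of vertices are irrelevant.) -/
structure FractionalColouring {V : Type u} [Fintype V] (G : SimpleGraph V) where
  left : Finset V → ℝ
  right : Finset V → ℝ
  left_nonneg : ∀ I ∈ indepSets G, 0 ≤ left I
  left_le_right : ∀ I ∈ indepSets G, left I ≤ right I
  disjoint : ∀ I ∈ indepSets G, ∀ J ∈ indepSets G, I ≠ J →
    Disjoint (Set.Ico (left I) (right I)) (Set.Ico (left J) (right J))
  total : ∀ x : V, ∑ I ∈ (indepSets G).filter (fun I => x ∈ I), (right I - left I) = 1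

/-- The set of colours `c(x)`, of measure `1`, that a fractional colouring gives to a vertex. -/
def FractionalColouring.colour {V : Type u} [Fintype V] {G : SimpleGraph V}
    (w : FractionalColouring G) (x : V) : Set ℝ :=
  ⋃ I ∈ (indepSets G).filter (fun I => x ∈ I), Set.Ico (w.left I) (w.right I)

/-- `G` admits a fractional `k`-colouring: there is a probability distribution on the independent
sets of `G` whose random set contains each given vertex with probability at least `1 / k`. -/
def FractionallyColourable {V : Type u} [Fintype V] (G : SimpleGraph V) (k : ℝ) : Prop :=
  0 < k ∧ ∃ p : Finset V → ℝ, (∀ I ∈ indepSets G, 0 ≤ p I) ∧ ∑ I ∈ indepSets G, p I = 1 ∧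
    ∀ x : V, 1 / k ≤ ∑ I ∈ (indepSets G).filter (fun I => x ∈ I), p I

/-- The fractional chromatic number `χ_f(G)`. -/
def fractionalChromaticNumber {V : Type u} [Fintype V] (G : SimpleGraph V) : ℝ :=
  sInf {k : ℝ | FractionallyColourable G k}

/-- A cover `(L, H)` of `G`, the vertex set of the graph `H` being `W`. -/
structure Cover {V : Type u} (G : SimpleGraph V) (W : Type v) where
  H : SimpleGraph W
  L : V → Finset W
  partition : ∀ x : W, ∃! a : V, x ∈ L a
  complete : ∀ a : V, H.IsClique (L a : Set W)
  edges : ∀ a b : V, ∀ x ∈ L a, ∀ y ∈ L b, H.Adj x y → a = b ∨ G.Adj a b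
  /-- For adjacent `a`, `b` the edges between `L a` and `L b` form a matching. (The condition for
  the elements of `L b` is the instance of this one with `a` and `b` exchanged.) -/
  matching : ∀ a b : V, G.Adj a b → ∀ x ∈ L a, ∀ y ∈ L b, ∀ z ∈ L b,
    H.Adj x y → H.Adj x z → y = z

/-- There is a colouring for the cover: an independent set of `H` of size `|V(G)|`. -/
def Cover.Colourable {V : Type u} [Fintype V] {G : SimpleGraph V} {W : Type v}
    (C : Cover G W) : Prop :=
  ∃ I : Finset W, C.H.IsIndepSet (I : Set W) ∧ I.card = Fintype.card V

/-- The correspondence chromatic number `χ_c(G)`: the least `k` such that `G` is colourable for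
each `k`-fold cover. (The graph `H` of a `k`-fold cover is finite, so that graphs on types in the
lowest universe exhaust all of them up to isomorphism.) -/
def correspondenceChromaticNumber {V : Type u} [Fintype V] (G : SimpleGraph V) : ℕ :=
  sInf {k : ℕ | ∀ (W : Type) (C : Cover G W), (∀ a : V, (C.L a).card = k) → C.Colourable}

/-- For every vertex `a`, the integer `om a` is at least `3` and at least the size of every clique
that contains `a`. -/
def LocalCliqueBound {V : Type u} (G : SimpleGraph V) (om : V → ℕ) : Prop :=
  ∀ a : V, 3 ≤ om a ∧ ∀ s : Finset V, G.IsClique (s : Set V) → a ∈ s → s.card ≤ om a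

/-- The quantity `(ω - 2) x log log y / log y`. -/
def boundOne (om x y : ℝ) : ℝ :=
  (om - 2) * (x * Real.log (Real.log y) / Real.log y)

/-- The quantity `c x √(log (ω - 1) / log y)`. -/
def boundTwo (c om x y : ℝ) : ℝ :=
  c * x * Real.sqrt (Real.log (om - 1) / Real.log y)

/-- The quantity
`k = min {(e² log (8 D⁴)) ^ (ω - 1), exp √(4 log (ω - 1) (1 + ε) log (8 D⁴))}`. -/
def scale (eps : ℝ) (om : ℕ) (D : ℝ) : ℝ :=
  min ((Real.exp 1 ^ 2 * Real.log (8 * D ^ 4)) ^ (om - 1))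
    (Real.exp (Real.sqrt
      (4 * Real.log ((om : ℝ) - 1) * ((1 + eps) * Real.log (8 * D ^ 4)))))

end

end LocalOcc

/-! All five conclusions rest on one fact about a graph F whose cliques have at most r = ω - 1
vertices: if its partition function Z is large, then a hard-core set on F is rarely small, where
small means about log Z / ((r - 1) log log Z) or (1/2) √(log Z / log r). By Chernoff's bound
(`small_le_exp`), which lowers the fugacity, this needs an upper bound for log |F| in terms of log
Z. One bound is of Ramsey type (`log_card_le`) and gives the first value; the other is
supersaturation by iterating Turán's theorem (`exists_log_sq_le`) and gives the second.
`exists_threshold` restates both for a degree parameter M: with f the desired ratio of colours to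
degree, there are a size s with 1 / s ≤ (1 + ε) f and a threshold Z₀, negligible against f M, such
that Z ≥ Z₀ makes sets of size at most s rare.

Local occupancy. Reveal a hard-core set I outside the neighbourhood of a, and let F consist of the
neighbours that are still possible. Either Z(F) ≤ Z₀, and the neighbourhood stays empty with
probability at least 1 / Z₀, which lets a be occupied; or about s neighbours are occupied on
average. Hence 1 ≤ β Pr(a ∈ I) + γ E|I ∩ N(a)| with β + γ M ≤ (1 + ε) f M
(`exists_part_le_occupancy`). Summation over a bounds the occupancy fraction. For fractional
colouring, colour measure is spent greedily on the hard-core distribution of the vertices that are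
not yet fully coloured; accumulating the inequality shows that a is finished before β + γ deg(a) has
been spent (`IsPartial.step`).

Correspondence colouring. Take a uniform random independent set of the cover graph, a partial
colouring. If a is uncoloured, the colours x of a have disjoint sets of neighbours in the lists
around a, which together contain at most deg(a) chosen colours. So not all x can see more than s of
them, and the others have a chance of order 1 / Z₀ of remaining available; a multiplicative weight
argument makes this concentrated (`card_few_free_le`). An available colour is unlikely to conflict
with k available colours, as this makes a partition function too large (`card_many_free_le`). The
lopsided local lemma avoids all bad events, and the uncoloured vertices are completed by an
independent transversal of lists of size 4k with degrees at most k (`exists_transversal`). For the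
correspondence chromatic number, greedy colouring suffices if a bound reaches Δ. Otherwise ω is so
small that log (Δ / k) is asymptotically log Δ for the first bound and at least 0.18 log Δ for the
second, which is why the constant 2 becomes 5. -/

namespace LocalOcc

noncomputable section

/-! ### Independent sets in graphs with bounded cliques -/

section Basic

variable {V : Type*} (G : SimpleGraph V)

/-- The independent subsets of a finite set `S` of vertices. -/
def ind (S : Finset V) : Finset (Finset V) :=
  S.powerset.filter fun I => ∀ a ∈ I, ∀ b ∈ I, ¬ G.Adj a b

/-- The elements of `U` without neighbours in `J`. -/
def free (U J : Finset V) : Finset V :=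
  U.filter fun y => ∀ z ∈ J, ¬ G.Adj y z

/-- The partition function of the subgraph induced by `S`. -/
def part (S : Finset V) (x : ℝ) : ℝ := ∑ I ∈ ind G S, x ^ I.card

/-- The contribution to `part G S x` of the sets of size at most `s`. -/
def small (S : Finset V) (x s : ℝ) : ℝ :=
  ∑ I ∈ (ind G S).filter (fun I => (I.card : ℝ) ≤ s), x ^ I.card

/-- All cliques inside `S` have at most `r` elements. -/
def CliqueLE (S : Finset V) (r : ℕ) : Prop :=
  ∀ Q : Finset V, Q ⊆ S → G.IsClique (Q : Set V) → Q.card ≤ r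

variable {G}

theorem mem_ind {S I : Finset V} : I ∈ ind G S ↔ I ⊆ S ∧ ∀ a ∈ I, ∀ b ∈ I, ¬ G.Adj a b := by
  simp [ind]

theorem mem_free {U J : Finset V} {y : V} : y ∈ free G U J ↔ y ∈ U ∧ ∀ z ∈ J, ¬ G.Adj y z := by
  simp [free]

theorem free_subset (U J : Finset V) : free G U J ⊆ U := fun _ hy => (mem_free.1 hy).1

theorem isIndepSet_iff_forall {I : Finset V} :
    G.IsIndepSet (I : Set V) ↔ ∀ a ∈ I, ∀ b ∈ I, ¬ G.Adj a b := by
  constructor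
  · intro h a ha b hb hab
    exact h (by simpa using ha) (by simpa using hb) hab.ne hab
  · intro h a ha b hb _
    exact h a (by simpa using ha) b (by simpa using hb)

theorem indepSets_eq [Fintype V] : indepSets G = ind G Finset.univ := by
  ext I
  simp [indepSets, mem_ind, isIndepSet_iff_forall]

theorem partitionFunction_eq [Fintype V] (x : ℝ) :
    partitionFunction G x = part G Finset.univ x := by
  rw [partitionFunction, part, indepSets_eq]

theorem empty_mem_ind (S : Finset V) : ∅ ∈ ind G S := by simp [mem_ind]

theorem subset_mem_ind {S I J : Finset V} (hI : I ∈ ind G S) (h : J ⊆ I) : J ∈ ind G S := by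
  rw [mem_ind] at *
  exact ⟨h.trans hI.1, fun a ha b hb => hI.2 a (h ha) b (h hb)⟩

theorem CliqueLE.mono {S T : Finset V} {r : ℕ} (h : CliqueLE G S r) (hT : T ⊆ S) :
    CliqueLE G T r := fun Q hQ hc => h Q (hQ.trans hT) hc

theorem one_le_part (S : Finset V) {x : ℝ} (hx : 0 ≤ x) : 1 ≤ part G S x := by
  have := Finset.single_le_sum (f := fun I : Finset V => x ^ I.card) (s := ind G S)
    (fun I _ => pow_nonneg hx _) (empty_mem_ind S)
  simpa [part] using this

theorem part_pos (S : Finset V) {x : ℝ} (hx : 0 ≤ x) : 0 < part G S x :=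
  zero_lt_one.trans_le (one_le_part S hx)

/-- Independent sets are obtained by choosing first the part outside `U`. -/
theorem sum_ind_fiber {M : Type*} [AddCommMonoid M] {A U : Finset V} (hU : U ⊆ A)
    (f : Finset V → M) :
    ∑ K ∈ ind G A, f K =
      ∑ J ∈ ind G (A \ U), ∑ Q ∈ ind G (free G U J), f (J ∪ Q) := by
  rw [Finset.sum_sigma']
  refine Finset.sum_bij' (fun K _ => ⟨K \ U, K ∩ U⟩) (fun p _ => p.1 ∪ p.2) ?_ ?_ ?_ ?_ ?_
  · intro K hK
    rw [mem_ind] at hK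
    simp only [Finset.mem_sigma, mem_ind]
    refine ⟨⟨Finset.sdiff_subset_sdiff hK.1 le_rfl, fun a ha b hb =>
      hK.2 a (Finset.mem_sdiff.1 ha).1 b (Finset.mem_sdiff.1 hb).1⟩, ?_, fun a ha b hb =>
      hK.2 a (Finset.mem_inter.1 ha).1 b (Finset.mem_inter.1 hb).1⟩
    intro y hy
    rw [Finset.mem_inter] at hy
    exact mem_free.2 ⟨hy.2, fun z hz => hK.2 y hy.1 z (Finset.mem_sdiff.1 hz).1⟩
  · rintro ⟨J, Q⟩ h
    simp only [Finset.mem_sigma, mem_ind] at h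
    obtain ⟨⟨hJ, hJi⟩, hQ, hQi⟩ := h
    simp only [mem_ind]
    refine ⟨Finset.union_subset (hJ.trans Finset.sdiff_subset)
      ((hQ.trans (Finset.filter_subset _ _)).trans hU), ?_⟩
    intro a ha b hb
    rcases Finset.mem_union.1 ha with ha | ha <;> rcases Finset.mem_union.1 hb with hb | hb
    · exact hJi a ha b hb
    · exact fun h => (mem_free.1 (hQ hb)).2 a ha h.symm
    · exact (mem_free.1 (hQ ha)).2 b hb
    · exact hQi a ha b hb
  · intro K _
    exact Finset.sdiff_union_inter K U
  · rintro ⟨J, Q⟩ h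
    simp only [Finset.mem_sigma, mem_ind] at h
    obtain ⟨⟨hJ, hJi⟩, hQ, hQi⟩ := h
    have h1 : ∀ x ∈ J, x ∉ U := fun x hx => (Finset.mem_sdiff.1 (hJ hx)).2
    have h2 : ∀ x ∈ Q, x ∈ U := fun x hx => (mem_free.1 (hQ hx)).1
    have e1 : (J ∪ Q) \ U = J := by
      ext x; simp only [Finset.mem_sdiff, Finset.mem_union]
      constructor
      · rintro ⟨h | h, h'⟩
        · exact h
        · exact absurd (h2 x h) h'
      · exact fun h => ⟨Or.inl h, h1 x h⟩
    have e2 : (J ∪ Q) ∩ U = Q := by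
      ext x; simp only [Finset.mem_inter, Finset.mem_union]
      constructor
      · rintro ⟨h | h, h'⟩
        · exact absurd h' (h1 x h)
        · exact h
      · exact fun h => ⟨Or.inr h, h2 x h⟩
    simp only [e1, e2]
  · intro K _
    exact congrArg f (Finset.sdiff_union_inter K U).symm

theorem disjoint_of_mem_ind_free {A U J Q : Finset V} (hJ : J ∈ ind G (A \ U))
    (hQ : Q ∈ ind G (free G U J)) : Disjoint J Q := by
  rw [Finset.disjoint_left]
  intro x hx hx'
  exact (Finset.mem_sdiff.1 ((mem_ind.1 hJ).1 hx)).2 (mem_free.1 ((mem_ind.1 hQ).1 hx')).1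

/-- The spatial Markov property: given the part J outside U, the rest is a hard-core set on those
vertices of U that J does not block. -/
theorem part_fiber {A U : Finset V} (hU : U ⊆ A) (x : ℝ) :
    part G A x = ∑ J ∈ ind G (A \ U), x ^ J.card * part G (free G U J) x := by
  rw [part, sum_ind_fiber hU]
  refine Finset.sum_congr rfl fun J hJ => ?_
  rw [part, Finset.mul_sum]
  refine Finset.sum_congr rfl fun Q hQ => ?_
  rw [Finset.card_union_of_disjoint (disjoint_of_mem_ind_free hJ hQ), pow_add]

theorem part_le_exp (S : Finset V) {x : ℝ} (hx : 0 ≤ x) : part G S x ≤ Real.exp (x * S.card) := by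
  calc part G S x ≤ ∑ I ∈ S.powerset, x ^ I.card :=
        Finset.sum_le_sum_of_subset_of_nonneg (Finset.filter_subset _ _)
          fun I _ _ => pow_nonneg hx _
    _ = (x + 1) ^ S.card := by
        have := Finset.sum_pow_mul_eq_add_pow x 1 S
        simpa using this
    _ ≤ Real.exp x ^ S.card := pow_le_pow_left₀ (by positivity) (Real.add_one_le_exp x) _
    _ = Real.exp (x * S.card) := by rw [mul_comm, Real.exp_nat_mul]

/-- Chernoff's bound for the number of small independent sets. -/
theorem small_le_exp (S : Finset V) {x μ s : ℝ} (hμ : 0 < μ) (hx : μ ≤ x) :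
    small G S x s ≤ Real.exp (μ * S.card + s * Real.log (x / μ)) := by
  have hx0 : 0 < x := hμ.trans_le hx
  have h1 : 1 ≤ x / μ := (one_le_div hμ).2 hx
  have hl : 0 ≤ Real.log (x / μ) := Real.log_nonneg h1
  -- Passing from fugacity x to μ costs (x / μ) ^ |I|, at most (x / μ) ^ s for the sets that are
  -- counted.
  calc small G S x s ≤ ∑ I ∈ (ind G S).filter (fun I => (I.card : ℝ) ≤ s),
        μ ^ I.card * Real.exp (s * Real.log (x / μ)) := by
        refine Finset.sum_le_sum fun I hI => ?_
        have hs := (Finset.mem_filter.1 hI).2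
        have : x ^ I.card = μ ^ I.card * Real.exp (I.card * Real.log (x / μ)) := by
          rw [Real.exp_nat_mul, Real.exp_log (by positivity), ← mul_pow, mul_div_cancel₀ _ hμ.ne']
        rw [this]
        gcongr
    _ ≤ ∑ I ∈ ind G S, μ ^ I.card * Real.exp (s * Real.log (x / μ)) :=
        Finset.sum_le_sum_of_subset_of_nonneg (Finset.filter_subset _ _)
          fun I _ _ => by positivity
    _ = part G S μ * Real.exp (s * Real.log (x / μ)) := by rw [part, Finset.sum_mul]
    _ ≤ _ := by
        rw [Real.exp_add]
        gcongr
        exact part_le_exp S hμ.le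

/-- A Ramsey-type bound. A largest independent set dominates S, and the neighbourhood of each of its
vertices has a smaller clique bound, so S is covered by at most A closed neighbourhoods to which
induction applies. The 1 on the left accounts for the centre of a closed neighbourhood. -/
theorem card_add_one_le_pow {A r : ℕ} : ∀ {S : Finset V}, CliqueLE G S r →
    (∀ I ∈ ind G S, I.card ≤ A) → S.card + 1 ≤ (A + 1) ^ r := by
  induction r with
  | zero =>
    intro S hS _
    rcases S.eq_empty_or_nonempty with rfl | ⟨v, hv⟩
    · simp
    · have := hS {v} (by simpa using hv) (by simp)
      simp at this
  | succ r ih =>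
    intro S hS hA
    obtain ⟨I, hI, hmax⟩ := Finset.exists_max_image (ind G S) Finset.card ⟨∅, empty_mem_ind S⟩
    have hIi := mem_ind.1 hI
    have hN : ∀ v ∈ I, (S.filter (G.Adj v)).card + 1 ≤ (A + 1) ^ r := by
      intro v hv
      apply ih
      · intro Q hQ hc
        have hvQ : v ∉ Q := fun h => G.loopless.irrefl v (Finset.mem_filter.1 (hQ h)).2
        have := hS (insert v Q) (Finset.insert_subset (hIi.1 hv)
          (hQ.trans (Finset.filter_subset _ _))) (by
            rw [Finset.coe_insert]
            exact hc.insert fun b hb _ => (Finset.mem_filter.1 (hQ hb)).2)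
        rw [Finset.card_insert_of_notMem hvQ] at this
        omega
      · intro J hJ
        refine hA J ?_
        rw [mem_ind] at *
        exact ⟨hJ.1.trans (Finset.filter_subset _ _), hJ.2⟩
    have hcov : S ⊆ I.biUnion fun v => insert v (S.filter (G.Adj v)) := by
      intro w hw
      rw [Finset.mem_biUnion]
      by_contra hcon
      push Not at hcon
      have hw1 : ∀ v ∈ I, w ≠ v ∧ ¬ G.Adj v w := by
        intro v hv
        have := hcon v hv
        simp only [Finset.mem_insert, Finset.mem_filter, not_or, not_and] at this
        exact ⟨this.1, this.2 hw⟩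
      have hwI : w ∉ I := fun h => (hw1 w h).1 rfl
      have : insert w I ∈ ind G S := by
        rw [mem_ind]
        refine ⟨Finset.insert_subset hw hIi.1, ?_⟩
        intro a ha b hb
        rcases Finset.mem_insert.1 ha with ha' | ha' <;>
          rcases Finset.mem_insert.1 hb with hb' | hb'
        · rw [ha', hb']; exact G.loopless.irrefl _
        · rw [ha']; exact fun h => (hw1 b hb').2 h.symm
        · rw [hb']; exact (hw1 a ha').2
        · exact hIi.2 a ha' b hb'
      have := hmax _ this
      rw [Finset.card_insert_of_notMem hwI] at this
      omega
    have h1 : S.card ≤ I.card * (A + 1) ^ r := by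
      refine (Finset.card_le_card hcov).trans (Finset.card_biUnion_le_card_mul _ _ _ ?_)
      exact fun v hv => (Finset.card_insert_le _ _).trans (hN v hv)
    have h2 : I.card * (A + 1) ^ r ≤ A * (A + 1) ^ r := Nat.mul_le_mul_right _ (hA I hI)
    have h3 : 1 ≤ (A + 1) ^ r := Nat.one_le_pow _ _ (Nat.succ_pos _)
    rw [pow_succ]
    nlinarith

theorem pow_card_le_part {S I : Finset V} (hI : I ∈ ind G S) {x : ℝ} (hx : 0 ≤ x) :
    (1 + x) ^ I.card ≤ part G S x := by
  have h := Finset.sum_pow_mul_eq_add_pow x 1 I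
  simp only [one_pow, mul_one] at h
  rw [add_comm, ← h]
  exact Finset.sum_le_sum_of_subset_of_nonneg
    (fun J hJ => subset_mem_ind hI (Finset.mem_powerset.1 hJ)) fun J _ _ => pow_nonneg hx _

/-- The Cauchy–Schwarz inequality for two terms with weights r and 1, free of division by r; it is
the induction step of Turán's theorem. -/
theorem add_sq_le_of_sq_le {r σ p a : ℝ} (hr : 0 ≤ r) (hσ : 0 ≤ σ)
    (h : p ^ 2 ≤ r * σ) : (p + a) ^ 2 ≤ (r + 1) * (σ + a ^ 2) := by
  have h3 : 2 * p * a ≤ σ + r * a ^ 2 := by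
    have h5 : p ^ 2 * a ^ 2 ≤ r * σ * a ^ 2 := by gcongr
    have h6 : 0 ≤ σ + r * a ^ 2 := by positivity
    refine (abs_le_of_sq_le_sq' ?_ h6).2
    linarith [sq_nonneg (σ - r * a ^ 2)]
  linarith

/-- Turán's theorem, for the number of ordered pairs of nonadjacent vertices. -/
theorem sq_card_le_mul_sum {r : ℕ} : ∀ {S : Finset V}, CliqueLE G S r →
    (S.card : ℝ) ^ 2 ≤ r * ∑ v ∈ S, ((S.filter fun w => ¬ G.Adj v w).card : ℝ) := by
  induction r with
  | zero =>
    intro S hS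
    rcases S.eq_empty_or_nonempty with rfl | ⟨v, hv⟩
    · simp
    · have := hS {v} (by simpa using hv) (by simp)
      simp at this
  | succ r ih =>
    intro S hS
    rcases S.eq_empty_or_nonempty with rfl | hne
    · simp
    obtain ⟨v, hv, hmin⟩ := Finset.exists_min_image S
      (fun v => (S.filter fun w => ¬ G.Adj v w).card) hne
    set N := S.filter (G.Adj v) with hNdef
    set M := S.filter (fun w => ¬ G.Adj v w) with hMdef
    have hNM : (N.card : ℝ) + M.card = S.card := by
      rw [hNdef, hMdef]
      exact_mod_cast Finset.card_filter_add_card_filter_not (s := S) (G.Adj v)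
    have hN : CliqueLE G N r := by
      intro Q hQ hc
      have hvQ : v ∉ Q := fun h => G.loopless.irrefl v (Finset.mem_filter.1 (hQ h)).2
      have := hS (insert v Q) (Finset.insert_subset hv
        (hQ.trans (Finset.filter_subset _ _))) (by
          rw [Finset.coe_insert]
          exact hc.insert fun b hb _ => (Finset.mem_filter.1 (hQ hb)).2)
      rw [Finset.card_insert_of_notMem hvQ] at this
      omega
    have h1 := ih hN
    set σ : ℝ := ∑ w ∈ N, ((N.filter fun w' => ¬ G.Adj w w').card : ℝ) with hσ
    have hσ0 : 0 ≤ σ := Finset.sum_nonneg fun _ _ => Nat.cast_nonneg _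
    -- The vertices of N are left to induction. Each vertex of M has at least |M| nonneighbours by
    -- the choice of v; a vertex counts as its own nonneighbour, so v ∈ M.
    have h2 : σ + (M.card : ℝ) ^ 2 ≤
        ∑ w ∈ S, ((S.filter fun w' => ¬ G.Adj w w').card : ℝ) := by
      rw [← Finset.sum_filter_add_sum_filter_not S (G.Adj v)]
      refine add_le_add (Finset.sum_le_sum fun w _ => ?_) ?_
      · exact_mod_cast Finset.card_le_card
          (Finset.filter_subset_filter _ (Finset.filter_subset _ _))
      · have := Finset.card_nsmul_le_sum M
          (fun w => ((S.filter fun w' => ¬ G.Adj w w').card : ℝ)) M.card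
          (fun w hw => by exact_mod_cast hmin w (Finset.mem_filter.1 hw).1)
        rw [nsmul_eq_mul] at this
        nlinarith
    have hr : (0 : ℝ) ≤ r := Nat.cast_nonneg _
    rw [← hNM]
    push_cast
    exact (add_sq_le_of_sq_le hr hσ0 h1).trans
      (mul_le_mul_of_nonneg_left h2 (by linarith))

/-- The `t`-tuples of pairwise nonadjacent, not necessarily distinct, elements of `S`. -/
def tuples (G : SimpleGraph V) (t : ℕ) (S : Finset V) : Finset (Fin t → V) :=
  (Fintype.piFinset fun _ => S).filter fun f => ∀ i j, ¬ G.Adj (f i) (f j)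

theorem sum_tuples_le (t : ℕ) (S : Finset V) :
    ∑ v ∈ S, (tuples G t (S.filter fun w => ¬ G.Adj v w)).card ≤ (tuples G (t + 1) S).card := by
  rw [← Finset.card_sigma]
  refine Finset.card_le_card_of_injOn (fun p => Fin.cons p.1 p.2) ?_ ?_
  · rintro ⟨v, f⟩ h
    simp only [Finset.coe_sigma, Set.mem_sigma_iff, Finset.mem_coe, tuples, Finset.mem_filter,
      Fintype.mem_piFinset] at h ⊢
    obtain ⟨hv, hf, hind⟩ := h
    refine ⟨Fin.cases hv fun i => (hf i).1, ?_⟩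
    refine Fin.cases ?_ fun i => ?_
    · exact Fin.cases (G.loopless.irrefl _) fun j => (hf j).2
    · exact Fin.cases (fun h => (hf i).2 h.symm) fun j => hind i j
  · rintro ⟨v, f⟩ _ ⟨w, g⟩ _ h
    have := Fin.cons_injective2 h
    simp only [Sigma.mk.injEq]
    exact ⟨this.1, heq_of_eq this.2⟩

/-- After the first entry v, the others form a tuple of nonneighbours of v. By Turán's theorem v has
at least |S| / r nonneighbours on average, and by the power mean inequality the passage from t to t
+ 1 costs a factor r ^ t. -/
theorem pow_card_le_tuples {r : ℕ} (t : ℕ) : ∀ {S : Finset V}, CliqueLE G S r →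
    (S.card : ℝ) ^ t ≤ (r : ℝ) ^ (t * (t - 1) / 2) * (tuples G t S).card := by
  induction t with
  | zero =>
    intro S _
    simp [tuples]
  | succ t ih =>
    intro S hS
    rcases S.eq_empty_or_nonempty with rfl | hne
    · simp only [Finset.card_empty, Nat.cast_zero]
      rw [zero_pow (Nat.succ_ne_zero t)]
      positivity
    have hy : (0 : ℝ) < S.card := by exact_mod_cast hne.card_pos
    set c : V → ℝ := fun v => ((S.filter fun w => ¬ G.Adj v w).card : ℝ) with hc
    have h1 : (S.card : ℝ) ^ (t + 1) ≤ (r : ℝ) ^ t * ∑ v ∈ S, c v ^ t := by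
      rcases t with _ | n
      · simp
      have hj := pow_sum_div_card_le_sum_pow (s := S) (f := c) (fun i _ => Nat.cast_nonneg _) n
      rw [div_le_iff₀ (by positivity)] at hj
      have ht := pow_le_pow_left₀ (by positivity) (sq_card_le_mul_sum hS) (n + 1)
      rw [mul_pow] at ht
      have : (S.card : ℝ) ^ n * (S.card : ℝ) ^ (n + 2) ≤
          (S.card : ℝ) ^ n * ((r : ℝ) ^ (n + 1) * ∑ v ∈ S, c v ^ (n + 1)) := by
        calc (S.card : ℝ) ^ n * (S.card : ℝ) ^ (n + 2) = ((S.card : ℝ) ^ 2) ^ (n + 1) := by ring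
          _ ≤ _ := ht
          _ ≤ (r : ℝ) ^ (n + 1) * ((∑ v ∈ S, c v ^ (n + 1)) * (S.card : ℝ) ^ n) := by gcongr
          _ = _ := by ring
      exact le_of_mul_le_mul_left this (by positivity)
    have h2 : ∑ v ∈ S, c v ^ t ≤ (r : ℝ) ^ (t * (t - 1) / 2) * (tuples G (t + 1) S).card := by
      calc ∑ v ∈ S, c v ^ t ≤ ∑ v ∈ S, (r : ℝ) ^ (t * (t - 1) / 2) *
            (tuples G t (S.filter fun w => ¬ G.Adj v w)).card :=
            Finset.sum_le_sum fun v _ => ih (hS.mono (Finset.filter_subset _ _))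
        _ = (r : ℝ) ^ (t * (t - 1) / 2) *
            (∑ v ∈ S, (tuples G t (S.filter fun w => ¬ G.Adj v w)).card : ℕ) := by
            push_cast; rw [Finset.mul_sum]
        _ ≤ _ := by gcongr; exact sum_tuples_le t S
    have e : (t + 1) * (t + 1 - 1) / 2 = t + t * (t - 1) / 2 := by
      rcases t with _ | n
      · simp
      · have : (n + 1 + 1) * (n + 1 + 1 - 1) = (n + 1) * (n + 1 - 1) + 2 * (n + 1) := by
          simp only [Nat.add_sub_cancel]; ring
        rw [this, Nat.add_mul_div_left _ _ (by norm_num)]; ring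
    rw [e, pow_add (r : ℝ), mul_assoc]
    exact h1.trans (by gcongr)

/-- The range of a tuple is an independent set of size at most t, and is the range of at most t ^ t
tuples; the power of max 1 (1 / x) compensates for the fugacity. -/
theorem tuples_card_le (t : ℕ) (S : Finset V) {x : ℝ} (hx : 0 < x) :
    ((tuples G t S).card : ℝ) ≤ (t : ℝ) ^ t * (max 1 (1 / x)) ^ t * part G S x := by
  have hmap : ∀ f ∈ tuples G t S, Finset.univ.image f ∈
      (ind G S).filter fun I => I.card ≤ t := by
    intro f hf
    simp only [tuples, Finset.mem_filter, Fintype.mem_piFinset] at hf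
    simp only [Finset.mem_filter, mem_ind]
    refine ⟨⟨?_, ?_⟩, Finset.card_image_le.trans (by simp)⟩
    · intro a ha
      obtain ⟨i, _, rfl⟩ := Finset.mem_image.1 ha
      exact hf.1 i
    · intro a ha b hb
      obtain ⟨i, _, rfl⟩ := Finset.mem_image.1 ha
      obtain ⟨j, _, rfl⟩ := Finset.mem_image.1 hb
      exact hf.2 i j
  have h1 := Finset.card_le_mul_card_image_of_maps_to hmap (t ^ t) (by
    intro I hI
    calc _ ≤ (Fintype.piFinset fun _ : Fin t => I).card := by
          refine Finset.card_le_card fun f hf => ?_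
          simp only [Finset.mem_filter] at hf
          rw [Fintype.mem_piFinset]
          intro i
          rw [← hf.2]
          exact Finset.mem_image_of_mem f (Finset.mem_univ i)
      _ = I.card ^ t := by simp
      _ ≤ t ^ t := Nat.pow_le_pow_left (Finset.mem_filter.1 hI).2 t)
  have h2 : (((ind G S).filter fun I => I.card ≤ t).card : ℝ) ≤
      (max 1 (1 / x)) ^ t * part G S x := by
    rw [part, Finset.mul_sum, Finset.card_eq_sum_ones, Nat.cast_sum]
    refine (Finset.sum_le_sum fun I hI => ?_).trans
      (Finset.sum_le_sum_of_subset_of_nonneg (Finset.filter_subset _ _)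
        fun I _ _ => by positivity)
    have hI := (Finset.mem_filter.1 hI).2
    have hk : (1 : ℝ) ≤ max 1 (1 / x) := le_max_left _ _
    calc ((1 : ℕ) : ℝ) = (1 / x) ^ I.card * x ^ I.card := by
          rw [← mul_pow, one_div_mul_cancel hx.ne', one_pow, Nat.cast_one]
      _ ≤ (max 1 (1 / x)) ^ I.card * x ^ I.card := by gcongr; exact le_max_right _ _
      _ ≤ _ := by gcongr
  calc ((tuples G t S).card : ℝ)
      ≤ (t : ℝ) ^ t * ((ind G S).filter fun I => I.card ≤ t).card := by exact_mod_cast h1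
    _ ≤ (t : ℝ) ^ t * ((max 1 (1 / x)) ^ t * part G S x) := by gcongr
    _ = _ := by ring

end Basic

/-! ### Small independent sets are rare when the partition function is large -/

section Estimates

open Filter Real

theorem small_mono {V : Type*} {G : SimpleGraph V} {S : Finset V} {x s s' : ℝ} (hx : 0 ≤ x)
    (h : s ≤ s') : small G S x s ≤ small G S x s' :=
  Finset.sum_le_sum_of_subset_of_nonneg
    (fun _ hI => Finset.mem_filter.2 ⟨(Finset.mem_filter.1 hI).1,
      (Finset.mem_filter.1 hI).2.trans h⟩) fun _ _ _ => pow_nonneg hx _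

theorem log_part_le {V : Type*} {G : SimpleGraph V} {S : Finset V} {x : ℝ} (hx : 0 ≤ x) :
    log (part G S x) ≤ x * S.card := by
  rw [← log_exp (x * S.card)]
  exact log_le_log (part_pos S hx) (part_le_exp S hx)

theorem eventually_mul_log_add_le {c : ℝ} (hc : 0 < c) (a C : ℝ) :
    ∀ᶠ z : ℝ in atTop, a * log z + C ≤ c * z := by
  have h1 : (fun z : ℝ => a * log z + C) =o[atTop] (id : ℝ → ℝ) :=
    (isLittleO_log_id_atTop.const_mul_left a).add (Asymptotics.isLittleO_const_id_atTop C)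
  filter_upwards [h1.def hc, eventually_ge_atTop 0] with z hz hz0
  rw [id, norm_of_nonneg hz0] at hz
  exact (le_abs_self _).trans hz

theorem tuples_log_le {V : Type*} {G : SimpleGraph V} {S : Finset V} {x : ℝ} (hx : 0 < x)
    {r t : ℕ} (hr : 2 ≤ r) (hS : CliqueLE G S r) (hy : 0 < S.card) (ht : 0 < t) :
    t * log S.card ≤ t * (t - 1) / 2 * log r + t * log t + t * log (max 1 (1 / x)) +
      log (part G S x) := by
  have h := (pow_card_le_tuples t hS).trans
    (mul_le_mul_of_nonneg_left (tuples_card_le t S hx) (by positivity))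
  have hy' : (0 : ℝ) < S.card := by exact_mod_cast hy
  have ht' : (0 : ℝ) < t := by exact_mod_cast ht
  have hr' : (0 : ℝ) < r := by positivity
  have hlr : 0 ≤ log r := log_nonneg (by exact_mod_cast (by omega : 1 ≤ r))
  have hZ := part_pos (G := G) S hx.le
  have h2 := log_le_log (by positivity) h
  rw [log_mul (by positivity) (by positivity), log_mul (by positivity) hZ.ne',
    log_mul (by positivity) (by positivity), log_pow, log_pow, log_pow, log_pow] at h2
  have h3 : ((t * (t - 1) / 2 : ℕ) : ℝ) ≤ t * (t - 1) / 2 := by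
    refine Nat.cast_div_le.trans ?_
    rw [Nat.cast_mul, Nat.cast_sub ht]
    simp
  have h4 := mul_le_mul_of_nonneg_right h3 hlr
  linarith

/-- Supersaturation: a graph with small cliques has many independent sets. -/
theorem exists_log_sq_le {x : ℝ} (hx : 0 < x) :
    ∃ y₀ : ℝ, ∀ (V : Type u) (G : SimpleGraph V) (S : Finset V) (r : ℕ), 2 ≤ r →
      CliqueLE G S r → y₀ ≤ S.card →
      0.37 * log S.card ^ 2 ≤ log r * log (part G S x) := by
  obtain ⟨ℓ₀, hℓ₀⟩ := eventually_atTop.1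
    (eventually_mul_log_add_le (c := 0.01) (by norm_num) 1 (log (max 1 (1 / x))))
  refine ⟨exp (max ℓ₀ 4), fun V G S r hr hS hy => ?_⟩
  have hy0 : (0 : ℝ) < S.card := (exp_pos _).trans_le hy
  have hℓ : max ℓ₀ 4 ≤ log S.card := (le_log_iff_exp_le hy0).2 hy
  have hev := hℓ₀ _ ((le_max_left _ _).trans hℓ)
  have h4 : 4 ≤ log S.card := (le_max_right _ _).trans hℓ
  set ℓ := log S.card with hℓdef
  have hl2 : 0.69 < log 2 := by linarith [log_two_gt_d9]
  have hlr : log 2 ≤ log r := log_le_log (by norm_num) (by exact_mod_cast hr)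
  have hlr0 : 0 < log r := by linarith
  set L := ℓ / log r with hL
  have hLr : L * log r = ℓ := div_mul_cancel₀ _ hlr0.ne'
  have hL0 : 0 ≤ L := by positivity
  -- As t - 1 ≤ L / 2, the Turán loss is at most ℓ / 4 per entry; the remaining losses are 0.01 ℓ
  -- per entry, so 0.74 ℓ is kept for each of the t > L / 2 entries. The added 1 keeps t positive
  -- when r is so large that L < 2.
  set t : ℕ := ⌊L / 2⌋₊ + 1 with ht
  have ht1 : L / 2 < t := by rw [ht]; push_cast; exact Nat.lt_floor_add_one _
  have ht2 : (t : ℝ) ≤ L / 2 + 1 := by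
    rw [ht]; push_cast; linarith [Nat.floor_le (by positivity : 0 ≤ L / 2)]
  have ht0 : (0 : ℝ) < t := by linarith
  have hmain := tuples_log_le hx hr hS (by exact_mod_cast hy0) (by omega : 0 < t)
  have hLℓ : L * 0.69 ≤ ℓ := by rw [← hLr]; gcongr; linarith
  have htℓ : (t : ℝ) ≤ ℓ := by linarith
  have hlt : log t ≤ log ℓ := log_le_log ht0 htℓ
  have h5 : (t : ℝ) * (t - 1) / 2 * log r ≤ t * (ℓ / 4) := by
    have : ((t : ℝ) - 1) * log r ≤ L / 2 * log r := by gcongr; linarith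
    calc (t : ℝ) * (t - 1) / 2 * log r = t * ((t - 1) * log r) / 2 := by ring
      _ ≤ t * (L / 2 * log r) / 2 := by gcongr
      _ = t * (L * log r) / 4 := by ring
      _ = t * (ℓ / 4) := by rw [hLr]; ring
  have h6 : (t : ℝ) * (log t + log (max 1 (1 / x))) ≤ t * (0.01 * ℓ) := by
    gcongr; linarith
  have h7 : (t : ℝ) * (0.74 * ℓ) ≤ log (part G S x) := by linarith
  have h8 : L / 2 * (0.74 * ℓ) ≤ log (part G S x) := by
    refine le_trans ?_ h7
    gcongr
  calc 0.37 * ℓ ^ 2 = log r * (L / 2 * (0.74 * ℓ)) := by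
        linear_combination (-0.37 * ℓ) * hLr
    _ ≤ _ := by gcongr

/-- The Ramsey-type bound, in which the size A of an independent set satisfies (1 + x) ^ A ≤ Z
because all its subsets contribute to Z. -/
theorem log_card_le {V : Type*} {G : SimpleGraph V} {S : Finset V} {x : ℝ} (hx : 0 < x)
    {r : ℕ} (hS : CliqueLE G S r) (hy : 0 < S.card) :
    log S.card ≤ r * log (log (part G S x) / log (1 + x) + 1) := by
  have hc : 0 < log (1 + x) := log_pos (by linarith)
  have hz : 0 ≤ log (part G S x) := log_nonneg (one_le_part S hx.le)
  have hA : ∀ I ∈ ind G S, I.card ≤ ⌊log (part G S x) / log (1 + x)⌋₊ := by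
    intro I hI
    refine Nat.le_floor ?_
    rw [le_div_iff₀ hc, ← log_pow]
    exact log_le_log (by positivity) (pow_card_le_part hI hx.le)
  have h := card_add_one_le_pow hS hA
  have hy' : (0 : ℝ) < S.card := by exact_mod_cast hy
  rw [← log_pow]
  refine log_le_log hy' ?_
  have h1 : (S.card : ℝ) + 1 ≤ ((⌊log (part G S x) / log (1 + x)⌋₊ : ℝ) + 1) ^ r := by
    exact_mod_cast h
  refine (by linarith : (S.card : ℝ) ≤ (S.card : ℝ) + 1).trans (h1.trans ?_)
  gcongr
  exact Nat.floor_le (by positivity)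

-- Chernoff's bound at fugacity μ = z / (w |S|), where z = log Z and w = log z. The term μ |S| = z /
-- w is negligible, and log (x / μ) is at most about r w - w by `log_card_le`. The summand -w, due
-- to the factor z in μ, is what yields r - 1, hence ω - 2, in place of r.
set_option maxHeartbeats 1000000 in
theorem exists_small_le_one {x ε : ℝ} (hx : 0 < x) (hε : 0 < ε) (hε1 : ε < 1) :
    ∃ z₀ : ℝ, ∀ (V : Type u) (G : SimpleGraph V) (S : Finset V) (r : ℕ), 2 ≤ r →
      CliqueLE G S r → z₀ ≤ log (part G S x) →
      small G S x ((1 - ε) * log (part G S x) / ((r - 1) * log (log (part G S x)))) ≤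
        ε * part G S x := by
  set c := log (1 + x) with hcdef
  have hc : 0 < c := log_pos (by linarith)
  set C := log (1 / c + 1) with hCdef
  have hC : 0 ≤ C := log_nonneg (by have : 0 < 1 / c := by positivity
                                    linarith)
  set D := |log x| + 2 * C with hD
  have hw : Tendsto (fun z : ℝ => log z) atTop atTop := tendsto_log_atTop
  obtain ⟨z₀, hz₀⟩ := eventually_atTop.1
    ((eventually_ge_atTop 1).and ((hw.eventually (eventually_ge_atTop (max 1 (4 / ε)))).and
      ((hw.eventually (eventually_mul_log_add_le (c := ε / 4) (by positivity) 1 D)).and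
      ((hw.eventually (eventually_ge_atTop (1 / x))).and
      (eventually_ge_atTop (2 / ε * (-log ε)))))))
  refine ⟨z₀, fun V G S r hr hS hz => ?_⟩
  obtain ⟨hz1, hw1, hwD, hwx, hzε⟩ := hz₀ _ hz
  have hZ := part_pos (G := G) S hx.le
  have hzy := log_part_le (G := G) (S := S) hx.le
  set z := log (part G S x) with hzdef
  set w := log z with hwdef
  have hw2 : 1 ≤ w := (le_max_left _ _).trans hw1
  have hw3 : 4 / ε ≤ w := (le_max_right _ _).trans hw1
  have hz0 : 0 < z := by linarith
  have hw0 : 0 < w := by linarith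
  have hy : (0 : ℝ) < S.card := by
    by_contra hcon
    have : (S.card : ℝ) = 0 := le_antisymm (not_lt.1 hcon) (Nat.cast_nonneg _)
    rw [this] at hzy
    linarith
  have hr1 : (1 : ℝ) ≤ (r : ℝ) - 1 := by
    have : (2 : ℝ) ≤ r := by exact_mod_cast hr
    linarith
  have hly := log_card_le hx hS (by exact_mod_cast hy)
  rw [← hzdef, ← hcdef] at hly
  have hlz : log (z / c + 1) ≤ w + C := by
    rw [hwdef, hCdef, ← log_mul hz0.ne' (by positivity)]
    refine log_le_log (by positivity) ?_
    rw [mul_add, mul_one, mul_one_div]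
    linarith
  set s := (1 - ε) * z / ((r - 1) * w) with hs
  have hs0 : 0 ≤ s := div_nonneg (mul_nonneg (by linarith) hz0.le) (by positivity)
  have hμ : z / (w * S.card) ≤ x := by
    rw [div_le_iff₀ (by positivity)]
    calc z ≤ 1 * (x * S.card) := by linarith
      _ ≤ w * (x * S.card) := by gcongr
      _ = _ := by ring
  have h := small_le_exp (G := G) S (s := s) (by positivity : 0 < z / (w * S.card)) hμ
  refine h.trans ?_
  have e1 : z / (w * S.card) * S.card = z / w := by field_simp
  have e2 : log (x / (z / (w * S.card))) = log x + log w + log S.card - w := by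
    rw [div_div_eq_mul_div, log_div (by positivity) hz0.ne', log_mul hx.ne' (by positivity),
      log_mul hw0.ne' hy.ne']
    ring
  have hlw : 0 ≤ log w := log_nonneg hw2
  have h2 : log x + log w + log S.card - w ≤ (r - 1) * (w + D + log w) := by
    have a1 : log S.card ≤ r * (w + C) := hly.trans (by gcongr)
    have a2 := le_abs_self (log x)
    have a3 : 0 ≤ |log x| + log w := by positivity
    have a4 := mul_le_mul_of_nonneg_right hr1 a3
    have a5 := mul_le_mul_of_nonneg_right hr1 hC
    rw [hD]
    nlinarith
  have h3 : s * (log x + log w + log S.card - w) ≤ (1 - ε) * z * (1 + ε / 4) := by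
    calc _ ≤ s * ((r - 1) * (w + D + log w)) := by gcongr
      _ = (1 - ε) * z * ((w + (log w + D)) / w) := by
        rw [hs]; field_simp; ring
      _ ≤ _ := by
        have : 0 ≤ (1 - ε) * z := mul_nonneg (by linarith) hz0.le
        gcongr
        rw [div_le_iff₀ hw0]
        linarith
  have h4 : z / w ≤ ε / 4 * z := by
    rw [div_le_iff₀ hw0]
    rw [div_le_iff₀ hε] at hw3
    nlinarith
  have h5 : z / w + s * (log x + log w + log S.card - w) ≤ log ε + z := by
    rw [div_mul_eq_mul_div, div_le_iff₀ hε] at hzε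
    have e3 : (1 - ε) * z * (1 + ε / 4) = z - 3 / 4 * (ε * z) - ε * ε * z / 4 := by ring
    have e4 : 0 < ε * ε * z := by positivity
    rw [e3] at h3
    linarith
  rw [e1, e2]
  calc _ ≤ exp (log ε + z) := exp_le_exp.2 h5
    _ = ε * part G S x := by rw [exp_add, exp_log hε, hzdef, exp_log hZ]

-- Chernoff's bound at fugacity 1 / |S|, so that the linear term is only 1, with log |S| controlled
-- by supersaturation.
set_option maxHeartbeats 1000000 in
theorem exists_small_le_two {x ε : ℝ} (hx : 0 < x) (hε : 0 < ε) :
    ∃ z₀ : ℝ, ∀ (V : Type u) (G : SimpleGraph V) (S : Finset V) (r : ℕ), 2 ≤ r →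
      CliqueLE G S r → z₀ ≤ log (part G S x) →
      small G S x (1 / 2 * √(log (part G S x) / log r)) ≤ ε * part G S x := by
  obtain ⟨y₀, hy₀⟩ := exists_log_sq_le.{u} hx
  refine ⟨max (max 1 (x * y₀)) (max ((100 * |log x|) ^ 2) ((1 - log ε) / 0.16)),
    fun V G S r hr hS hz => ?_⟩
  have hz1 := (le_max_left _ _).trans ((le_max_left _ _).trans hz)
  have hz2 := (le_max_right _ _).trans ((le_max_left _ _).trans hz)
  have hz3 := (le_max_left _ _).trans ((le_max_right _ _).trans hz)
  have hz4 := (le_max_right _ _).trans ((le_max_right _ _).trans hz)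
  have hZ := part_pos (G := G) S hx.le
  have hzy := log_part_le (G := G) (S := S) hx.le
  have hy1 : y₀ ≤ S.card := le_of_mul_le_mul_left (hz2.trans hzy) hx
  have hsq := hy₀ V G S r hr hS hy1
  set z := log (part G S x) with hzdef
  have hz0 : 0 < z := by linarith
  have hxy : 1 ≤ x * S.card := hz1.trans hzy
  have hy : (0 : ℝ) < S.card := by
    by_contra hcon
    have : (S.card : ℝ) = 0 := le_antisymm (not_lt.1 hcon) (Nat.cast_nonneg _)
    rw [this] at hzy
    linarith
  have hl2 : 0.69 < log 2 := by linarith [log_two_gt_d9]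
  have hlr : log 2 ≤ log r := log_le_log (by norm_num) (by exact_mod_cast hr)
  have hlr0 : 0 < log r := by linarith
  set s := 1 / 2 * √(z / log r) with hs
  have hs0 : 0 ≤ s := by positivity
  have hs2 : s ^ 2 * (4 * log r) = z := by
    rw [hs, mul_pow, sq_sqrt (by positivity)]
    field_simp
    norm_num
  have hsz : s ≤ √z := by
    refine le_sqrt_of_sq_le ?_
    nlinarith [sq_nonneg s]
  have h := small_le_exp (G := G) S (s := s) (by positivity : 0 < 1 / (S.card : ℝ))
    (by rw [div_le_iff₀ hy]; exact hxy : 1 / (S.card : ℝ) ≤ x)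
  refine h.trans ?_
  have e2 : log (x / (1 / (S.card : ℝ))) = log x + log S.card := by
    rw [div_div_eq_mul_div, div_one, log_mul hx.ne' hy.ne']
  rw [e2, one_div_mul_cancel hy.ne']
  have h1 : s * log x ≤ 0.01 * z := by
    have : 100 * |log x| ≤ √z := le_sqrt_of_sq_le hz3
    calc s * log x ≤ s * |log x| := by gcongr; exact le_abs_self _
      _ ≤ √z * (0.01 * √z) := by gcongr; linarith
      _ = 0.01 * z := by rw [mul_left_comm, mul_self_sqrt hz0.le]
  -- The square of the left side is at most z² / (4 · 0.37). Any constant above 1/4 in place of 0.37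
  -- would make the factor of z less than 1.
  have h2 : s * log S.card ≤ 0.83 * z := by
    refine (abs_le_of_sq_le_sq' ?_ (by positivity)).2
    have : s ^ 2 * (0.37 * log S.card ^ 2) ≤ s ^ 2 * (log r * z) := by gcongr
    have e : s ^ 2 * (log r * z) = z ^ 2 / 4 := by linear_combination (z / 4) * hs2
    rw [e] at this
    nlinarith [sq_nonneg z]
  rw [div_le_iff₀ (by norm_num)] at hz4
  calc _ ≤ exp (log ε + z) := exp_le_exp.2 (by linarith)
    _ = ε * part G S x := by rw [exp_add, exp_log hε, hzdef, exp_log hZ]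

/-- The two possible values of the ratio of the number of colours to the degree. -/
def IsRatio (om : ℕ) (M f : ℝ) : Prop :=
  f = (om - 2) * (log (log M) / log M) ∨ f = 2 * √(log (om - 1) / log M)

-- The common source of all bounds. Since s and Z₀ depend only on M, `om` and f, the conclusion
-- applies at once to all subsets of a neighbourhood, in the graph itself or in the graph of a
-- cover. The choice Z₀ = M ^ (1 - e) keeps log Z₀ close to log M, so that 1 / s is close to f,
-- while Z₀ is negligible against f M ≥ M / log M.
set_option maxHeartbeats 1000000 in
theorem exists_threshold {x ε : ℝ} (hx : 0 < x) (hε : 0 < ε) :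
    ∃ M₀ : ℝ, exp 1 < M₀ ∧ ∀ M : ℝ, M₀ ≤ M → ∀ om : ℕ, 3 ≤ om → ∀ f : ℝ, IsRatio om M f →
      ∃ s Z₀ : ℝ, 0 < s ∧ 1 ≤ Z₀ ∧ 0 < f ∧ 1 / s ≤ (1 + ε) * f ∧ Z₀ ≤ ε * f * M ∧
        ∀ (V : Type u) (G : SimpleGraph V) (S : Finset V), CliqueLE G S (om - 1) →
          Z₀ ≤ part G S x → small G S x s ≤ ε * part G S x := by
  obtain ⟨e, he0, he1, he2⟩ : ∃ e : ℝ, 0 < e ∧ 8 * e ≤ 1 ∧ 8 * e ≤ ε := by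
    have hmin : 0 < min ε 1 := lt_min hε one_pos
    exact ⟨min ε 1 / 8, by positivity, by linarith [min_le_right ε 1],
      by linarith [min_le_left ε 1]⟩
  have h1e : 0 < 1 - e := by linarith
  have he3 : 1 ≤ (1 + ε) * (1 - e) ^ 2 := by
    have : 1 ≤ (1 + 8 * e) * (1 - e) ^ 2 := by nlinarith [pow_pos he0 3]
    exact this.trans (by gcongr)
  have he4 : 1 ≤ (1 + ε) * (1 - e) := by
    have : 1 ≤ (1 + 8 * e) * (1 - e) := by nlinarith
    exact this.trans (by gcongr)
  have he5 : (1 - e) ^ 2 ≤ 1 - e := by nlinarith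
  obtain ⟨z₁, hz₁⟩ := exists_small_le_one.{u} hx he0 (by linarith)
  obtain ⟨z₂, hz₂⟩ := exists_small_le_two.{u} hx he0
  obtain ⟨q₀, hq₀⟩ := eventually_atTop.1
    (((eventually_ge_atTop (2 * max (max z₁ z₂) (exp 1))).and
      (tendsto_log_atTop.eventually (eventually_ge_atTop 1))).and
      (eventually_mul_log_add_le he0 1 (-log ε)))
  refine ⟨exp (max q₀ 2), exp_lt_exp.2 (by linarith [le_max_right q₀ 2]), fun M hM om hom => ?_⟩
  have hM0 : 0 < M := (exp_pos _).trans_le hM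
  have hq : max q₀ 2 ≤ log M := (le_log_iff_exp_le hM0).2 hM
  obtain ⟨⟨hq1, hq2⟩, hq3⟩ := hq₀ _ ((le_max_left _ _).trans hq)
  set q := log M with hqdef
  have hq4 : 2 ≤ q := (le_max_right _ _).trans hq
  have hq0 : 0 < q := by linarith
  have hMq : exp q = M := exp_log hM0
  set Z₀ := exp ((1 - e) * q) with hZ₀
  have hZ1 : 1 ≤ Z₀ := one_le_exp (mul_nonneg (by linarith) hq0.le)
  have hr : 2 ≤ om - 1 := by omega
  have hrc : ((om - 1 : ℕ) : ℝ) = (om : ℝ) - 1 := by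
    rw [Nat.cast_sub (by omega)]; simp
  have hom' : (3 : ℝ) ≤ om := by exact_mod_cast hom
  -- the lower bound for `f` that is needed in both cases
  have hZf : ∀ f : ℝ, 1 / q ≤ f → Z₀ ≤ ε * f * M := by
    intro f hf
    have : Z₀ = exp (-(e * q)) * M := by rw [← hMq, ← exp_add, hZ₀]; ring_nf
    rw [this]
    have h1 : exp (-(e * q)) ≤ exp (log ε - log q) := exp_le_exp.2 (by linarith)
    rw [exp_sub, exp_log hε, exp_log hq0] at h1
    have h2 : ε / q ≤ ε * f := by rw [div_eq_mul_one_div]; gcongr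
    gcongr
    exact h1.trans h2
  have hzlog : ∀ (V : Type u) (G : SimpleGraph V) (S : Finset V), Z₀ ≤ part G S x →
      (1 - e) * q ≤ log (part G S x) := by
    intro V G S h
    rw [le_log_iff_exp_le (part_pos S hx.le)]
    exact h
  have hhalf : q / 2 ≤ (1 - e) * q := by nlinarith
  have hqz : max (max z₁ z₂) (exp 1) ≤ (1 - e) * q := by linarith
  rintro f (rfl | rfl)
  · have hf : 1 / q ≤ ((om : ℝ) - 2) * (log q / q) := by
      calc 1 / q = 1 * (1 / q) := by ring
        _ ≤ _ := by gcongr <;> linarith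
    have hom2 : (0 : ℝ) < om - 2 := by linarith
    have hlq : 0 < log q := by linarith
    refine ⟨(1 - e) * ((1 - e) * (q / log q)) / (om - 2), Z₀, ?_, hZ1,
      (by positivity : 0 < 1 / q).trans_le hf, ?_, hZf _ hf, ?_⟩
    · positivity
    · have : 1 / ((1 - e) * ((1 - e) * (q / log q)) / ((om : ℝ) - 2)) =
          1 / (1 - e) ^ 2 * ((om - 2) * (log q / q)) := by field_simp
      rw [this]
      gcongr
      rw [div_le_iff₀ (by positivity)]
      exact he3
    · intro V G S hS hZ
      have hz := hzlog V G S hZ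
      have h := hz₁ V G S _ hr hS ((le_max_left _ _).trans ((le_max_left _ _).trans
        (hqz.trans hz)))
      refine (small_mono hx.le ?_).trans (h.trans ?_)
      · rw [hrc]
        set z := log (part G S x)
        have hze : exp 1 ≤ (1 - e) * q := (le_max_right _ _).trans hqz
        have hw : 1 ≤ log z := by
          rw [le_log_iff_exp_le ((exp_pos _).trans_le (hze.trans hz))]; exact hze.trans hz
        have hz0 : 0 < z := (exp_pos _).trans_le (hze.trans hz)
        have hqe : exp 1 ≤ q := hze.trans (by nlinarith)
        -- The size s must not depend on Z: z / log z increases from `exp 1` on, so z may be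
        -- replaced by its lower bound (1 - e) q.
        have hanti := log_div_self_antitoneOn (Set.mem_Ici.2 hze)
          (Set.mem_Ici.2 (hze.trans hz)) hz
        simp only at hanti
        have h2 : (1 - e) * (q / log q) ≤ z / log z := by
          have h3 : log ((1 - e) * q) ≤ log q :=
            log_le_log (by positivity) (by nlinarith)
          rw [div_le_div_iff₀ hz0 (by positivity)] at hanti
          rw [mul_div_assoc', div_le_div_iff₀ hlq (by linarith)]
          calc (1 - e) * q * log z = log z * ((1 - e) * q) := by ring
            _ ≤ _ := hanti
            _ ≤ log q * z := by gcongr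
            _ = _ := by ring
        calc (1 - e) * ((1 - e) * (q / log q)) / ((om : ℝ) - 2)
            ≤ (1 - e) * (z / log z) / ((om : ℝ) - 2) := by gcongr
          _ = _ := by
            have : (om : ℝ) - 1 - 1 = om - 2 := by ring
            rw [this]
            field_simp
      · have := part_pos (G := G) S hx.le
        gcongr
        linarith
  · have hl2 : 0.69 < log 2 := by linarith [log_two_gt_d9]
    have hlr : log 2 ≤ log ((om : ℝ) - 1) := log_le_log (by norm_num) (by linarith)
    have hlr0 : 0 < log ((om : ℝ) - 1) := by linarith
    have hf : 1 / q ≤ 2 * √(log ((om : ℝ) - 1) / q) := by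
      have : 1 / (2 * q) ≤ √(log ((om : ℝ) - 1) / q) := by
        refine le_sqrt_of_sq_le ?_
        rw [div_pow, div_le_div_iff₀ (by positivity) hq0]
        nlinarith
      calc 1 / q = 2 * (1 / (2 * q)) := by field_simp
        _ ≤ _ := by gcongr
    refine ⟨1 / 2 * √((1 - e) * q / log ((om : ℝ) - 1)), Z₀, by positivity, hZ1,
      (by positivity : 0 < 1 / q).trans_le hf, ?_, hZf _ hf, ?_⟩
    · have h2 : (1 - e) * (1 / √(log ((om : ℝ) - 1) / q)) ≤
          √((1 - e) * q / log ((om : ℝ) - 1)) := by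
        rw [mul_div_assoc, sqrt_mul h1e.le, ← inv_div (log ((om : ℝ) - 1)) q, sqrt_inv, one_div]
        gcongr
        exact le_sqrt_of_sq_le he5
      have h3 : 0 < √(log ((om : ℝ) - 1) / q) := by positivity
      rw [div_le_iff₀ (by positivity)]
      calc (1 : ℝ) ≤ (1 + ε) * (1 - e) := he4
        _ = (1 + ε) * (2 * √(log ((om : ℝ) - 1) / q)) *
            (1 / 2 * ((1 - e) * (1 / √(log ((om : ℝ) - 1) / q)))) := by field_simp
        _ ≤ _ := by gcongr
    · intro V G S hS hZ
      have hz := hzlog V G S hZ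
      have h := hz₂ V G S _ hr hS ((le_max_right _ _).trans ((le_max_left _ _).trans
        (hqz.trans hz)))
      rw [hrc] at h
      refine (small_mono hx.le ?_).trans (h.trans ?_)
      · gcongr
      · have := part_pos (G := G) S hx.le
        gcongr
        linarith

end Estimates

/-! ### Local occupancy and the occupancy fraction -/

section HardCore

/-- The set of neighbours of a vertex. -/
def nbrs {V : Type*} [Fintype V] (G : SimpleGraph V) (a : V) : Finset V :=
  Finset.univ.filter (G.Adj a)

theorem mem_nbrs {V : Type*} [Fintype V] {G : SimpleGraph V} {a b : V} :
    b ∈ nbrs G a ↔ G.Adj a b := by simp [nbrs]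

theorem card_nbrs {V : Type*} [Fintype V] (G : SimpleGraph V) (a : V) :
    (nbrs G a).card = G.degree a := by
  rw [← SimpleGraph.card_neighborFinset_eq_degree]
  congr 1
  ext b
  simp [mem_nbrs]

theorem LocalCliqueBound.cliqueLE {V : Type*} [Fintype V] {G : SimpleGraph V} {om : V → ℕ}
    (h : LocalCliqueBound G om) {a : V} {n : ℕ} (hn : om a ≤ n) :
    CliqueLE G (nbrs G a) (n - 1) := by
  intro Q hQ hc
  have haQ : a ∉ Q := fun h' => G.loopless.irrefl a (mem_nbrs.1 (hQ h'))
  have := (h a).2 (insert a Q) (by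
    rw [Finset.coe_insert]
    exact hc.insert fun b hb _ => mem_nbrs.1 (hQ hb)) (Finset.mem_insert_self _ _)
  rw [Finset.card_insert_of_notMem haQ] at this
  omega

/-- Either Z ≤ Z₀, or the sets with more than s elements carry a proportion of at least 1 - ε of Z
and the mean size is at least (1 - ε) s. -/
theorem part_le_add_of_small_le {V : Type*} {G : SimpleGraph V} {F : Finset V}
    {x s Z₀ ε : ℝ} (hx : 0 < x) (hs : 0 < s) (hZ₀ : 0 ≤ Z₀) (hε : ε < 1)
    (h : Z₀ ≤ part G F x → small G F x s ≤ ε * part G F x) :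
    part G F x ≤ Z₀ + 1 / ((1 - ε) * s) * ∑ Q ∈ ind G F, (Q.card : ℝ) * x ^ Q.card := by
  have h1 : 0 < 1 - ε := by linarith
  have hsum : 0 ≤ ∑ Q ∈ ind G F, (Q.card : ℝ) * x ^ Q.card :=
    Finset.sum_nonneg fun Q _ => by positivity
  rcases le_or_gt (part G F x) Z₀ with hZ | hZ
  · have : 0 ≤ 1 / ((1 - ε) * s) * ∑ Q ∈ ind G F, (Q.card : ℝ) * x ^ Q.card := by positivity
    linarith
  have h2 := h hZ.le
  have h3 : s * (part G F x - small G F x s) ≤ ∑ Q ∈ ind G F, (Q.card : ℝ) * x ^ Q.card := by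
    have e : part G F x - small G F x s =
        ∑ I ∈ (ind G F).filter (fun I => ¬ (I.card : ℝ) ≤ s), x ^ I.card := by
      rw [part, small, ← Finset.sum_filter_add_sum_filter_not (ind G F)
        (fun I => (I.card : ℝ) ≤ s)]
      ring
    rw [e, Finset.mul_sum]
    refine (Finset.sum_le_sum fun I hI => ?_).trans
      (Finset.sum_le_sum_of_subset_of_nonneg (Finset.filter_subset _ _)
        fun I _ _ => by positivity)
    have := (Finset.mem_filter.1 hI).2
    gcongr
    exact (not_le.1 this).le
  have h4 : s * ((1 - ε) * part G F x) ≤ s * (part G F x - small G F x s) := by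
    gcongr; linarith
  have h5 : part G F x ≤ 1 / ((1 - ε) * s) * ∑ Q ∈ ind G F, (Q.card : ℝ) * x ^ Q.card := by
    rw [one_div_mul_eq_div, le_div_iff₀ (by positivity)]
    linarith
  linarith

variable {V : Type*} [Fintype V] {G : SimpleGraph V}

/-- If I has no neighbour of a, then a can be inserted or removed freely, so a is present with
conditional probability x / (1 + x). -/
theorem sum_avoid_nbrs_le {S : Finset V} {a : V} (ha : a ∈ S) {x : ℝ} (hx : 0 < x) :
    ∑ I ∈ (ind G S).filter (fun I => Disjoint I (nbrs G a)), x ^ I.card ≤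
      (1 + x) / x * ∑ I ∈ (ind G S).filter (fun I => a ∈ I), x ^ I.card := by
  set B := ∑ I ∈ (ind G S).filter (fun I => a ∈ I), x ^ I.card with hB
  rw [← Finset.sum_filter_add_sum_filter_not _ (fun I => a ∈ I)]
  have h1 : ∑ I ∈ ((ind G S).filter (fun I => Disjoint I (nbrs G a))).filter (fun I => a ∈ I),
      x ^ I.card ≤ B := by
    refine Finset.sum_le_sum_of_subset_of_nonneg ?_ fun I _ _ => by positivity
    intro I hI
    simp only [Finset.mem_filter] at hI ⊢
    exact ⟨hI.1.1, hI.2⟩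
  have h2 : x * ∑ I ∈ ((ind G S).filter (fun I => Disjoint I (nbrs G a))).filter
      (fun I => a ∉ I), x ^ I.card ≤ B := by
    rw [Finset.mul_sum]
    set T := ((ind G S).filter (fun I => Disjoint I (nbrs G a))).filter (fun I => a ∉ I) with hT
    have hinj : Set.InjOn (fun I : Finset V => insert a I) (T : Set (Finset V)) := by
      intro I hI J hJ hIJ
      have h1 : a ∉ I := (Finset.mem_filter.1 hI).2
      have h2 : a ∉ J := (Finset.mem_filter.1 hJ).2
      have := congrArg (fun K => Finset.erase K a) hIJ
      simpa [Finset.erase_insert h1, Finset.erase_insert h2] using this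
    have e : ∑ I ∈ T, x * x ^ I.card = ∑ I ∈ T.image (fun I => insert a I), x ^ I.card := by
      rw [Finset.sum_image hinj]
      refine Finset.sum_congr rfl fun I hI => ?_
      rw [Finset.card_insert_of_notMem (Finset.mem_filter.1 hI).2, pow_succ']
    rw [e]
    refine Finset.sum_le_sum_of_subset_of_nonneg ?_ fun I _ _ => by positivity
    intro K hK
    obtain ⟨I, hI, rfl⟩ := Finset.mem_image.1 hK
    simp only [hT, Finset.mem_filter, mem_ind] at hI
    obtain ⟨⟨⟨hIS, hIi⟩, hdisj⟩, _⟩ := hI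
    rw [Finset.disjoint_left] at hdisj
    simp only [Finset.mem_filter, mem_ind, Finset.mem_insert_self, and_true]
    refine ⟨Finset.insert_subset ha hIS, fun b hb c hc => ?_⟩
    rcases Finset.mem_insert.1 hb with hb' | hb' <;> rcases Finset.mem_insert.1 hc with hc' | hc'
    · rw [hb', hc']; exact G.loopless.irrefl _
    · rw [hb']; exact fun h => hdisj hc' (mem_nbrs.2 h)
    · rw [hc']; exact fun h => hdisj hb' (mem_nbrs.2 h.symm)
    · exact hIi b hb' c hc'
  have h3 : ∑ I ∈ ((ind G S).filter (fun I => Disjoint I (nbrs G a))).filter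
      (fun I => a ∉ I), x ^ I.card ≤ 1 / x * B := by
    rw [one_div_mul_eq_div, le_div_iff₀ hx, mul_comm]
    exact h2
  have e : (1 + x) / x * B = B + 1 / x * B := by field_simp; ring
  rw [e]
  exact add_le_add h1 h3

/-- Local occupancy in the neighbourhood of `a` gives a lower bound for the occupancy of the
closed neighbourhood of `a`. -/
theorem part_le_occupancy {S : Finset V} {a : V} (ha : a ∈ S) {x Z₀ γ : ℝ} (hx : 0 < x)
    (hZ₀ : 0 ≤ Z₀)
    (h : ∀ F ⊆ nbrs G a,
      part G F x ≤ Z₀ + γ * ∑ Q ∈ ind G F, (Q.card : ℝ) * x ^ Q.card) :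
    part G S x ≤ (1 + x) / x * Z₀ * ∑ I ∈ (ind G S).filter (fun I => a ∈ I), x ^ I.card +
      γ * ∑ I ∈ ind G S, ((I ∩ nbrs G a).card : ℝ) * x ^ I.card := by
  set U := S ∩ nbrs G a with hU
  have hUS : U ⊆ S := Finset.inter_subset_left
  have hJ : ∀ J ∈ ind G (S \ U), Disjoint J (nbrs G a) := by
    intro J hJ
    rw [Finset.disjoint_left]
    intro y hy hy'
    have := Finset.mem_sdiff.1 ((mem_ind.1 hJ).1 hy)
    exact this.2 (Finset.mem_inter.2 ⟨this.1, hy'⟩)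
  -- The weight of J alone is that of the outcome in which no neighbour of a is occupied; this is
  -- what the term Z₀ is charged to.
  have h1 : ∑ J ∈ ind G (S \ U), x ^ J.card ≤
      ∑ I ∈ (ind G S).filter (fun I => Disjoint I (nbrs G a)), x ^ I.card := by
    refine Finset.sum_le_sum_of_subset_of_nonneg ?_ fun I _ _ => by positivity
    intro J hJ'
    have hJS : J ∈ ind G S :=
      mem_ind.2 ⟨(mem_ind.1 hJ').1.trans Finset.sdiff_subset, (mem_ind.1 hJ').2⟩
    exact Finset.mem_filter.2 ⟨hJS, hJ J hJ'⟩
  have h2 : ∑ I ∈ ind G S, ((I ∩ nbrs G a).card : ℝ) * x ^ I.card =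
      ∑ J ∈ ind G (S \ U), x ^ J.card *
        ∑ Q ∈ ind G (free G U J), (Q.card : ℝ) * x ^ Q.card := by
    rw [sum_ind_fiber hUS]
    refine Finset.sum_congr rfl fun J hJ' => ?_
    rw [Finset.mul_sum]
    refine Finset.sum_congr rfl fun Q hQ => ?_
    have hQN : Q ⊆ nbrs G a := fun y hy =>
      (Finset.mem_inter.1 (mem_free.1 ((mem_ind.1 hQ).1 hy)).1).2
    rw [Finset.union_inter_distrib_right, Finset.disjoint_iff_inter_eq_empty.1 (hJ J hJ'),
      Finset.empty_union, Finset.inter_eq_left.2 hQN,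
      Finset.card_union_of_disjoint (disjoint_of_mem_ind_free hJ' hQ), pow_add]
    ring
  calc part G S x = ∑ J ∈ ind G (S \ U), x ^ J.card * part G (free G U J) x := part_fiber hUS x
    _ ≤ ∑ J ∈ ind G (S \ U), x ^ J.card * (Z₀ + γ *
          ∑ Q ∈ ind G (free G U J), (Q.card : ℝ) * x ^ Q.card) := by
        refine Finset.sum_le_sum fun J _ => ?_
        gcongr
        exact h _ ((free_subset _ _).trans Finset.inter_subset_right)
    _ = Z₀ * ∑ J ∈ ind G (S \ U), x ^ J.card +
          γ * ∑ I ∈ ind G S, ((I ∩ nbrs G a).card : ℝ) * x ^ I.card := by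
        rw [h2, Finset.mul_sum, Finset.mul_sum, ← Finset.sum_add_distrib]
        exact Finset.sum_congr rfl fun J _ => by ring
    _ ≤ Z₀ * ((1 + x) / x * ∑ I ∈ (ind G S).filter (fun I => a ∈ I), x ^ I.card) +
          γ * ∑ I ∈ ind G S, ((I ∩ nbrs G a).card : ℝ) * x ^ I.card := by
        gcongr
        exact h1.trans (sum_avoid_nbrs_le ha hx)
    _ = _ := by ring

/-- Divided by the partition function of S, the inequality says 1 ≤ β Pr(a ∈ I) + γ E|I ∩ N(a)|.
Here β is a constant multiple of Z₀ and γ is nearly 1 / s, whence the bound for β + γ M. An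
arbitrary S is needed because the greedy algorithm works on a shrinking set of vertices. -/
theorem exists_part_le_occupancy {x ε : ℝ} (hx : 0 < x) (hε : 0 < ε) :
    ∃ M₀ : ℝ, Real.exp 1 < M₀ ∧ ∀ M : ℝ, M₀ ≤ M → ∀ om : ℕ, 3 ≤ om → ∀ f : ℝ,
      IsRatio om M f → 0 < f ∧ ∃ β γ : ℝ, 0 < β ∧ 0 ≤ γ ∧ β + γ * M ≤ (1 + ε) * f * M ∧
        ∀ (V : Type u) [Fintype V] (G : SimpleGraph V) (S : Finset V) (a : V), a ∈ S →
          CliqueLE G (nbrs G a) (om - 1) →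
          part G S x ≤ β * ∑ I ∈ (ind G S).filter (fun I => a ∈ I), x ^ I.card +
            γ * ∑ I ∈ ind G S, ((I ∩ nbrs G a).card : ℝ) * x ^ I.card := by
  set c := (1 + x) / x with hc
  have hc0 : 0 < c := by positivity
  obtain ⟨e, he0, he1, he2⟩ : ∃ e : ℝ, 0 < e ∧ 8 * e ≤ 1 ∧ (8 + c) * e ≤ ε := by
    have hmin : 0 < min ε 1 := lt_min hε one_pos
    refine ⟨min ε 1 / (8 + c), by positivity, ?_, ?_⟩
    · rw [mul_div_assoc', div_le_one (by positivity)]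
      nlinarith [min_le_right ε 1]
    · rw [mul_div_cancel₀ _ (by positivity)]
      exact min_le_left _ _
  obtain ⟨M₀, hM₀, h⟩ := exists_threshold.{u} hx he0
  refine ⟨M₀, hM₀, fun M hM om hom f hf => ?_⟩
  have hM0 : 0 < M := (Real.exp_pos 1).trans (hM₀.trans_le hM)
  obtain ⟨s, Z₀, hs, hZ₀, hf0, hsf, hZf, hsmall⟩ := h M hM om hom f hf
  have h1e : 0 < 1 - e := by linarith
  refine ⟨hf0, c * Z₀, 1 / ((1 - e) * s), by positivity, by positivity, ?_, ?_⟩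
  · have h1 : 1 / ((1 - e) * s) ≤ (1 + 4 * e) * f := by
      have : 1 / ((1 - e) * s) = 1 / s / (1 - e) := by field_simp
      rw [this, div_le_iff₀ h1e]
      refine hsf.trans ?_
      have : 1 + e ≤ (1 + 4 * e) * (1 - e) := by nlinarith
      calc (1 + e) * f ≤ ((1 + 4 * e) * (1 - e)) * f := by gcongr
        _ = _ := by ring
    calc c * Z₀ + 1 / ((1 - e) * s) * M ≤ c * (e * f * M) + (1 + 4 * e) * f * M := by gcongr
      _ = (1 + (4 + c) * e) * f * M := by ring
      _ ≤ _ := by gcongr; nlinarith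
  · intro V _ G S a ha hcl
    refine part_le_occupancy ha hx (by linarith) fun F hF => ?_
    exact part_le_add_of_small_le hx hs (by linarith) (by linarith)
      (hsmall V G F (hcl.mono hF))

theorem sum_card_inter_nbrs_le (I : Finset V) :
    ∑ a : V, (I ∩ nbrs G a).card ≤ G.maxDegree * I.card := by
  have h1 : ∀ a : V, (I ∩ nbrs G a).card = ∑ b ∈ I, if G.Adj a b then 1 else 0 := by
    intro a
    rw [← Finset.sum_filter, ← Finset.card_eq_sum_ones]
    congr 1
    ext b
    simp [mem_nbrs]
  simp only [h1]
  rw [Finset.sum_comm]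
  calc _ ≤ ∑ b ∈ I, G.maxDegree := by
        refine Finset.sum_le_sum fun b _ => ?_
        refine le_trans ?_ (G.degree_le_maxDegree b)
        rw [← card_nbrs, nbrs, Finset.card_filter]
        exact le_of_eq (Finset.sum_congr rfl fun a _ => by simp only [G.adj_comm])
    _ = _ := by rw [Finset.sum_const, smul_eq_mul, mul_comm]

theorem occupancyFraction_eq_div (x : ℝ) :
    occupancyFraction G x =
      (∑ I ∈ ind G Finset.univ, (I.card : ℝ) * x ^ I.card) / part G Finset.univ x /
        Fintype.card V := by
  rw [occupancyFraction]
  congr 1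
  simp only [hardCoreProb, ite_mul, zero_mul]
  rw [Finset.sum_ite_mem, Finset.univ_inter, indepSets_eq, partitionFunction_eq, Finset.sum_div]
  exact Finset.sum_congr rfl fun I _ => by ring

/-- Sum over all a: an element of I is counted once with factor β, and at most Δ times with factor
γ. -/
theorem one_le_mul_occupancyFraction [Nonempty V] {x β γ : ℝ} (hx : 0 < x) (hγ : 0 ≤ γ)
    (h : ∀ a : V, part G Finset.univ x ≤
      β * ∑ I ∈ (ind G Finset.univ).filter (fun I => a ∈ I), x ^ I.card +
        γ * ∑ I ∈ ind G Finset.univ, ((I ∩ nbrs G a).card : ℝ) * x ^ I.card) :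
    1 ≤ (β + γ * G.maxDegree) * occupancyFraction G x := by
  have hZ := part_pos (G := G) Finset.univ hx.le
  have hV : (0 : ℝ) < Fintype.card V := by exact_mod_cast Fintype.card_pos
  have h1 := Finset.sum_le_sum fun a (_ : a ∈ (Finset.univ : Finset V)) => h a
  rw [Finset.sum_const, Finset.card_univ, nsmul_eq_mul, Finset.sum_add_distrib,
    ← Finset.mul_sum, ← Finset.mul_sum] at h1
  have h2 : ∑ a : V, ∑ I ∈ (ind G Finset.univ).filter (fun I => a ∈ I), x ^ I.card =
      ∑ I ∈ ind G Finset.univ, (I.card : ℝ) * x ^ I.card := by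
    simp only [Finset.sum_filter]
    rw [Finset.sum_comm]
    refine Finset.sum_congr rfl fun I _ => ?_
    rw [← Finset.sum_filter, Finset.sum_const, nsmul_eq_mul]
    simp
  have h3 : ∑ a : V, ∑ I ∈ ind G Finset.univ, ((I ∩ nbrs G a).card : ℝ) * x ^ I.card ≤
      G.maxDegree * ∑ I ∈ ind G Finset.univ, (I.card : ℝ) * x ^ I.card := by
    rw [Finset.sum_comm, Finset.mul_sum]
    refine Finset.sum_le_sum fun I _ => ?_
    rw [← Finset.sum_mul, ← mul_assoc]
    gcongr
    exact_mod_cast sum_card_inter_nbrs_le I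
  rw [h2] at h1
  have h4 := mul_le_mul_of_nonneg_left h3 hγ
  rw [occupancyFraction_eq_div, div_div, mul_div_assoc', one_le_div (by positivity)]
  linarith

end HardCore

theorem exists_le_occupancyFraction {x ε : ℝ} (hx : 0 < x) (hε : 0 < ε) :
    ∃ Δ₀ : ℕ, ∀ (V : Type u) [Fintype V] (G : SimpleGraph V) (om : V → ℕ),
      LocalCliqueBound G om → Δ₀ ≤ G.maxDegree →
        let Δ : ℝ := (G.maxDegree : ℝ)
        let ω : ℝ := ((Finset.univ.sup om : ℕ) : ℝ)
        (1 - ε) * max (Real.log Δ / ((ω - 2) * Δ * Real.log (Real.log Δ)))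
            (1 / (2 * Δ) * Real.sqrt (Real.log Δ / Real.log (ω - 1)))
          ≤ occupancyFraction G x := by
  obtain ⟨M₀, hM₀, h⟩ := exists_part_le_occupancy.{u} hx hε
  refine ⟨⌈M₀⌉₊, fun V _ G om hom hΔ => ?_⟩
  intro Δ ω
  have hMΔ : M₀ ≤ Δ := (Nat.le_ceil M₀).trans (Nat.cast_le.2 hΔ)
  have hΔ0 : 0 < Δ := (Real.exp_pos 1).trans (hM₀.trans_le hMΔ)
  have hne : Nonempty V := by
    by_contra hcon
    rw [not_nonempty_iff] at hcon
    have h0 : G.maxDegree = 0 := by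
      simp [SimpleGraph.maxDegree]
    have : Δ = 0 := by simp only [Δ, h0, Nat.cast_zero]
    linarith
  have hω3 : 3 ≤ Finset.univ.sup om :=
    (hom (Classical.arbitrary V)).1.trans (Finset.le_sup (Finset.mem_univ _))
  have key : ∀ f, IsRatio (Finset.univ.sup om) Δ f →
      (1 - ε) * (1 / (f * Δ)) ≤ occupancyFraction G x := by
    intro f hf
    obtain ⟨hf0, β, γ, hβ, hγ, hβγ, hocc⟩ := h Δ hMΔ _ hω3 f hf
    have h1 := one_le_mul_occupancyFraction hx hγ fun a : V =>
      hocc V G Finset.univ a (Finset.mem_univ a)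
        (hom.cliqueLE (Finset.le_sup (Finset.mem_univ a)))
    have h0 : 0 < occupancyFraction G x := by
      by_contra hcon
      have : (β + γ * G.maxDegree) * occupancyFraction G x ≤ 0 :=
        mul_nonpos_of_nonneg_of_nonpos (by positivity) (not_lt.1 hcon)
      linarith
    have h2 : 1 ≤ (1 + ε) * f * Δ * occupancyFraction G x :=
      h1.trans (by gcongr)
    rw [mul_one_div, div_le_iff₀ (by positivity)]
    calc 1 - ε = (1 - ε) * 1 := by ring
      _ ≤ 1 / (1 + ε) := by
        rw [le_div_iff₀ (by positivity)]; nlinarith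
      _ ≤ 1 / (1 + ε) * ((1 + ε) * f * Δ * occupancyFraction G x) := by
        apply le_mul_of_one_le_right (by positivity) h2
      _ = _ := by field_simp
  rcases max_choice (Real.log Δ / ((ω - 2) * Δ * Real.log (Real.log Δ)))
      (1 / (2 * Δ) * Real.sqrt (Real.log Δ / Real.log (ω - 1))) with hm | hm
  · rw [hm]
    refine le_trans (le_of_eq ?_) (key _ (Or.inl rfl))
    congr 1
    rw [one_div, mul_div_assoc', div_mul_eq_mul_div, inv_div]
    ring
  · rw [hm]
    refine le_trans (le_of_eq ?_) (key _ (Or.inr rfl))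
    congr 1
    rw [← inv_div (Real.log (ω - 1)), Real.sqrt_inv, one_div, one_div, ← mul_inv]
    congr 1
    ring

/-! ### Greedy fractional colouring -/

section Fractional

variable {V : Type*} [Fintype V] {G : SimpleGraph V}

/-- The total weight of the sets containing `a`. -/
def cov (W : Finset V → ℝ) (a : V) : ℝ := ∑ I : Finset V, if a ∈ I then W I else 0

theorem cov_nonneg {W : Finset V → ℝ} (hW : ∀ I, 0 ≤ W I) (a : V) : 0 ≤ cov W a :=
  Finset.sum_nonneg fun I _ => by split_ifs; exacts [hW I, le_rfl]

theorem cov_add_smul (W p : Finset V → ℝ) (τ : ℝ) (a : V) :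
    cov (fun I => W I + τ * p I) a = cov W a + τ * cov p a := by
  simp only [cov, Finset.mul_sum, ← Finset.sum_add_distrib]
  refine Finset.sum_congr rfl fun I _ => ?_
  split_ifs <;> simp

theorem sum_cov_nbrs (G : SimpleGraph V) (W : Finset V → ℝ) (a : V) :
    ∑ b ∈ nbrs G a, cov W b = ∑ I : Finset V, W I * ((I ∩ nbrs G a).card : ℝ) := by
  simp only [cov]
  rw [Finset.sum_comm]
  refine Finset.sum_congr rfl fun I _ => ?_
  rw [← Finset.sum_filter, Finset.sum_const, nsmul_eq_mul, mul_comm]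
  congr 3
  ext b
  simp [and_comm]

/-- A partial fractional colouring produced by the greedy algorithm: the colour measure that is
used on sets with a vertex of small parameter `B` is small. -/
structure IsPartial (G : SimpleGraph V) (β γ : V → ℝ) (W : Finset V → ℝ) : Prop where
  nonneg : ∀ I, 0 ≤ W I
  supp : ∀ I, I ∉ ind G Finset.univ → W I = 0
  le_one : ∀ a, cov W a ≤ 1
  occ : ∀ a, cov W a < 1 → ∑ I, W I ≤ β a * cov W a + γ a * ∑ b ∈ nbrs G a, cov W b
  early : ∀ a, ∑ J ∈ Finset.univ.filter
    (fun J : Finset V => ∃ b ∈ J, β b + γ b * G.degree b ≤ β a + γ a * G.degree a), W J ≤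
      β a + γ a * G.degree a

variable {β γ : V → ℝ}

/-- The amount τ of p is the largest that covers no vertex more than once, so a vertex of S is
finished. The occupancy inequality of p, multiplied by τ, is added to that of W. A vertex that was
unfinished before the step therefore still bounds the total measure after it by β + γ deg, since all
coverages are at most 1. -/
theorem IsPartial.step (hβ : ∀ a, 0 ≤ β a) (hγ : ∀ a, 0 ≤ γ a) {W : Finset V → ℝ}
    (hW : IsPartial G β γ W) {S : Finset V} (hS : S = Finset.univ.filter fun a => cov W a < 1)
    {p : Finset V → ℝ} (hne : S.Nonempty) (hp : ∀ I, 0 ≤ p I) (hps : ∀ I, I ∉ ind G S → p I = 0)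
    (hp1 : ∑ I, p I = 1)
    (hocc : ∀ a ∈ S, 1 ≤ β a * cov p a + γ a * ∑ b ∈ nbrs G a, cov p b) :
    ∃ W', IsPartial G β γ W' ∧ (Finset.univ.filter fun a => cov W' a < 1) ⊂ S := by
  have hq0 : ∀ a, 0 ≤ cov p a := cov_nonneg hp
  have hSmem : ∀ a, a ∈ S ↔ cov W a < 1 := fun a => by rw [hS]; simp
  have hqS : ∀ a, a ∉ S → cov p a = 0 := by
    intro a ha
    refine Finset.sum_eq_zero fun I _ => ?_
    split_ifs with h
    · exact hps I fun hI => ha ((mem_ind.1 hI).1 h)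
    · rfl
  set P := S.filter fun a => 0 < cov p a with hP
  have hPne : P.Nonempty := by
    by_contra hcon
    rw [Finset.not_nonempty_iff_eq_empty, hP, Finset.filter_eq_empty_iff] at hcon
    have hz : ∀ a, cov p a = 0 := fun a => by
      by_cases ha : a ∈ S
      · exact le_antisymm (not_lt.1 (hcon ha)) (hq0 a)
      · exact hqS a ha
    obtain ⟨a, ha⟩ := hne
    have := hocc a ha
    simp only [hz, mul_zero, Finset.sum_const_zero, add_zero] at this
    linarith
  obtain ⟨c, hc, hmin⟩ := Finset.exists_min_image P (fun a => (1 - cov W a) / cov p a) hPne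
  rw [hP, Finset.mem_filter] at hc
  set τ := (1 - cov W c) / cov p c with hτ
  have hτ0 : 0 ≤ τ := div_nonneg (by linarith [hW.le_one c]) hc.2.le
  have hcov := cov_add_smul W p τ
  set W' : Finset V → ℝ := fun I => W I + τ * p I with hW'
  have hle : ∀ a, cov W' a ≤ 1 := by
    intro a
    rw [hcov]
    by_cases ha : a ∈ S
    · rcases (hq0 a).eq_or_lt with h | h
      · rw [← h]; linarith [hW.le_one a]
      · have := hmin a (by rw [hP, Finset.mem_filter]; exact ⟨ha, h⟩)
        rw [le_div_iff₀ h] at this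
        linarith
    · rw [hqS a ha]; linarith [hW.le_one a]
  have hsum : ∑ I, W' I = ∑ I, W I + τ := by
    simp only [hW', Finset.sum_add_distrib, ← Finset.mul_sum, hp1, mul_one]
  have hoccS : ∀ a ∈ S, ∑ I, W' I ≤ β a * cov W' a + γ a * ∑ b ∈ nbrs G a, cov W' b := by
    intro a ha
    have h1 := hW.occ a ((hSmem a).1 ha)
    have h2 := mul_le_mul_of_nonneg_left (hocc a ha) hτ0
    simp only [hcov, hsum, Finset.sum_add_distrib, ← Finset.mul_sum]
    linarith
  have hB : ∀ a ∈ S, ∑ I, W' I ≤ β a + γ a * G.degree a := by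
    intro a ha
    refine (hoccS a ha).trans (add_le_add (mul_le_of_le_one_right (hβ a) (hle a)) ?_)
    refine mul_le_mul_of_nonneg_left ?_ (hγ a)
    calc ∑ b ∈ nbrs G a, cov W' b ≤ ∑ b ∈ nbrs G a, 1 := Finset.sum_le_sum fun b _ => hle b
      _ = G.degree a := by rw [Finset.sum_const, card_nbrs, nsmul_eq_mul, mul_one]
  have hnn : ∀ I, 0 ≤ W' I := fun I => add_nonneg (hW.nonneg I) (mul_nonneg hτ0 (hp I))
  refine ⟨W', ⟨hnn, ?_, hle, ?_, ?_⟩, ?_⟩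
  · intro I hI
    have : I ∉ ind G S := fun h => hI (mem_ind.2 ⟨Finset.subset_univ _, (mem_ind.1 h).2⟩)
    simp only [hW', hW.supp I hI, hps I this, mul_zero, add_zero]
  · intro a ha
    refine hoccS a ((hSmem a).2 (lt_of_le_of_lt ?_ ha))
    rw [hcov]
    linarith [mul_nonneg hτ0 (hq0 a)]
  · intro a
    -- If more than the parameter of a has been spent, all vertices whose parameter is no larger
    -- were finished before this step, so p does not charge any set that contains one of them.
    by_cases hT : ∑ I, W' I ≤ β a + γ a * G.degree a
    · exact (Finset.sum_le_sum_of_subset_of_nonneg (Finset.filter_subset _ _)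
        fun I _ _ => hnn I).trans hT
    · refine le_trans (le_of_eq ?_) (hW.early a)
      refine Finset.sum_congr rfl fun J hJ => ?_
      obtain ⟨b, hb, hba⟩ := (Finset.mem_filter.1 hJ).2
      have : p J = 0 := by
        refine hps J fun hJS => hT ((hB b ((mem_ind.1 hJS).1 hb)).trans hba)
      simp only [hW', this, mul_zero, add_zero]
  · rw [Finset.ssubset_iff_of_subset]
    · refine ⟨c, hc.1, ?_⟩
      rw [Finset.mem_filter, hcov, hτ, div_mul_cancel₀ _ hc.2.ne']
      simp
    · intro a ha
      rw [Finset.mem_filter, hcov] at ha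
      exact (hSmem a).2 (by linarith [mul_nonneg hτ0 (hq0 a)])

theorem IsPartial.exists_complete (hβ : ∀ a, 0 ≤ β a) (hγ : ∀ a, 0 ≤ γ a)
    (hocc : ∀ S : Finset V, S.Nonempty → ∃ p : Finset V → ℝ, (∀ I, 0 ≤ p I) ∧
      (∀ I, I ∉ ind G S → p I = 0) ∧ ∑ I, p I = 1 ∧
      ∀ a ∈ S, 1 ≤ β a * cov p a + γ a * ∑ b ∈ nbrs G a, cov p b) :
    ∃ W, IsPartial G β γ W ∧ ∀ a, cov W a = 1 := by
  suffices H : ∀ n : ℕ, ∀ W, IsPartial G β γ W →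
      (Finset.univ.filter fun a => cov W a < 1).card ≤ n →
      ∃ W, IsPartial G β γ W ∧ ∀ a, cov W a = 1 by
    refine H _ (fun _ => 0) ⟨fun _ => le_rfl, fun _ _ => rfl, ?_, ?_, ?_⟩ le_rfl
    · intro a; simp [cov]
    · intro a _; simp [cov]
    · intro a
      have h1 := hβ a
      have h2 := hγ a
      simp only [Finset.sum_const_zero]
      positivity
  intro n
  induction n with
  | zero =>
    intro W hW hn
    refine ⟨W, hW, fun a => ?_⟩
    rw [Nat.le_zero, Finset.card_eq_zero, Finset.filter_eq_empty_iff] at hn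
    exact le_antisymm (hW.le_one a) (not_lt.1 (hn (Finset.mem_univ a)))
  | succ n ih =>
    intro W hW hn
    rcases (Finset.univ.filter fun a => cov W a < 1).eq_empty_or_nonempty with h | h
    · refine ih W hW (by rw [h]; simp)
    · obtain ⟨p, hp, hps, hp1, hpo⟩ := hocc _ h
      obtain ⟨W', hW', hss⟩ := hW.step hβ hγ rfl h hp hps hp1 hpo
      exact ih W' hW' (by have := Finset.card_lt_card hss; omega)

/-- The hard-core model as input of the greedy algorithm. -/
theorem exists_distribution {x : ℝ} (hx : 0 < x) {S : Finset V}
    (h : ∀ a ∈ S, part G S x ≤ β a * ∑ I ∈ (ind G S).filter (fun I => a ∈ I), x ^ I.card +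
            γ a * ∑ I ∈ ind G S, ((I ∩ nbrs G a).card : ℝ) * x ^ I.card) :
    ∃ p : Finset V → ℝ, (∀ I, 0 ≤ p I) ∧
      (∀ I, I ∉ ind G S → p I = 0) ∧ ∑ I, p I = 1 ∧
      ∀ a ∈ S, 1 ≤ β a * cov p a + γ a * ∑ b ∈ nbrs G a, cov p b := by
  have hZ := part_pos (G := G) S hx.le
  refine ⟨fun I => if I ∈ ind G S then x ^ I.card / part G S x else 0, ?_, ?_, ?_, ?_⟩
  · intro I
    dsimp only
    split_ifs <;> positivity
  · intro I hI
    simp [hI]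
  · rw [Finset.sum_ite_mem, Finset.univ_inter, ← Finset.sum_div]
    exact div_self hZ.ne'
  · intro a ha
    have e1 : cov (fun I => if I ∈ ind G S then x ^ I.card / part G S x else 0) a =
        (∑ I ∈ (ind G S).filter (fun I => a ∈ I), x ^ I.card) / part G S x := by
      rw [cov, Finset.sum_div, Finset.sum_filter, ← Finset.sum_subset (Finset.subset_univ (ind G S))]
      · refine Finset.sum_congr rfl fun I hI => ?_
        rw [if_pos hI]
      · intro I _ hI
        simp [hI]
    have e2 : ∑ b ∈ nbrs G a, cov (fun I => if I ∈ ind G S then x ^ I.card / part G S x else 0) b =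
        (∑ I ∈ ind G S, ((I ∩ nbrs G a).card : ℝ) * x ^ I.card) / part G S x := by
      rw [sum_cov_nbrs]
      simp only [ite_mul, zero_mul]
      rw [Finset.sum_ite_mem, Finset.univ_inter, Finset.sum_div]
      exact Finset.sum_congr rfl fun I _ => by ring
    rw [e1, e2, mul_div_assoc', mul_div_assoc', ← add_div, le_div_iff₀ hZ, one_mul]
    exact h a ha

/-- Every nonempty set is counted by `early` at a vertex with the largest parameter. Measure spent
on the empty set is not controlled, and is useless. -/
theorem IsPartial.sum_nonempty_le {W : Finset V → ℝ} (hW : IsPartial G β γ W) {k : ℝ} (hk : 0 ≤ k)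
    (h : ∀ a, β a + γ a * G.degree a ≤ k) :
    ∑ J ∈ Finset.univ.filter (fun J : Finset V => J.Nonempty), W J ≤ k := by
  rcases isEmpty_or_nonempty V with hV | hV
  · rw [Finset.sum_eq_zero]
    · exact hk
    · intro J hJ
      obtain ⟨a, _⟩ := (Finset.mem_filter.1 hJ).2
      exact (hV.false a).elim
  obtain ⟨a, _, hmax⟩ := Finset.exists_max_image Finset.univ
    (fun a => β a + γ a * G.degree a) Finset.univ_nonempty
  refine (Finset.sum_le_sum_of_subset_of_nonneg ?_ fun I _ _ => hW.nonneg I).trans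
    ((hW.early a).trans (h a))
  intro J hJ
  obtain ⟨b, hb⟩ := (Finset.mem_filter.1 hJ).2
  exact Finset.mem_filter.2 ⟨Finset.mem_univ _, b, hb, hmax b (Finset.mem_univ b)⟩

theorem cov_eq_sum_filter {W : Finset V → ℝ} (hsupp : ∀ I, I ∉ ind G Finset.univ → W I = 0)
    (a : V) : cov W a = ∑ I ∈ (indepSets G).filter (fun I => a ∈ I), W I := by
  rw [cov, Finset.sum_filter, indepSets_eq, ← Finset.sum_subset (Finset.subset_univ (ind G _))]
  intro I _ hI
  simp [hsupp I hI]

theorem IsPartial.fractionallyColourable {W : Finset V → ℝ} (hW : IsPartial G β γ W)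
    (h1 : ∀ a, cov W a = 1) {k : ℝ} (hk : 0 < k)
    (h : ∀ a, β a + γ a * G.degree a ≤ k) : FractionallyColourable G k := by
  set T := ∑ J ∈ Finset.univ.filter (fun J : Finset V => J.Nonempty), W J with hT
  have hTk : T ≤ k := hW.sum_nonempty_le hk.le h
  -- The empty set takes up the probability that is left over.
  refine ⟨hk, fun I => if I.Nonempty then W I / k else 1 - T / k, ?_, ?_, ?_⟩
  · intro I _
    dsimp only
    split_ifs
    · exact div_nonneg (hW.nonneg I) hk.le
    · rw [sub_nonneg]; exact (div_le_one hk).2 hTk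
  · rw [indepSets_eq, Finset.sum_ite, ← Finset.sum_div]
    have e1 : ∑ I ∈ (ind G Finset.univ).filter (fun J => J.Nonempty), W I = T := by
      rw [hT]
      refine Finset.sum_subset (Finset.filter_subset_filter _ (Finset.subset_univ _)) ?_
      intro I hI hI'
      refine hW.supp I fun hcon => hI' (Finset.mem_filter.2 ⟨hcon, (Finset.mem_filter.1 hI).2⟩)
    have e2 : (ind G Finset.univ).filter (fun J => ¬ J.Nonempty) = {∅} := by
      ext I
      simp only [Finset.mem_filter, Finset.not_nonempty_iff_eq_empty, Finset.mem_singleton]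
      exact ⟨fun h => h.2, fun h => ⟨h ▸ empty_mem_ind _, h⟩⟩
    rw [e1, e2, Finset.sum_singleton]
    ring
  · intro a
    rw [← h1 a, cov_eq_sum_filter hW.supp, Finset.sum_div]
    refine Finset.sum_le_sum fun I hI => ?_
    rw [if_pos ⟨a, (Finset.mem_filter.1 hI).2⟩]

/-- The intervals are arranged in the order in which the greedy algorithm needs them. -/
theorem IsPartial.exists_fractionalColouring {W : Finset V → ℝ} (hW : IsPartial G β γ W)
    (h1 : ∀ a, cov W a = 1) :
    ∃ w : FractionalColouring G, ∀ a,
      w.colour a ⊆ Set.Ico 0 (β a + γ a * G.degree a) := by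
  set B : V → ℝ := fun a => β a + γ a * G.degree a with hB
  obtain ⟨b, hb⟩ : ∃ b : Finset V → ℝ, ∀ J : Finset V, J.Nonempty →
      (∃ a ∈ J, B a = b J) ∧ ∀ a ∈ J, b J ≤ B a := by
    refine ⟨fun J => if h : J.Nonempty then J.inf' h B else 0, fun J hJ => ?_⟩
    simp only [dif_pos hJ]
    obtain ⟨a, ha, hab⟩ := Finset.exists_mem_eq_inf' hJ B
    exact ⟨⟨a, ha, hab.symm⟩, fun a ha => Finset.inf'_le B ha⟩
  -- Sets are ordered by their smallest parameter; the enumeration breaks ties, which makes the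
  -- order strict and the intervals disjoint.
  let e := Fintype.equivFin (Finset V)
  let key : Finset V → ℝ ×ₗ Fin (Fintype.card (Finset V)) := fun J => toLex (b J, e J)
  have hinj : Function.Injective key := by
    intro J K h
    have : (b J, e J) = (b K, e K) := toLex.injective h
    exact e.injective (Prod.mk.inj this).2
  have hbkey : ∀ J K, key J ≤ key K → b J ≤ b K := by
    intro J K h
    rcases (Prod.Lex.le_iff (x := key J) (y := key K)).1 h with h | h
    · exact h.le
    · exact h.1.le
  let pre : Finset V → Finset (Finset V) := fun J =>
    Finset.univ.filter fun K => K.Nonempty ∧ key K < key J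
  -- The intervals are laid end to end. The empty set receives an empty interval, so as not to
  -- displace the others.
  let left : Finset V → ℝ := fun J => if J.Nonempty then ∑ K ∈ pre J, W K else 0
  let right : Finset V → ℝ := fun J => if J.Nonempty then ∑ K ∈ pre J, W K + W J else 0
  have hl0 : ∀ J, 0 ≤ left J := by
    intro J
    simp only [left]
    split_ifs
    · exact Finset.sum_nonneg fun K _ => hW.nonneg K
    · exact le_rfl
  have hlr : ∀ J, left J ≤ right J := by
    intro J
    simp only [left, right]
    split_ifs
    · linarith [hW.nonneg J]
    · exact le_rfl
  have hins : ∀ J, right J = if J.Nonempty then ∑ K ∈ insert J (pre J), W K else 0 := by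
    intro J
    simp only [right]
    split_ifs
    · rw [Finset.sum_insert (by simp [pre]), add_comm]
    · rfl
  have hlt : ∀ J K, J.Nonempty → K.Nonempty → key J < key K → right J ≤ left K := by
    intro J K hJ hK h
    rw [hins, if_pos hJ]
    simp only [left, if_pos hK]
    refine Finset.sum_le_sum_of_subset_of_nonneg ?_ fun I _ _ => hW.nonneg I
    intro I hI
    rcases Finset.mem_insert.1 hI with rfl | hI
    · simp [pre, hJ, h]
    · simp only [pre, Finset.mem_filter, Finset.mem_univ, true_and] at hI ⊢
      exact ⟨hI.1, hI.2.trans h⟩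
  have hdisj : ∀ J K, J ≠ K → Disjoint (Set.Ico (left J) (right J)) (Set.Ico (left K) (right K)) := by
    intro J K hJK
    by_cases hJ : J.Nonempty
    swap
    · simp [left, right, hJ]
    by_cases hK : K.Nonempty
    swap
    · simp [left, right, hK]
    rw [Set.disjoint_left]
    rintro y ⟨hy1, hy2⟩ ⟨hy3, hy4⟩
    rcases lt_or_gt_of_ne (hinj.ne hJK) with h | h
    · linarith [hlt J K hJ hK h]
    · linarith [hlt K J hK hJ h]
  -- Each set placed no later than J has a vertex whose parameter is at most the minimum over J,
  -- attained at c; thus `early` at c bounds the right end.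
  have hright : ∀ J, ∀ a ∈ J, right J ≤ B a := by
    intro J a ha
    have hJ : J.Nonempty := ⟨a, ha⟩
    obtain ⟨⟨c, hc, hcb⟩, hmin⟩ := hb J hJ
    refine le_trans ?_ ((hW.early c).trans (hcb.le.trans (hmin a ha)))
    rw [hins, if_pos hJ]
    refine Finset.sum_le_sum_of_subset_of_nonneg ?_ fun I _ _ => hW.nonneg I
    intro I hI
    have hI' : I.Nonempty ∧ b I ≤ b J := by
      rcases Finset.mem_insert.1 hI with rfl | hI
      · exact ⟨hJ, le_rfl⟩
      · simp only [pre, Finset.mem_filter, Finset.mem_univ, true_and] at hI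
        exact ⟨hI.1, hbkey _ _ hI.2.le⟩
    obtain ⟨⟨d, hd, hdb⟩, -⟩ := hb I hI'.1
    exact Finset.mem_filter.2 ⟨Finset.mem_univ _, d, hd, hdb.le.trans (hI'.2.trans hcb.ge)⟩
  refine ⟨⟨left, right, fun J _ => hl0 J, fun J _ => hlr J, fun J _ K _ h => hdisj J K h, ?_⟩, ?_⟩
  · intro a
    rw [← h1 a, cov_eq_sum_filter hW.supp]
    refine Finset.sum_congr rfl fun I hI => ?_
    have hne : I.Nonempty := ⟨a, (Finset.mem_filter.1 hI).2⟩
    simp only [left, right, if_pos hne]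
    ring
  · intro a y hy
    simp only [FractionalColouring.colour, Set.mem_iUnion] at hy
    obtain ⟨I, hI, hy1, hy2⟩ := hy
    exact ⟨(hl0 I).trans hy1, hy2.trans_le (hright I a (Finset.mem_filter.1 hI).2)⟩

end Fractional

theorem exists_isRatio_min (om : ℕ) (m M : ℝ) :
    ∃ f, IsRatio om M f ∧ min (boundOne om m M) (boundTwo 2 om m M) = f * m := by
  rcases min_choice (boundOne om m M) (boundTwo 2 om m M) with h | h
  · exact ⟨_, Or.inl rfl, by rw [h, boundOne]; ring⟩
  · exact ⟨_, Or.inr rfl, by rw [h, boundTwo]; ring⟩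

/-- The fugacity is 1, and each vertex has its own parameters, taken at M = m. Since deg(a) ≤ m, the
finishing time β + γ deg(a) is within β + γ m. -/
theorem exists_local_fractionalColouring {ε : ℝ} (hε : 0 < ε) : ∃ δ₀ : ℝ, Real.exp 1 < δ₀ ∧
    ∀ (V : Type u) [Fintype V] (G : SimpleGraph V) (om : V → ℕ),
      LocalCliqueBound G om →
        ∃ w : FractionalColouring G, ∀ a : V,
          let m : ℝ := max (G.degree a : ℝ) δ₀
          w.colour a ⊆ Set.Ico 0
            (min ((1 + ε) * boundOne (om a) m m) ((1 + ε) * boundTwo 2 (om a) m m)) := by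
  obtain ⟨M₀, hM₀, h⟩ := exists_part_le_occupancy.{u} one_pos hε
  refine ⟨M₀, hM₀, fun V _ G om hom => ?_⟩
  have key : ∀ a : V, ∃ β γ : ℝ, 0 < β ∧ 0 ≤ γ ∧ β + γ * G.degree a ≤
      (1 + ε) * min (boundOne (om a) (max (G.degree a : ℝ) M₀) (max (G.degree a : ℝ) M₀))
        (boundTwo 2 (om a) (max (G.degree a : ℝ) M₀) (max (G.degree a : ℝ) M₀)) ∧
      ∀ S : Finset V, a ∈ S → part G S 1 ≤
        β * ∑ I ∈ (ind G S).filter (fun I => a ∈ I), (1 : ℝ) ^ I.card +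
            γ * ∑ I ∈ ind G S, ((I ∩ nbrs G a).card : ℝ) * (1 : ℝ) ^ I.card := by
    intro a
    obtain ⟨f, hf, hfm⟩ := exists_isRatio_min (om a) (max (G.degree a : ℝ) M₀)
      (max (G.degree a : ℝ) M₀)
    obtain ⟨-, β, γ, hβ, hγ, hβγ, hocc⟩ := h _ (le_max_right _ _) _ (hom a).1 f hf
    refine ⟨β, γ, hβ, hγ, ?_, fun S ha => hocc V G S a ha (hom.cliqueLE le_rfl)⟩
    rw [hfm, ← mul_assoc]
    refine le_trans ?_ hβγ
    gcongr
    exact le_max_left _ _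
  choose β γ hβ hγ hβγ hocc using key
  obtain ⟨W, hW, hW1⟩ := IsPartial.exists_complete (G := G) (fun a => (hβ a).le) hγ
    fun S _ => exists_distribution one_pos fun a ha => hocc a S ha
  obtain ⟨w, hw⟩ := hW.exists_fractionalColouring hW1
  refine ⟨w, fun a => ?_⟩
  intro m
  refine (hw a).trans (Set.Ico_subset_Ico_right ?_)
  rw [← mul_min_of_nonneg _ _ (by linarith : 0 ≤ 1 + ε)]
  exact hβγ a

theorem exists_fractionalChromaticNumber_le {ε : ℝ} (hε : 0 < ε) : ∃ Δ₀ : ℕ,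
    ∀ (V : Type u) [Fintype V] (G : SimpleGraph V) (om : V → ℕ),
      LocalCliqueBound G om → Δ₀ ≤ G.maxDegree →
        let Δ : ℝ := (G.maxDegree : ℝ)
        let ω : ℝ := ((Finset.univ.sup om : ℕ) : ℝ)
        fractionalChromaticNumber G ≤
          (1 + ε) * min (boundOne ω Δ Δ) (boundTwo 2 ω Δ Δ) := by
  obtain ⟨M₀, hM₀, h⟩ := exists_part_le_occupancy.{u} one_pos hε
  refine ⟨⌈M₀⌉₊, fun V _ G om hom hΔ => ?_⟩
  intro Δ ω
  have hMΔ : M₀ ≤ Δ := (Nat.le_ceil M₀).trans (Nat.cast_le.2 hΔ)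
  have hΔ0 : 0 < Δ := (Real.exp_pos 1).trans (hM₀.trans_le hMΔ)
  have hne : Nonempty V := by
    by_contra hcon
    rw [not_nonempty_iff] at hcon
    have h0 : G.maxDegree = 0 := by
      simp [SimpleGraph.maxDegree]
    have : Δ = 0 := by simp only [Δ, h0, Nat.cast_zero]
    linarith
  have hω3 : 3 ≤ Finset.univ.sup om :=
    (hom (Classical.arbitrary V)).1.trans (Finset.le_sup (Finset.mem_univ _))
  obtain ⟨f, hf, hfm⟩ := exists_isRatio_min (Finset.univ.sup om) Δ Δ
  obtain ⟨hf0, β, γ, hβ, hγ, hβγ, hocc⟩ := h Δ hMΔ _ hω3 f hf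
  obtain ⟨W, hW, hW1⟩ := IsPartial.exists_complete (G := G) (β := fun _ => β) (γ := fun _ => γ)
    (fun _ => hβ.le) (fun _ => hγ)
    fun S _ => exists_distribution one_pos fun a ha => hocc V G S a ha
      (hom.cliqueLE (Finset.le_sup (Finset.mem_univ a)))
  refine csInf_le ⟨0, fun k hk => hk.1.le⟩ ?_
  rw [hfm, ← mul_assoc]
  refine hW.fractionallyColourable hW1 (by positivity) fun a => le_trans ?_ hβγ
  have : (G.degree a : ℝ) ≤ Δ := Nat.cast_le.2 (G.degree_le_maxDegree a)
  gcongr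

/-! ### A local lemma for counting measure -/

/-- The lopsided Lovász local lemma, for the uniform distribution on a finite set. -/
theorem exists_forall_not_of_lopsided {α ι : Type*} (Ω : Finset α) (hΩ : Ω.Nonempty)
    (bad : ι → α → Prop) (S : Finset ι) (Γ : ι → Finset ι) {p : ℝ} {D : ℕ} (hD : 1 ≤ D)
    (hp : 0 ≤ p) (hpD : 4 * p * D ≤ 1) (hΓ : ∀ i ∈ S, (Γ i).card ≤ D)
    (hcond : ∀ i ∈ S, ∀ T ⊆ S, Disjoint T (Γ i) →
      ((Ω.filter fun w => bad i w ∧ ∀ j ∈ T, ¬ bad j w).card : ℝ) ≤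
        p * (Ω.filter fun w => ∀ j ∈ T, ¬ bad j w).card) :
    ∃ w ∈ Ω, ∀ i ∈ S, ¬ bad i w := by
  set N : Finset ι → ℝ := fun T => ((Ω.filter fun w => ∀ j ∈ T, ¬ bad j w).card : ℝ) with hN
  set B : ι → Finset ι → ℝ := fun i T =>
    ((Ω.filter fun w => bad i w ∧ ∀ j ∈ T, ¬ bad j w).card : ℝ) with hB
  have hN0 : ∀ T, 0 ≤ N T := fun T => Nat.cast_nonneg _
  -- Given that no event of T occurs, the event i has probability at most 2p. By induction the
  -- events of T ∩ Γ i have total probability at most 2pD ≤ 1/2 given that those outside Γ i fail,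
  -- so conditioning on their failure at most doubles p.
  have key : ∀ n : ℕ, ∀ T ⊆ S, T.card ≤ n → ∀ i ∈ S, B i T ≤ 2 * p * N T := by
    intro n
    induction n with
    | zero =>
      intro T hT hn i hi
      have : T = ∅ := Finset.card_eq_zero.1 (Nat.le_zero.1 hn)
      subst this
      have := hcond i hi ∅ hT (Finset.disjoint_empty_left _)
      have h0 := mul_nonneg hp (hN0 ∅)
      change B i ∅ ≤ p * N ∅ at this
      linarith
    | succ n ih =>
      intro T hT hn i hi
      set T1 := T ∩ Γ i with hT1
      set T2 := T \ Γ i with hT2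
      have hT2S : T2 ⊆ S := Finset.sdiff_subset.trans hT
      have h1 : B i T2 ≤ p * N T2 := hcond i hi T2 hT2S Finset.sdiff_disjoint
      have h2 : B i T ≤ B i T2 := by
        simp only [hB]
        refine Nat.cast_le.2 (Finset.card_le_card fun w hw => ?_)
        rw [Finset.mem_filter] at hw ⊢
        exact ⟨hw.1, hw.2.1, fun j hj => hw.2.2 j (Finset.mem_sdiff.1 hj).1⟩
      rcases T1.eq_empty_or_nonempty with hemp | hne
      · have hTT : T2 = T := by
          rw [hT2, Finset.sdiff_eq_self_iff_disjoint, Finset.disjoint_iff_inter_eq_empty]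
          exact hemp
        rw [hTT] at h1
        have h0 := mul_nonneg hp (hN0 T)
        linarith
      have hcard : T2.card ≤ n := by
        have := Finset.card_sdiff_add_card_inter T (Γ i)
        rw [← hT1, ← hT2] at this
        have := hne.card_pos
        omega
      have h3 : N T2 ≤ N T + ∑ j ∈ T1, B j T2 := by
        simp only [hN, hB]
        rw [← Nat.cast_sum, ← Nat.cast_add]
        refine Nat.cast_le.2 (le_trans (Finset.card_le_card (t :=
          (Ω.filter fun w => ∀ j ∈ T, ¬ bad j w) ∪
          T1.biUnion fun j => Ω.filter fun w => bad j w ∧ ∀ j ∈ T2, ¬ bad j w) ?_)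
          ((Finset.card_union_le _ _).trans (Nat.add_le_add_left Finset.card_biUnion_le _)))
        intro w hw
        rw [Finset.mem_filter] at hw
        rw [Finset.mem_union, Finset.mem_biUnion, Finset.mem_filter]
        by_cases hbad : ∃ j ∈ T1, bad j w
        · obtain ⟨j, hj, hjw⟩ := hbad
          exact Or.inr ⟨j, hj, Finset.mem_filter.2 ⟨hw.1, hjw, hw.2⟩⟩
        · push Not at hbad
          refine Or.inl ⟨hw.1, fun j hj => ?_⟩
          by_cases hjΓ : j ∈ Γ i
          · exact hbad j (Finset.mem_inter.2 ⟨hj, hjΓ⟩)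
          · exact hw.2 j (Finset.mem_sdiff.2 ⟨hj, hjΓ⟩)
      have h4 : ∑ j ∈ T1, B j T2 ≤ D * (2 * p * N T2) := by
        calc _ ≤ ∑ j ∈ T1, 2 * p * N T2 := Finset.sum_le_sum fun j hj =>
              ih T2 hT2S hcard j (hT (Finset.mem_inter.1 hj).1)
          _ = T1.card * (2 * p * N T2) := by rw [Finset.sum_const, nsmul_eq_mul]
          _ ≤ _ := by
            have : T1.card ≤ D := (Finset.card_le_card Finset.inter_subset_right).trans (hΓ i hi)
            have := hN0 T2
            gcongr
      have h5 : D * (2 * p * N T2) ≤ 1 / 2 * N T2 := by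
        have := mul_le_mul_of_nonneg_right hpD (hN0 T2)
        linarith
      have h6 : p * N T2 ≤ p * (2 * N T) := mul_le_mul_of_nonneg_left (by linarith) hp
      linarith
  have hpos : ∀ T : Finset ι, T ⊆ S → 0 < N T := by
    intro T
    induction T using Finset.induction_on with
    | empty =>
      intro _
      simp only [hN]
      have : (Ω.filter fun w => ∀ j ∈ (∅ : Finset ι), ¬ bad j w) = Ω := by simp
      rw [this]
      exact_mod_cast hΩ.card_pos
    | insert i T hi ih =>
      intro hT
      have hT' : T ⊆ S := (Finset.subset_insert i T).trans hT
      have h1 := key _ T hT' le_rfl i (hT (Finset.mem_insert_self i T))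
      have h2 : N T ≤ N (insert i T) + B i T := by
        simp only [hN, hB]
        rw [← Nat.cast_add]
        refine Nat.cast_le.2 (le_trans (Finset.card_le_card ?_) (Finset.card_union_le _ _))
        intro w hw
        rw [Finset.mem_filter] at hw
        rw [Finset.mem_union, Finset.mem_filter, Finset.mem_filter]
        by_cases hb : bad i w
        · exact Or.inr ⟨hw.1, hb, hw.2⟩
        · refine Or.inl ⟨hw.1, fun j hj => ?_⟩
          rcases Finset.mem_insert.1 hj with rfl | hj
          · exact hb
          · exact hw.2 j hj
      have hN1 := ih hT'
      have hp2 : 4 * p ≤ 1 := by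
        have : (1 : ℝ) ≤ D := by exact_mod_cast hD
        nlinarith
      nlinarith
  have := hpos S subset_rfl
  simp only [hN] at this
  obtain ⟨w, hw⟩ := Finset.card_pos.1 (Nat.cast_pos.1 this)
  rw [Finset.mem_filter] at hw
  exact ⟨w, hw.1, hw.2⟩

/-! ### Independent transversals by counting -/

section Transversal

variable {V W : Type*} (H : SimpleGraph W) (L : V → Finset W)

/-- The independent transversals of the lists of the vertices in `T`. -/
def transversals (T : Finset V) : Finset (Finset W) :=
  (ind H (T.biUnion L)).filter fun K => ∀ a ∈ T, (K ∩ L a).card = 1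

variable {H L}

theorem mem_transversals {T : Finset V} {K : Finset W} : K ∈ transversals H L T ↔
    K ∈ ind H (T.biUnion L) ∧ ∀ a ∈ T, (K ∩ L a).card = 1 := Finset.mem_filter

/-- A transversal of T extends by x unless it contains one of the at most k neighbours y of x.
Deleting y from a blocked transversal leaves a transversal of the lists other than that of y, and q
bounds the number of these. -/
theorem card_mul_le_card_transversals_insert {T : Finset V} {a : V} (ha : a ∉ T)
    (hdisj : ∀ b c x, x ∈ L b → x ∈ L c → b = c) {q : ℝ} {k : ℝ} (hq : 0 ≤ q)
    (hdeg : ∀ x ∈ L a, (((T.biUnion L).filter (H.Adj x)).card : ℝ) ≤ k)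
    (hrec : ∀ b ∈ T, ((transversals H L (T.erase b)).card : ℝ) ≤ q) :
    ((L a).card : ℝ) * ((transversals H L T).card - k * q) ≤
      (transversals H L (insert a T)).card := by
  set C := transversals H L T with hC
  set good : W → Finset (Finset W) := fun x => C.filter fun K => ∀ y ∈ K, ¬ H.Adj x y with hgood
  have h1 : ∀ x ∈ L a, (C.card : ℝ) - k * q ≤ (good x).card := by
    intro x hx
    have hsplit : C.card ≤ (good x).card +
        ∑ y ∈ (T.biUnion L).filter (H.Adj x), (C.filter fun K => y ∈ K).card := by
      refine (Finset.card_le_card (t := good x ∪ ((T.biUnion L).filter (H.Adj x)).biUnion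
        fun y => C.filter fun K => y ∈ K) ?_).trans ((Finset.card_union_le _ _).trans
          (Nat.add_le_add_left Finset.card_biUnion_le _))
      intro K hK
      rw [Finset.mem_union]
      by_cases h : ∃ y ∈ K, H.Adj x y
      · obtain ⟨y, hy, hxy⟩ := h
        refine Or.inr (Finset.mem_biUnion.2 ⟨y, ?_, Finset.mem_filter.2 ⟨hK, hy⟩⟩)
        have hK' := (Finset.mem_filter.1 hK).1
        exact Finset.mem_filter.2 ⟨(mem_ind.1 hK').1 hy, hxy⟩
      · push Not at h
        exact Or.inl (Finset.mem_filter.2 ⟨hK, h⟩)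
    have hy : ∀ y ∈ (T.biUnion L).filter (H.Adj x),
        (((C.filter fun K => y ∈ K).card : ℕ) : ℝ) ≤ q := by
      intro y hy
      obtain ⟨b, hb, hyb⟩ := Finset.mem_biUnion.1 (Finset.mem_filter.1 hy).1
      refine le_trans (Nat.cast_le.2 ?_) (hrec b hb)
      refine Finset.card_le_card_of_injOn (fun K => K.erase y) ?_ ?_
      · intro K hK
        rw [Finset.mem_coe, Finset.mem_filter, hC, mem_transversals, mem_ind] at hK
        obtain ⟨⟨⟨hKT, hKi⟩, hK1⟩, hyK⟩ := hK
        have hone : K ∩ L b = {y} := by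
          obtain ⟨z, hz⟩ := Finset.card_eq_one.1 (hK1 b hb)
          have : y ∈ K ∩ L b := Finset.mem_inter.2 ⟨hyK, hyb⟩
          rw [hz, Finset.mem_singleton] at this
          rw [hz, this]
        rw [Finset.mem_coe, mem_transversals, mem_ind]
        refine ⟨⟨?_, fun c hc d hd => hKi c (Finset.mem_of_mem_erase hc) d
          (Finset.mem_of_mem_erase hd)⟩, ?_⟩
        · intro z hz
          obtain ⟨hzy, hzK⟩ := Finset.mem_erase.1 hz
          obtain ⟨c, hc, hzc⟩ := Finset.mem_biUnion.1 (hKT hzK)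
          refine Finset.mem_biUnion.2 ⟨c, Finset.mem_erase.2 ⟨?_, hc⟩, hzc⟩
          rintro rfl
          have : z ∈ K ∩ L c := Finset.mem_inter.2 ⟨hzK, hzc⟩
          rw [hone, Finset.mem_singleton] at this
          exact hzy this
        · intro c hc
          obtain ⟨hcb, hcT⟩ := Finset.mem_erase.1 hc
          rw [← hK1 c hcT]
          congr 1
          ext z
          simp only [Finset.mem_inter, Finset.mem_erase]
          refine ⟨fun h => ⟨h.1.2, h.2⟩, fun h => ⟨⟨?_, h.1⟩, h.2⟩⟩
          rintro rfl
          exact hcb (hdisj c b z h.2 hyb)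
      · intro K hK K' hK' h
        have h1 := (Finset.mem_filter.1 hK).2
        have h2 := (Finset.mem_filter.1 hK').2
        rw [← Finset.insert_erase h1, ← Finset.insert_erase h2]
        exact congrArg (insert y) h
    have hsum : ((∑ y ∈ (T.biUnion L).filter (H.Adj x), (C.filter fun K => y ∈ K).card : ℕ) : ℝ) ≤
        k * q := by
      rw [Nat.cast_sum]
      refine (Finset.sum_le_card_nsmul _ _ _ hy).trans ?_
      rw [nsmul_eq_mul]
      exact mul_le_mul_of_nonneg_right (hdeg x hx) hq
    have := (Nat.cast_le (α := ℝ)).2 hsplit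
    rw [Nat.cast_add] at this
    linarith
  have h2 : ((L a).sigma good).card ≤ (transversals H L (insert a T)).card := by
    refine Finset.card_le_card_of_injOn (fun p => insert p.1 p.2) ?_ ?_
    · rintro ⟨x, K⟩ h
      rw [Finset.mem_coe, Finset.mem_sigma] at h
      obtain ⟨hx, hK⟩ := h
      rw [hgood, Finset.mem_filter, hC, mem_transversals, mem_ind] at hK
      obtain ⟨⟨⟨hKT, hKi⟩, hK1⟩, hxK⟩ := hK
      rw [Finset.mem_coe, mem_transversals, mem_ind]
      refine ⟨⟨?_, ?_⟩, ?_⟩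
      · rw [Finset.biUnion_insert]
        refine Finset.insert_subset (Finset.mem_union_left _ hx)
          (hKT.trans Finset.subset_union_right)
      · intro c hc d hd
        rcases Finset.mem_insert.1 hc with hc' | hc' <;> rcases Finset.mem_insert.1 hd with hd' | hd'
        · rw [hc', hd']; exact H.loopless.irrefl _
        · rw [hc']; exact hxK d hd'
        · rw [hd']; exact fun h => hxK c hc' h.symm
        · exact hKi c hc' d hd'
      · intro c hc
        rcases Finset.mem_insert.1 hc with rfl | hc
        · rw [Finset.card_eq_one]
          refine ⟨x, ?_⟩
          ext z
          simp only [Finset.mem_inter, Finset.mem_insert, Finset.mem_singleton]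
          constructor
          · rintro ⟨h | h, hz⟩
            · exact h
            · obtain ⟨d, hd, hzd⟩ := Finset.mem_biUnion.1 (hKT h)
              exact absurd (hdisj d c z hzd hz ▸ hd) ha
          · rintro rfl
            exact ⟨Or.inl rfl, hx⟩
        · rw [← hK1 c hc]
          congr 1
          ext z
          simp only [Finset.mem_inter, Finset.mem_insert]
          refine ⟨fun h => ⟨h.1.resolve_left ?_, h.2⟩, fun h => ⟨Or.inr h.1, h.2⟩⟩
          rintro rfl
          exact ha (hdisj c a z h.2 hx ▸ hc)
    · have hrec : ∀ x K, x ∈ L a → K ∈ good x → insert x K ∩ L a = {x} ∧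
          (insert x K).erase x = K := by
        intro x K hx hK
        rw [hgood, Finset.mem_filter, hC, mem_transversals, mem_ind] at hK
        have hKa : ∀ z ∈ K, z ∉ L a := by
          intro z hz hza
          obtain ⟨d, hd, hzd⟩ := Finset.mem_biUnion.1 (hK.1.1.1 hz)
          exact ha (hdisj d a z hzd hza ▸ hd)
        constructor
        · ext z
          simp only [Finset.mem_inter, Finset.mem_insert, Finset.mem_singleton]
          constructor
          · rintro ⟨h | h, hz⟩
            · exact h
            · exact absurd hz (hKa z h)
          · rintro rfl
            exact ⟨Or.inl rfl, hx⟩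
        · exact Finset.erase_insert fun h => hKa x h hx
      rintro ⟨x, K⟩ h ⟨x', K'⟩ h' heq
      rw [Finset.mem_coe, Finset.mem_sigma] at h h'
      obtain ⟨e1, e2⟩ := hrec x K h.1 h.2
      obtain ⟨e3, e4⟩ := hrec x' K' h'.1 h'.2
      dsimp only at heq
      rw [heq, e3, Finset.singleton_inj] at e1
      subst e1
      rw [heq, e4] at e2
      rw [e2]
  rw [Finset.card_sigma] at h2
  refine le_trans ?_ (Nat.cast_le.2 h2)
  rw [Nat.cast_sum, ← nsmul_eq_mul]
  exact Finset.card_nsmul_le_sum _ _ _ h1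

/-- Lists four times larger than the degrees have an independent transversal. -/
theorem exists_transversal (T : Finset V)
    (hdisj : ∀ b c x, x ∈ L b → x ∈ L c → b = c) {k : ℝ} (hk : 0 < k)
    (hlist : ∀ a ∈ T, 4 * k ≤ (L a).card)
    (hdeg : ∀ a ∈ T, ∀ x ∈ L a,
      (((T.biUnion L).filter fun y => y ∉ L a ∧ H.Adj x y).card : ℝ) ≤ k) :
    (transversals H L T).Nonempty := by
  -- Each new list multiplies the number of transversals by at least 2k. By induction q can be 1 /
  -- (2k) times the present number, so at most half of the transversals are blocked at a given
  -- colour, and half of 4k is 2k.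
  have key : ∀ n : ℕ, ∀ T' : Finset V, T'.card = n → T' ⊆ T →
      0 < (transversals H L T').card ∧ ∀ a ∈ T \ T',
      2 * k * ((transversals H L T').card : ℝ) ≤ (transversals H L (insert a T')).card := by
    intro n
    induction n using Nat.strong_induction_on with
    | _ n ih =>
      intro T' hn hT'
      have hpos : 0 < (transversals H L T').card := by
        rcases T'.eq_empty_or_nonempty with rfl | ⟨b, hb⟩
        · exact Finset.card_pos.2 ⟨∅, by simp [transversals, mem_ind]⟩
        · have hlt : (T'.erase b).card < n := by
            rw [← hn]; exact Finset.card_erase_lt_of_mem hb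
          obtain ⟨h1, h2⟩ := ih _ hlt (T'.erase b) rfl ((Finset.erase_subset _ _).trans hT')
          have h3 := h2 b (by simp [hT' hb])
          rw [Finset.insert_erase hb] at h3
          have : (0 : ℝ) < 2 * k * (transversals H L (T'.erase b)).card := by
            have : (0 : ℝ) < (transversals H L (T'.erase b)).card := by exact_mod_cast h1
            positivity
          exact_mod_cast this.trans_le h3
      refine ⟨hpos, fun a ha => ?_⟩
      obtain ⟨haT, haT'⟩ := Finset.mem_sdiff.1 ha
      have hC0 : (0 : ℝ) < (transversals H L T').card := by exact_mod_cast hpos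
      have h := card_mul_le_card_transversals_insert (H := H) haT' hdisj (k := k)
        (q := (transversals H L T').card / (2 * k)) (by positivity) (fun x hx => ?_)
        (fun b hb => ?_)
      · refine le_trans ?_ h
        have e : k * (((transversals H L T').card : ℝ) / (2 * k)) =
            (transversals H L T').card / 2 := by field_simp
        rw [e]
        have := mul_le_mul_of_nonneg_right (hlist a haT) hC0.le
        linarith
      · refine le_trans (Nat.cast_le.2 (Finset.card_le_card ?_)) (hdeg a haT x hx)
        intro y hy
        rw [Finset.mem_filter] at hy ⊢
        obtain ⟨b, hb, hyb⟩ := Finset.mem_biUnion.1 hy.1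
        refine ⟨Finset.mem_biUnion.2 ⟨b, hT' hb, hyb⟩, fun hya => ?_, hy.2⟩
        exact haT' (hdisj b a y hyb hya ▸ hb)
      · have hlt : (T'.erase b).card < n := by
          rw [← hn]; exact Finset.card_erase_lt_of_mem hb
        have h2 := (ih _ hlt (T'.erase b) rfl ((Finset.erase_subset _ _).trans hT')).2 b
          (by simp [hT' hb])
        rw [Finset.insert_erase hb] at h2
        rw [le_div_iff₀ (by positivity)]
        linarith
  exact Finset.card_pos.1 (key _ T rfl subset_rfl).1

end Transversal

/-! ### Deviation bounds for available colours -/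

section Concentration

variable {W : Type*} {H : SimpleGraph W}

theorem part_one (F : Finset W) : part H F 1 = (ind H F).card := by
  simp [part]

theorem sum_card_ind_free {A U : Finset W} (hU : U ⊆ A) :
    ∑ J ∈ ind H (A \ U), ((ind H (free H U J)).card : ℝ) = (ind H A).card := by
  have := part_fiber (G := H) hU 1
  simp only [part_one, one_pow, one_mul] at this
  exact this.symm

/-- The weights of the numbers of coloured neighbours of a colour. -/
def wt (θ η s : ℝ) (n : ℕ) : ℝ :=
  if n = 0 then 1 / 2 else if (n : ℝ) ≤ s then 1 + θ else 1 - 2 * η * θ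

/-- The weight has mean at most 1 on a uniform independent set, whatever Z is. If Z ≥ Z₀, small sets
have proportion at most η, and their gain θ is made up for by the loss 2ηθ on the others. If Z < Z₀,
the gains total at most θ Z₀ = 1/2, the loss on the empty set. -/
theorem sum_wt_le {F : Finset W} {Z₀ η s : ℝ} (hZ₀ : 1 ≤ Z₀) (hη : 0 < η)
    (hη2 : η ≤ 1 / 2) (h : Z₀ ≤ part H F 1 → small H F 1 s ≤ η * part H F 1) :
    ∑ Q ∈ ind H F, wt (1 / (2 * Z₀)) η s Q.card ≤ (ind H F).card := by
  set θ := 1 / (2 * Z₀) with hθ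
  have hθ0 : 0 < θ := by positivity
  have hθZ : θ * (2 * Z₀) = 1 := one_div_mul_cancel (by positivity)
  rw [← part_one]
  rcases le_or_gt Z₀ (part H F 1) with hZ | hZ
  · have hs := h hZ
    rw [← Finset.sum_filter_add_sum_filter_not (ind H F) (fun Q => (Q.card : ℝ) ≤ s)]
    have e1 : part H F 1 = small H F 1 s +
        ∑ Q ∈ (ind H F).filter (fun Q => ¬ (Q.card : ℝ) ≤ s), (1 : ℝ) := by
      rw [part, small, ← Finset.sum_filter_add_sum_filter_not (ind H F)
        (fun I => (I.card : ℝ) ≤ s)]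
      simp
    have h1 : ∑ Q ∈ (ind H F).filter (fun Q => (Q.card : ℝ) ≤ s), wt θ η s Q.card ≤
        (1 + θ) * small H F 1 s := by
      rw [small, Finset.mul_sum]
      refine Finset.sum_le_sum fun Q hQ => ?_
      rw [wt, if_pos (Finset.mem_filter.1 hQ).2, one_pow, mul_one]
      split_ifs <;> linarith
    have h2 : ∑ Q ∈ (ind H F).filter (fun Q => ¬ (Q.card : ℝ) ≤ s), wt θ η s Q.card ≤
        (1 - 2 * η * θ) * ∑ Q ∈ (ind H F).filter (fun Q => ¬ (Q.card : ℝ) ≤ s), (1 : ℝ) := by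
      rw [Finset.mul_sum]
      refine Finset.sum_le_sum fun Q hQ => ?_
      have hθ2 : θ ≤ 1 / 2 := by nlinarith
      have hηθ : 2 * η * θ ≤ 1 / 2 := by nlinarith
      rw [wt, if_neg (Finset.mem_filter.1 hQ).2]
      split_ifs <;> linarith
    set sm := small H F 1 s
    set lg := ∑ Q ∈ (ind H F).filter (fun Q => ¬ (Q.card : ℝ) ≤ s), (1 : ℝ)
    have hlg : sm ≤ 2 * η * lg := by
      rw [e1] at hs
      have h0 : 0 ≤ lg := Finset.sum_nonneg fun _ _ => zero_le_one
      have hsm : 0 ≤ sm := Finset.sum_nonneg fun _ _ => by positivity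
      nlinarith
    have := mul_le_mul_of_nonneg_left hlg hθ0.le
    rw [e1]
    linarith
  · rw [← Finset.add_sum_erase _ _ (empty_mem_ind F)]
    have e1 : part H F 1 = 1 + ∑ Q ∈ (ind H F).erase ∅, (1 : ℝ) := by
      rw [part, ← Finset.add_sum_erase _ _ (empty_mem_ind F)]
      simp
    have h1 : ∑ Q ∈ (ind H F).erase ∅, wt θ η s Q.card ≤
        (1 + θ) * ∑ Q ∈ (ind H F).erase ∅, (1 : ℝ) := by
      rw [Finset.mul_sum]
      refine Finset.sum_le_sum fun Q hQ => ?_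
      have hηθ : 0 < 2 * η * θ := by positivity
      rw [wt]
      split_ifs <;> linarith
    have h0 : wt θ η s (∅ : Finset W).card = 1 / 2 := by simp [wt]
    rw [h0, e1]
    rw [e1] at hZ
    set t := ∑ Q ∈ (ind H F).erase ∅, (1 : ℝ)
    have : θ * t ≤ θ * Z₀ := by gcongr; linarith
    linarith

/-- Domination of the numbers of coloured neighbours by independent variables. -/
theorem sum_prod_wt_le {ι : Type*} {A : Finset W} {N : ι → Finset W} {g : ℕ → ℝ}
    (hg : ∀ n, 0 ≤ g n) (T : Finset ι) (hN : ∀ x ∈ T, N x ⊆ A)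
    (hdisj : ∀ x ∈ T, ∀ y ∈ T, x ≠ y → Disjoint (N x) (N y))
    (h : ∀ x ∈ T, ∀ F ⊆ N x, ∑ Q ∈ ind H F, g Q.card ≤ (ind H F).card) :
    ∑ Q ∈ ind H A, ∏ x ∈ T, g (Q ∩ N x).card ≤ (ind H A).card := by
  induction T using Finset.induction_on with
  | empty => simp
  | insert x T hx ih =>
    refine le_trans ?_ (ih (fun y hy => hN y (Finset.mem_insert_of_mem hy))
      (fun y hy z hz => hdisj y (Finset.mem_insert_of_mem hy) z (Finset.mem_insert_of_mem hz))
      (fun y hy => h y (Finset.mem_insert_of_mem hy)))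
    have hxA := hN x (Finset.mem_insert_self x T)
    -- Given J outside N x, the factor of x depends only on Q and, by disjointness, the other
    -- factors depend only on J.
    rw [sum_ind_fiber hxA, sum_ind_fiber hxA]
    refine Finset.sum_le_sum fun J hJ => ?_
    have hJx : J ∩ N x = ∅ := by
      rw [← Finset.disjoint_iff_inter_eq_empty, Finset.disjoint_left]
      exact fun y hy => (Finset.mem_sdiff.1 ((mem_ind.1 hJ).1 hy)).2
    have e1 : ∀ Q ∈ ind H (free H (N x) J), (J ∪ Q) ∩ N x = Q := by
      intro Q hQ
      rw [Finset.union_inter_distrib_right, hJx, Finset.empty_union, Finset.inter_eq_left]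
      exact (mem_ind.1 hQ).1.trans (free_subset _ _)
    have e2 : ∀ Q ∈ ind H (free H (N x) J), ∏ y ∈ T, g ((J ∪ Q) ∩ N y).card =
        ∏ y ∈ T, g (J ∩ N y).card := by
      intro Q hQ
      refine Finset.prod_congr rfl fun y hy => ?_
      have hne : x ≠ y := fun h => hx (h ▸ hy)
      have hd := hdisj x (Finset.mem_insert_self x T) y (Finset.mem_insert_of_mem hy) hne
      have : Q ∩ N y = ∅ := by
        rw [← Finset.disjoint_iff_inter_eq_empty]
        exact hd.mono_left ((mem_ind.1 hQ).1.trans (free_subset _ _))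
      rw [Finset.union_inter_distrib_right, this, Finset.union_empty]
    have e3 : ∑ Q ∈ ind H (free H (N x) J), ∏ y ∈ insert x T, g ((J ∪ Q) ∩ N y).card =
        (∑ Q ∈ ind H (free H (N x) J), g Q.card) * ∏ y ∈ T, g (J ∩ N y).card := by
      rw [Finset.sum_mul]
      refine Finset.sum_congr rfl fun Q hQ => ?_
      rw [Finset.prod_insert hx, e1 Q hQ, e2 Q hQ]
    rw [e3, Finset.sum_congr rfl e2, Finset.sum_const, nsmul_eq_mul]
    refine mul_le_mul_of_nonneg_right ?_ (Finset.prod_nonneg fun y _ => hg _)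
    exact h x (Finset.mem_insert_self x T) _ (free_subset _ _)

/-- For use in the exponent: a colour earns θ / 2, pays 2 if it has no chosen neighbour, and returns
its gain with a small penalty if it has more than s of them. -/
theorem exp_le_wt {θ η s : ℝ} (hθ : 0 < θ) (hθ2 : θ ≤ 1 / 2) (hη : 0 < η) (hη2 : η ≤ 1 / 2)
    (n : ℕ) : Real.exp (θ / 2 - (if n = 0 then 2 else 0) -
      (if (n : ℝ) ≤ s then 0 else θ / 2 + 4 * η * θ)) ≤ wt θ η s n := by
  have hηθ : 2 * η * θ ≤ 1 / 2 := by nlinarith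
  have hηθ0 : 0 < η * θ := by positivity
  have hbase : ∀ y : ℝ, 0 ≤ y → y ≤ 1 / 2 → Real.exp (-(2 * y)) ≤ 1 - y := by
    intro y hy hy2
    rw [Real.exp_neg, inv_le_comm₀ (Real.exp_pos _) (by linarith)]
    have h1 := Real.add_one_le_exp (2 * y)
    refine le_trans ?_ h1
    rw [inv_le_iff_one_le_mul₀ (by linarith)]
    nlinarith
  rw [wt]
  by_cases h0 : n = 0
  · rw [if_pos h0, if_pos h0]
    have h1 : Real.exp (θ / 2 - 2 - if (n : ℝ) ≤ s then 0 else θ / 2 + 4 * η * θ) ≤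
        Real.exp (-(2 * (1 / 2))) := by
      refine Real.exp_le_exp.2 ?_
      split_ifs <;> linarith
    exact h1.trans ((hbase _ (by norm_num) le_rfl).trans (by norm_num))
  · rw [if_neg h0, if_neg h0]
    split_ifs with hs
    · have h1 : Real.exp (-(θ / 2)) ≥ 1 - θ / 2 := by
        have := Real.add_one_le_exp (-(θ / 2)); linarith
      have h2 : Real.exp (θ / 2) * Real.exp (-(θ / 2)) = 1 := by rw [← Real.exp_add]; simp
      have h3 := Real.exp_pos (θ / 2)
      simp only [sub_zero]
      have h4 : Real.exp (θ / 2) * (1 - θ / 2) ≤ 1 := by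
        have := mul_le_mul_of_nonneg_left h1 h3.le
        rwa [h2] at this
      have h5 : 1 ≤ (1 + θ) * (1 - θ / 2) := by nlinarith
      have h6 : 0 < 1 - θ / 2 := by linarith
      exact le_of_mul_le_mul_right (h4.trans h5) h6
    · have := hbase (2 * η * θ) (by positivity) hηθ
      refine le_trans (le_of_eq ?_) this
      congr 1
      ring

/-- It is unlikely that few of the colours are available. -/
theorem card_few_free_le {ι : Type*} {A : Finset W} {N : ι → Finset W} (T : Finset ι)
    (hN : ∀ x ∈ T, N x ⊆ A)
    (hdisj : ∀ x ∈ T, ∀ y ∈ T, x ≠ y → Disjoint (N x) (N y)) {Z₀ η s d ℓ X : ℝ}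
    (hZ₀ : 1 ≤ Z₀) (hη : 0 < η) (hη2 : η ≤ 1 / 2) (hs : 0 < s)
    (h : ∀ x ∈ T, ∀ F ⊆ N x, Z₀ ≤ part H F 1 → small H F 1 s ≤ η * part H F 1)
    (hd : ∀ Q ∈ ind H A, (Q.card : ℝ) ≤ d)
    (hX : 2 * ℓ + X ≤ 1 / (4 * Z₀) * (T.card - d / s - 8 * η * T.card)) :
    (((ind H A).filter fun Q => ((T.filter fun x => (Q ∩ N x).card = 0).card : ℝ) < ℓ).card : ℝ) ≤
      Real.exp (-X) * (ind H A).card := by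
  set θ := 1 / (2 * Z₀) with hθ
  have hθ0 : 0 < θ := by positivity
  have hθ2 : θ ≤ 1 / 2 := by
    rw [hθ]
    exact one_div_le_one_div_of_le (by norm_num) (by linarith)
  have hwt : ∀ n, 0 ≤ wt θ η s n := fun n => (Real.exp_pos _).le.trans (exp_le_wt hθ0 hθ2 hη hη2 n)
  have hsum := sum_prod_wt_le (H := H) (A := A) (N := N) hwt T hN hdisj
    fun x hx F hF => sum_wt_le hZ₀ hη hη2 (h x hx F hF)
  -- In this event fewer than ℓ colours pay 2, and at most d / s colours have more than s chosen
  -- neighbours, as the disjoint sets N x contain at most d elements of Q. The product of weights is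
  -- thus at least exp X, and Markov's inequality finishes.
  have hlow : ∀ Q ∈ (ind H A).filter
      (fun Q => ((T.filter fun x => (Q ∩ N x).card = 0).card : ℝ) < ℓ),
      Real.exp X ≤ ∏ x ∈ T, wt θ η s (Q ∩ N x).card := by
    intro Q hQ
    rw [Finset.mem_filter] at hQ
    refine le_trans ?_ (Finset.prod_le_prod (fun x _ => (Real.exp_pos _).le)
      fun x _ => exp_le_wt hθ0 hθ2 hη hη2 (s := s) (Q ∩ N x).card)
    rw [← Real.exp_sum]
    refine Real.exp_le_exp.2 ?_
    rw [Finset.sum_sub_distrib, Finset.sum_sub_distrib, Finset.sum_const, nsmul_eq_mul]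
    have e1 : ∑ x ∈ T, (if (Q ∩ N x).card = 0 then (2 : ℝ) else 0) =
        (T.filter fun x => (Q ∩ N x).card = 0).card * 2 := by
      rw [← Finset.sum_filter, Finset.sum_const, nsmul_eq_mul]
    set lg : ℝ := ((T.filter fun x => ¬ ((Q ∩ N x).card : ℝ) ≤ s).card : ℝ) with hlg
    have e2 : ∑ x ∈ T, (if ((Q ∩ N x).card : ℝ) ≤ s then (0 : ℝ) else θ / 2 + 4 * η * θ) =
        lg * (θ / 2 + 4 * η * θ) := by
      rw [hlg, ← nsmul_eq_mul, ← Finset.sum_const, Finset.sum_filter]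
      exact Finset.sum_congr rfl fun x _ => by simp only [ite_not]
    have h1 : lg ≤ T.card := Nat.cast_le.2 (Finset.card_filter_le _ _)
    have h2 : lg * s ≤ d := by
      refine le_trans ?_ (hd Q hQ.1)
      have h3 : ∑ x ∈ T, (Q ∩ N x).card ≤ Q.card := by
        rw [← Finset.card_biUnion]
        · exact Finset.card_le_card (Finset.biUnion_subset.2 fun x _ => Finset.inter_subset_left)
        · intro x hx y hy hxy
          exact (hdisj x hx y hy hxy).mono Finset.inter_subset_right Finset.inter_subset_right
      refine le_trans ?_ (Nat.cast_le.2 h3)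
      rw [Nat.cast_sum]
      refine le_trans ?_ (Finset.sum_le_sum_of_subset_of_nonneg
        (Finset.filter_subset (fun x => ¬ ((Q ∩ N x).card : ℝ) ≤ s) T)
        fun x _ _ => Nat.cast_nonneg _)
      rw [hlg, ← nsmul_eq_mul]
      exact Finset.card_nsmul_le_sum _ _ _ fun x hx => (not_le.1 (Finset.mem_filter.1 hx).2).le
    have h3 : lg ≤ d / s := (le_div_iff₀ hs).2 h2
    have e4 : 1 / (4 * Z₀) = θ / 2 := by rw [hθ]; field_simp; norm_num
    rw [e4] at hX
    rw [e1, e2]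
    have h4 : lg * (θ / 2) ≤ d / s * (θ / 2) := by gcongr
    have h5 : lg * (4 * η * θ) ≤ T.card * (4 * η * θ) := by gcongr
    linarith [hQ.2]
  have h1 := (Finset.card_nsmul_le_sum _ _ _ hlow).trans
    ((Finset.sum_le_sum_of_subset_of_nonneg (Finset.filter_subset _ _)
      fun Q _ _ => Finset.prod_nonneg fun x _ => hwt _).trans hsum)
  rw [nsmul_eq_mul] at h1
  rw [Real.exp_neg, inv_mul_eq_div, le_div_iff₀ (Real.exp_pos _)]
  exact h1

/-- It is unlikely that an available colour has many available neighbours. -/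
theorem card_many_free_le {A U : Finset W} (hU : U ⊆ A) {k Y : ℝ}
    (h : ∀ F ⊆ U, k ≤ F.card → Real.exp Y ≤ part H F 1) :
    (((ind H A).filter fun Q => (Q ∩ U).card = 0 ∧ k ≤ (free H U Q).card).card : ℝ) ≤
      Real.exp (-Y) * (ind H A).card := by
  rw [Real.exp_neg, inv_mul_eq_div, le_div_iff₀ (Real.exp_pos _), ← sum_card_ind_free hU]
  set B := (ind H A).filter fun Q => (Q ∩ U).card = 0 ∧ k ≤ (free H U Q).card with hB
  -- Each Q in B is empty on U, and is only one of at least exp Y independent sets with the same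
  -- part outside U.
  have hsub : B ⊆ ind H (A \ U) := by
    intro Q hQ
    obtain ⟨h1, h2, -⟩ := Finset.mem_filter.1 hQ
    rw [Finset.card_eq_zero, ← Finset.disjoint_iff_inter_eq_empty] at h2
    exact mem_ind.2 ⟨fun y hy => Finset.mem_sdiff.2 ⟨(mem_ind.1 h1).1 hy,
      Finset.disjoint_left.1 h2 hy⟩, (mem_ind.1 h1).2⟩
  refine le_trans ?_ (Finset.sum_le_sum_of_subset_of_nonneg hsub fun _ _ _ => Nat.cast_nonneg _)
  rw [← nsmul_eq_mul]
  refine Finset.card_nsmul_le_sum _ _ _ fun Q hQ => ?_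
  rw [← part_one]
  exact h _ (free_subset _ _) (Finset.mem_filter.1 hQ).2.2

end Concentration

/-! ### Random partial colourings of a cover and their completion -/

section Lists

set_option linter.unusedSectionVars false

variable {V W : Type*} [Fintype V]

/-- The lists of a cover, or parts of them. -/
structure ListSystem (G : SimpleGraph V) (H : SimpleGraph W) (L : V → Finset W) : Prop where
  disj : ∀ a b x, x ∈ L a → x ∈ L b → a = b
  clique : ∀ a, ∀ x ∈ L a, ∀ y ∈ L a, x ≠ y → H.Adj x y
  edges : ∀ a b, ∀ x ∈ L a, ∀ y ∈ L b, H.Adj x y → a = b ∨ G.Adj a b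
  matching : ∀ a b, G.Adj a b → ∀ x ∈ L a, ∀ y ∈ L b, ∀ z ∈ L b, H.Adj x y → H.Adj x z → y = z

/-- The closed neighbourhood of a vertex. -/
def cnbrs (G : SimpleGraph V) (a : V) : Finset V := insert a (nbrs G a)

theorem mem_cnbrs {G : SimpleGraph V} {a b : V} : b ∈ cnbrs G a ↔ b = a ∨ G.Adj a b := by
  simp [cnbrs, mem_nbrs]

theorem mem_cnbrs_comm {G : SimpleGraph V} {a b : V} : b ∈ cnbrs G a ↔ a ∈ cnbrs G b := by
  rw [mem_cnbrs, mem_cnbrs, G.adj_comm, eq_comm]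

theorem card_cnbrs_le (G : SimpleGraph V) (a : V) : (cnbrs G a).card ≤ G.maxDegree + 1 :=
  (Finset.card_insert_le _ _).trans (by
    rw [card_nbrs]; exact Nat.succ_le_succ (G.degree_le_maxDegree a))

/-- The colours of the neighbours that are not in the list of `a` and adjacent to `x`. -/
def conflicts (H : SimpleGraph W) (L : V → Finset W) (a : V) (x : W) : Finset W :=
  (Finset.univ.biUnion L).filter fun y => y ∉ L a ∧ H.Adj x y

/-- The vertex `a` is uncoloured by `I`, and either it has few available colours or one of them
conflicts with many available colours. -/
def Bad (H : SimpleGraph W) (L : V → Finset W) (ℓ k : ℝ) (a : V) (I : Finset W) : Prop :=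
  (∀ x ∈ L a, x ∉ I) ∧ (((free H (L a) I).card : ℝ) < ℓ ∨
    ∃ x ∈ free H (L a) I, k ≤ (free H (conflicts H L a x) I).card)

variable {G : SimpleGraph V} {H : SimpleGraph W} {L : V → Finset W}

theorem ListSystem.adj_mem (hL : ListSystem G H L) {a b : V} {x y : W} (hx : x ∈ L a)
    (hy : y ∈ L b) (h : H.Adj x y) : b ∈ cnbrs G a := by
  rw [mem_cnbrs]
  exact (hL.edges a b x hx y hy h).imp Eq.symm id

theorem ListSystem.free_iff (hL : ListSystem G H L) {I I' : Finset W}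
    (hI' : I' ⊆ Finset.univ.biUnion L) {b : V} {y : W}
    (h : ∀ c ∈ cnbrs G b, ∀ x ∈ L c, x ∈ I' → x ∈ I) (hy : y ∈ L b)
    (hf : ∀ z ∈ I, ¬ H.Adj y z) : ∀ z ∈ I', ¬ H.Adj y z := by
  intro z hz hyz
  obtain ⟨c, -, hc⟩ := Finset.mem_biUnion.1 (hI' hz)
  exact hf z (h c (hL.adj_mem hy hc hyz) z hc hz) hyz

/-- The bad event at a is determined by I on the lists at distance at most two: conflicts of a lie
in lists of neighbours, and their availability is decided one step further. -/
theorem ListSystem.bad_congr (hL : ListSystem G H L) {ℓ k : ℝ} {a : V} {I I' : Finset W}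
    (hI : I ⊆ Finset.univ.biUnion L) (hI' : I' ⊆ Finset.univ.biUnion L)
    (h : ∀ b ∈ cnbrs G a, ∀ c ∈ cnbrs G b, ∀ x ∈ L c, (x ∈ I ↔ x ∈ I'))
    (hbad : Bad H L ℓ k a I) : Bad H L ℓ k a I' := by
  have haa : a ∈ cnbrs G a := mem_cnbrs.2 (Or.inl rfl)
  have hfree : ∀ b ∈ cnbrs G a, ∀ y ∈ L b,
      ((∀ z ∈ I, ¬ H.Adj y z) ↔ ∀ z ∈ I', ¬ H.Adj y z) := fun b hb y hy =>
    ⟨hL.free_iff hI' (fun c hc x hx => (h b hb c hc x hx).2) hy,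
      hL.free_iff hI (fun c hc x hx => (h b hb c hc x hx).1) hy⟩
  have e1 : free H (L a) I = free H (L a) I' := by
    ext y
    rw [mem_free, mem_free]
    exact and_congr_right fun hy => hfree a haa y hy
  have e2 : ∀ x ∈ L a, free H (conflicts H L a x) I = free H (conflicts H L a x) I' := by
    intro x hx
    ext y
    rw [mem_free, mem_free]
    refine and_congr_right fun hy => ?_
    rw [conflicts, Finset.mem_filter] at hy
    obtain ⟨b, -, hb⟩ := Finset.mem_biUnion.1 hy.1
    exact hfree b (hL.adj_mem hx hb hy.2.2) y hb
  refine ⟨fun x hx hxI => hbad.1 x hx ((h a haa a haa x hx).2 hxI), ?_⟩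
  rw [← e1]
  refine hbad.2.imp id ?_
  rintro ⟨x, hx, hk⟩
  exact ⟨x, hx, by rwa [← e2 x (mem_free.1 hx).1]⟩

/-- By the matching condition the neighbours of x in these lists project injectively to N(a), and
cliques of H go to cliques of G. -/
theorem ListSystem.cliqueLE (hL : ListSystem G H L) {a : V} {r : ℕ} (hr : CliqueLE G (nbrs G a) r)
    {x : W} (hx : x ∈ L a) {F : Finset W} (hF : F ⊆ (nbrs G a).biUnion L)
    (hadj : ∀ y ∈ F, H.Adj x y) : CliqueLE H F r := by
  intro Q hQ hc
  have hex : ∀ y : W, ∃ b : V, y ∈ Q → b ∈ nbrs G a ∧ y ∈ L b := by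
    intro y
    by_cases hy : y ∈ Q
    · obtain ⟨b, hb, hyb⟩ := Finset.mem_biUnion.1 (hF (hQ hy))
      exact ⟨b, fun _ => ⟨hb, hyb⟩⟩
    · exact ⟨a, fun h => absurd h hy⟩
  choose π hπ using hex
  have hinj : Set.InjOn π (Q : Set W) := by
    intro y hy z hz hyz
    have h1 := hπ y hy
    have h2 := hπ z hz
    rw [← hyz] at h2
    exact hL.matching a (π y) (mem_nbrs.1 h1.1) x hx y h1.2 z h2.2 (hadj y (hQ hy)) (hadj z (hQ hz))
  rw [← Finset.card_image_of_injOn hinj]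
  refine hr _ ?_ ?_
  · intro b hb
    obtain ⟨y, hy, rfl⟩ := Finset.mem_image.1 hb
    exact (hπ y hy).1
  · intro b hb c hc' hbc
    obtain ⟨y, hy, rfl⟩ := Finset.mem_image.1 (Finset.mem_coe.1 hb)
    obtain ⟨z, hz, rfl⟩ := Finset.mem_image.1 (Finset.mem_coe.1 hc')
    have hyz : y ≠ z := fun h => hbc (h ▸ rfl)
    exact (hL.edges _ _ y (hπ y hy).2 z (hπ z hz).2 (hc hy hz hyz)).resolve_left hbc

/-- What is required of a vertex `a` for the bad event at `a` to be unlikely. -/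
structure Admissible (G : SimpleGraph V) (H : SimpleGraph W) (L : V → Finset W) (ℓ k X Y : ℝ)
    (a : V) (r : ℕ) (Z₀ η s : ℝ) : Prop where
  one_le : 1 ≤ Z₀
  η_pos : 0 < η
  η_le : η ≤ 1 / 2
  s_pos : 0 < s
  clique : CliqueLE G (nbrs G a) r
  small_le : ∀ F : Finset W, CliqueLE H F r → Z₀ ≤ part H F 1 → small H F 1 s ≤ η * part H F 1
  le_part : ∀ F : Finset W, CliqueLE H F r → k ≤ F.card → Real.exp Y ≤ part H F 1
  list : 2 * ℓ + X ≤ 1 / (4 * Z₀) *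
    ((L a).card - (G.degree a : ℝ) / s - 8 * η * (L a).card)

/-- The partial colouring J outside the closed neighbourhood is fixed. If a is uncoloured, Q lies in
the lists of its neighbours, at most one colour from each since lists are cliques; this gives d =
deg(a). The sets N x are disjoint by the matching condition. The two terms account for few available
colours and, by a union bound over the list, for an available colour with many available conflicts.
-/
theorem ListSystem.card_bad_le (hL : ListSystem G H L) {ℓ k X Y : ℝ} {a : V} {r : ℕ}
    {Z₀ η s : ℝ} (ha : Admissible G H L ℓ k X Y a r Z₀ η s) {J : Finset W}
    (hJ : J ∈ ind H (Finset.univ.biUnion L \ (cnbrs G a).biUnion L)) :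
    (((ind H (free H ((cnbrs G a).biUnion L) J)).filter
      fun Q => Bad H L ℓ k a (J ∪ Q)).card : ℝ) ≤
      (Real.exp (-X) + (L a).card * Real.exp (-Y)) *
        (ind H (free H ((cnbrs G a).biUnion L) J)).card := by
  set F := free H ((cnbrs G a).biUnion L) J with hF
  set A := free H ((nbrs G a).biUnion L) J with hA
  set N : W → Finset W := fun x => A.filter (H.Adj x) with hN
  have hJU : ∀ z ∈ J, ∀ c ∈ cnbrs G a, z ∉ L c := by
    intro z hz c hc hzc
    exact (Finset.mem_sdiff.1 ((mem_ind.1 hJ).1 hz)).2 (Finset.mem_biUnion.2 ⟨c, hc, hzc⟩)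
  have hJb : ∀ z ∈ J, ∃ c, z ∈ L c := by
    intro z hz
    obtain ⟨c, -, hc⟩ := Finset.mem_biUnion.1 (Finset.mem_sdiff.1 ((mem_ind.1 hJ).1 hz)).1
    exact ⟨c, hc⟩
  have hAF : A ⊆ F := by
    intro y hy
    rw [hA, mem_free] at hy
    refine mem_free.2 ⟨?_, hy.2⟩
    obtain ⟨b, hb, hyb⟩ := Finset.mem_biUnion.1 hy.1
    exact Finset.mem_biUnion.2 ⟨b, Finset.mem_insert_of_mem hb, hyb⟩
  have hindAF : ind H A ⊆ ind H F := fun Q hQ =>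
    mem_ind.2 ⟨(mem_ind.1 hQ).1.trans hAF, (mem_ind.1 hQ).2⟩
  have hNcl : ∀ x ∈ L a, CliqueLE H (N x) r := fun x hx =>
    hL.cliqueLE ha.clique hx ((Finset.filter_subset _ _).trans (free_subset _ _))
      fun y hy => (Finset.mem_filter.1 hy).2
  have hNdisj : ∀ x ∈ L a, ∀ x' ∈ L a, x ≠ x' → Disjoint (N x) (N x') := by
    intro x hx x' hx' hne
    rw [Finset.disjoint_left]
    intro y hy hy'
    obtain ⟨hyA, hxy⟩ := Finset.mem_filter.1 hy
    obtain ⟨-, hxy'⟩ := Finset.mem_filter.1 hy'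
    obtain ⟨b, hb, hyb⟩ := Finset.mem_biUnion.1 (mem_free.1 hyA).1
    exact hne (hL.matching b a (mem_nbrs.1 hb).symm y hyb x hx x' hx' hxy.symm hxy'.symm)
  have hd : ∀ Q ∈ ind H A, (Q.card : ℝ) ≤ G.degree a := by
    intro Q hQ
    rw [← card_nbrs]
    refine Nat.cast_le.2 ?_
    have hsub : Q ⊆ (nbrs G a).biUnion fun b => Q ∩ L b := by
      intro y hy
      obtain ⟨b, hb, hyb⟩ := Finset.mem_biUnion.1 (mem_free.1 ((mem_ind.1 hQ).1 hy)).1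
      exact Finset.mem_biUnion.2 ⟨b, hb, Finset.mem_inter.2 ⟨hy, hyb⟩⟩
    refine (Finset.card_le_card hsub).trans
      ((Finset.card_biUnion_le_card_mul _ _ 1 fun b _ => ?_).trans (by rw [mul_one]))
    rw [Finset.card_le_one]
    intro y hy z hz
    rw [Finset.mem_inter] at hy hz
    by_contra hne
    exact (mem_ind.1 hQ).2 y hy.1 z hz.1 (hL.clique b y hy.2 z hz.2 hne)
  have hfew := card_few_free_le (H := H) (A := A) (N := N) (L a)
    (fun x _ => Finset.filter_subset _ _) hNdisj ha.one_le ha.η_pos ha.η_le ha.s_pos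
    (fun x hx F hF => ha.small_le F ((hNcl x hx).mono hF)) hd ha.list
  have hmany : ∀ x ∈ L a,
      (((ind H A).filter fun Q => (Q ∩ N x).card = 0 ∧ k ≤ (free H (N x) Q).card).card : ℝ) ≤
      Real.exp (-Y) * (ind H A).card := fun x hx =>
    card_many_free_le (Finset.filter_subset _ _)
      fun F hF => ha.le_part F ((hNcl x hx).mono hF)
  have hcover : ((ind H F).filter fun Q => Bad H L ℓ k a (J ∪ Q)) ⊆
      ((ind H A).filter fun Q => (((L a).filter fun x => (Q ∩ N x).card = 0).card : ℝ) < ℓ) ∪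
      (L a).biUnion fun x => (ind H A).filter
        fun Q => (Q ∩ N x).card = 0 ∧ k ≤ (free H (N x) Q).card := by
    intro Q hQ
    obtain ⟨hQF, hunc, hbad⟩ := Finset.mem_filter.1 hQ
    rw [mem_ind] at hQF
    have hQA : Q ⊆ A := by
      intro y hy
      obtain ⟨hyU, hyJ⟩ := mem_free.1 (hQF.1 hy)
      obtain ⟨b, hb, hyb⟩ := Finset.mem_biUnion.1 hyU
      refine mem_free.2 ⟨Finset.mem_biUnion.2 ⟨b, ?_, hyb⟩, hyJ⟩
      rcases Finset.mem_insert.1 hb with rfl | hb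
      · exact absurd (Finset.mem_union_right _ hy) (hunc y hyb)
      · exact hb
    have hQi : Q ∈ ind H A := mem_ind.2 ⟨hQA, hQF.2⟩
    rw [Finset.mem_union, Finset.mem_biUnion]
    rcases hbad with hbad | ⟨x, hx, hk⟩
    · refine Or.inl (Finset.mem_filter.2 ⟨hQi, lt_of_le_of_lt (Nat.cast_le.2
        (Finset.card_le_card ?_)) hbad⟩)
      intro x hx
      obtain ⟨hxa, h0⟩ := Finset.mem_filter.1 hx
      refine mem_free.2 ⟨hxa, fun z hz hxz => ?_⟩
      rcases Finset.mem_union.1 hz with hz | hz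
      · obtain ⟨c, hc⟩ := hJb z hz
        exact hJU z hz c (hL.adj_mem hxa hc hxz) hc
      · rw [Finset.card_eq_zero] at h0
        have : z ∈ Q ∩ N x := Finset.mem_inter.2 ⟨hz, Finset.mem_filter.2 ⟨hQA hz, hxz⟩⟩
        rw [h0] at this
        simp at this
    · obtain ⟨hxa, hxf⟩ := mem_free.1 hx
      refine Or.inr ⟨x, hxa, Finset.mem_filter.2 ⟨hQi, ?_, hk.trans (Nat.cast_le.2
        (Finset.card_le_card ?_))⟩⟩
      · rw [Finset.card_eq_zero, Finset.eq_empty_iff_forall_notMem]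
        intro z hz
        rw [Finset.mem_inter] at hz
        exact hxf z (Finset.mem_union_right _ hz.1) (Finset.mem_filter.1 hz.2).2
      · intro y hy
        obtain ⟨hyc, hyf⟩ := mem_free.1 hy
        rw [conflicts, Finset.mem_filter] at hyc
        obtain ⟨hyb, hya, hxy⟩ := hyc
        obtain ⟨b, -, hb⟩ := Finset.mem_biUnion.1 hyb
        refine mem_free.2 ⟨Finset.mem_filter.2 ⟨mem_free.2 ⟨Finset.mem_biUnion.2 ⟨b, ?_, hb⟩,
          fun z hz => hyf z (Finset.mem_union_left _ hz)⟩, hxy⟩,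
          fun z hz => hyf z (Finset.mem_union_right _ hz)⟩
        rcases mem_cnbrs.1 (hL.adj_mem hxa hb hxy) with rfl | h
        · exact absurd hb hya
        · exact mem_nbrs.2 h
  have h1 : (((ind H F).filter fun Q => Bad H L ℓ k a (J ∪ Q)).card : ℝ) ≤
      (Real.exp (-X) + (L a).card * Real.exp (-Y)) * (ind H A).card := by
    refine (Nat.cast_le.2 ((Finset.card_le_card hcover).trans ((Finset.card_union_le _ _).trans
      (Nat.add_le_add_left Finset.card_biUnion_le _)))).trans ?_
    rw [Nat.cast_add, Nat.cast_sum, add_mul]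
    refine add_le_add hfew ((Finset.sum_le_card_nsmul _ _ _ hmany).trans (le_of_eq ?_))
    rw [nsmul_eq_mul, mul_assoc]
  refine h1.trans (mul_le_mul_of_nonneg_left (Nat.cast_le.2 (Finset.card_le_card hindAF)) ?_)
  positivity

/-- The vertices at distance at most three from `a`. -/
def ballThree (G : SimpleGraph V) (a : V) : Finset V :=
  (cnbrs G a).biUnion fun c => (cnbrs G c).biUnion fun b => cnbrs G b

theorem card_ballThree_le (a : V) : (ballThree G a).card ≤ (G.maxDegree + 1) ^ 3 := by
  refine (Finset.card_biUnion_le_card_mul _ _ ((G.maxDegree + 1) * (G.maxDegree + 1)) fun c _ =>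
    (Finset.card_biUnion_le_card_mul _ _ (G.maxDegree + 1) fun b _ => card_cnbrs_le G b).trans
      (Nat.mul_le_mul_right _ (card_cnbrs_le G c))).trans
    ((Nat.mul_le_mul_right _ (card_cnbrs_le G a)).trans (le_of_eq (by ring)))

/-- Resampling the closed neighbourhood of a does not affect bad events at distance more than three.
As `card_bad_le` holds for every fixed J, conditioning on such events does no harm, and the local
lemma applies. -/
theorem ListSystem.exists_forall_not_bad (hL : ListSystem G H L) {ℓ k X Y p : ℝ} {S : Finset V}
    (hp : 0 ≤ p) (hpD : 4 * p * ((G.maxDegree : ℝ) + 1) ^ 3 ≤ 1)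
    (h : ∀ a ∈ S, ∃ r Z₀ η s, Admissible G H L ℓ k X Y a r Z₀ η s)
    (hpa : ∀ a ∈ S, Real.exp (-X) + (L a).card * Real.exp (-Y) ≤ p) :
    ∃ I ∈ ind H (Finset.univ.biUnion L), ∀ a ∈ S, ¬ Bad H L ℓ k a I := by
  refine exists_forall_not_of_lopsided (ind H (Finset.univ.biUnion L)) ⟨∅, empty_mem_ind _⟩
    (fun a I => Bad H L ℓ k a I) S (ballThree G) (p := p) (D := (G.maxDegree + 1) ^ 3)
    (Nat.one_le_pow _ _ (Nat.succ_pos _)) hp (by push_cast; exact hpD)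
    (fun a _ => card_ballThree_le a) ?_
  intro a ha T hT hdisj
  obtain ⟨r, Z₀, η, s, hadm⟩ := h a ha
  set U := (cnbrs G a).biUnion L with hU
  have hUb : U ⊆ Finset.univ.biUnion L := Finset.biUnion_subset_biUnion_of_subset_left _
    (Finset.subset_univ _)
  have hfar : ∀ j ∈ T, ∀ J ∈ ind H (Finset.univ.biUnion L \ U), ∀ Q ∈ ind H (free H U J),
      (Bad H L ℓ k j (J ∪ Q) ↔ Bad H L ℓ k j J) := by
    intro j hj J hJ Q hQ
    have hJb : J ⊆ Finset.univ.biUnion L := (mem_ind.1 hJ).1.trans Finset.sdiff_subset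
    have hQU : Q ⊆ U := (mem_ind.1 hQ).1.trans (free_subset _ _)
    have hJQ : J ∪ Q ⊆ Finset.univ.biUnion L := Finset.union_subset hJb (hQU.trans hUb)
    have hag : ∀ b ∈ cnbrs G j, ∀ c ∈ cnbrs G b, ∀ x ∈ L c, (x ∈ J ∪ Q ↔ x ∈ J) := by
      intro b hb c hc x hx
      rw [Finset.mem_union]
      refine or_iff_left fun hxQ => ?_
      obtain ⟨c', hc', hxc'⟩ := Finset.mem_biUnion.1 (hQU hxQ)
      have := hL.disj c c' x hx hxc'
      subst this
      exact Finset.disjoint_left.1 hdisj hj (Finset.mem_biUnion.2 ⟨c, hc',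
        Finset.mem_biUnion.2 ⟨b, mem_cnbrs_comm.1 hc, mem_cnbrs_comm.1 hb⟩⟩)
    exact ⟨hL.bad_congr hJQ hJb hag,
      hL.bad_congr hJb hJQ fun b hb c hc x hx => (hag b hb c hc x hx).symm⟩
  rw [Finset.card_filter, Finset.card_filter, Nat.cast_sum, Nat.cast_sum, sum_ind_fiber hUb,
    sum_ind_fiber hUb, Finset.mul_sum]
  refine Finset.sum_le_sum fun J hJ => ?_
  by_cases hJT : ∀ j ∈ T, ¬ Bad H L ℓ k j J
  · have e1 : ∀ Q ∈ ind H (free H U J), ∀ j ∈ T, ¬ Bad H L ℓ k j (J ∪ Q) :=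
      fun Q hQ j hj => fun hb => hJT j hj ((hfar j hj J hJ Q hQ).1 hb)
    refine (le_of_eq ?_).trans (((hL.card_bad_le hadm hJ).trans
      (mul_le_mul_of_nonneg_right (hpa a ha) (Nat.cast_nonneg _))).trans (le_of_eq ?_))
    · rw [Finset.card_filter, Nat.cast_sum]
      refine Finset.sum_congr rfl fun Q hQ => ?_
      by_cases hb : Bad H L ℓ k a (J ∪ Q)
      · rw [if_pos ⟨hb, e1 Q hQ⟩, if_pos hb]
      · rw [if_neg fun h => hb h.1, if_neg hb]
    · rw [Finset.card_eq_sum_ones, Nat.cast_sum]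
      congr 1
      refine Finset.sum_congr rfl fun Q hQ => ?_
      rw [if_pos (e1 Q hQ)]
  · have e1 : ∀ Q ∈ ind H (free H U J), ¬ ∀ j ∈ T, ¬ Bad H L ℓ k j (J ∪ Q) :=
      fun Q hQ hb => hJT fun j hj => fun hb' => hb j hj ((hfar j hj J hJ Q hQ).2 hb')
    rw [Finset.sum_eq_zero]
    · exact mul_nonneg hp (Finset.sum_nonneg fun _ _ => Nat.cast_nonneg _)
    · intro Q hQ
      rw [if_neg fun hb => e1 Q hQ hb.2, Nat.cast_zero]

/-- The vertices of S left uncoloured by I have at least 4k available colours, each with fewer than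
k available conflicts, so a transversal of the available colours completes I. -/
theorem ListSystem.exists_partial_colouring (hL : ListSystem G H L) {k : ℝ} (hk : 0 < k)
    {S : Finset V} {I : Finset W} (hI : I ∈ ind H (Finset.univ.biUnion L))
    (hgood : ∀ a ∈ S, ¬ Bad H L (4 * k) k a I) :
    ∃ I ∈ ind H (Finset.univ.biUnion L), ∀ a ∈ S, ∃ x ∈ L a, x ∈ I := by
  set T := S.filter fun a => ∀ x ∈ L a, x ∉ I with hT
  have hgoodT : ∀ a ∈ T, 4 * k ≤ ((free H (L a) I).card : ℝ) ∧
      ∀ x ∈ free H (L a) I, ((free H (conflicts H L a x) I).card : ℝ) < k := by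
    intro a ha
    obtain ⟨haS, hunc⟩ := Finset.mem_filter.1 ha
    have := hgood a haS
    rw [Bad, not_and, not_or, not_lt, not_exists] at this
    refine ⟨(this hunc).1, fun x hx => ?_⟩
    have := (this hunc).2 x
    rw [not_and, not_le] at this
    exact this hx
  obtain ⟨K, hK⟩ := exists_transversal (H := H) (L := fun a => free H (L a) I) T
    (fun b c x hx hx' => hL.disj b c x (mem_free.1 hx).1 (mem_free.1 hx').1) hk
    (fun a ha => (hgoodT a ha).1) (by
      intro a ha x hx
      refine le_trans (Nat.cast_le.2 (Finset.card_le_card ?_)) ((hgoodT a ha).2 x hx).le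
      intro y hy
      obtain ⟨hyT, hya, hxy⟩ := Finset.mem_filter.1 hy
      obtain ⟨b, hb, hyb⟩ := Finset.mem_biUnion.1 hyT
      obtain ⟨hyb, hyf⟩ := mem_free.1 hyb
      refine mem_free.2 ⟨Finset.mem_filter.2 ⟨Finset.mem_biUnion.2 ⟨b, Finset.mem_univ _, hyb⟩,
        fun h => hya (mem_free.2 ⟨h, hyf⟩), hxy⟩, hyf⟩)
  rw [mem_transversals, mem_ind] at hK
  obtain ⟨⟨hKT, hKi⟩, hK1⟩ := hK
  have hKf : ∀ y ∈ K, (∃ b, y ∈ L b) ∧ ∀ z ∈ I, ¬ H.Adj y z := by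
    intro y hy
    obtain ⟨b, -, hyb⟩ := Finset.mem_biUnion.1 (hKT hy)
    exact ⟨⟨b, (mem_free.1 hyb).1⟩, (mem_free.1 hyb).2⟩
  refine ⟨I ∪ K, mem_ind.2 ⟨Finset.union_subset (mem_ind.1 hI).1 fun y hy => ?_, ?_⟩, ?_⟩
  · obtain ⟨⟨b, hb⟩, -⟩ := hKf y hy
    exact Finset.mem_biUnion.2 ⟨b, Finset.mem_univ _, hb⟩
  · intro y hy z hz
    rcases Finset.mem_union.1 hy with hy' | hy' <;> rcases Finset.mem_union.1 hz with hz' | hz'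
    · exact (mem_ind.1 hI).2 y hy' z hz'
    · exact fun h => (hKf z hz').2 y hy' h.symm
    · exact (hKf y hy').2 z hz'
    · exact hKi y hy' z hz'
  · intro a ha
    by_cases h : ∃ x ∈ L a, x ∈ I
    · obtain ⟨x, hx, hxI⟩ := h
      exact ⟨x, hx, Finset.mem_union_left _ hxI⟩
    · push Not at h
      have h1 := hK1 a (Finset.mem_filter.2 ⟨ha, h⟩)
      obtain ⟨x, hx⟩ := Finset.card_pos.1 (by rw [h1]; exact one_pos)
      rw [Finset.mem_inter] at hx
      exact ⟨x, (mem_free.1 hx.2).1, Finset.mem_union_right _ hx.1⟩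

/-- Vertices with more colours than neighbours can be coloured greedily. -/
theorem ListSystem.exists_extension (hL : ListSystem G H L) {S : Finset V} {I : Finset W}
    (hI : I ∈ ind H (Finset.univ.biUnion L)) (hIS : ∀ a ∈ S, ∃ x ∈ L a, x ∈ I) (T : Finset V)
    (hT : ∀ a ∈ T, G.degree a < (L a).card) :
    ∃ I ∈ ind H (Finset.univ.biUnion L), ∀ a ∈ S ∪ T, ∃ x ∈ L a, x ∈ I := by
  induction T using Finset.induction_on with
  | empty => exact ⟨I, hI, by simpa using hIS⟩
  | insert a T _ ih =>
    obtain ⟨I, hI, hIT⟩ := ih fun b hb => hT b (Finset.mem_insert_of_mem hb)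
    by_cases hcol : ∃ x ∈ L a, x ∈ I
    · refine ⟨I, hI, fun b hb => ?_⟩
      rw [Finset.union_insert, Finset.mem_insert] at hb
      rcases hb with rfl | hb
      · exact hcol
      · exact hIT b hb
    have hblock : ((L a).filter fun x => ∃ z ∈ I, H.Adj x z).card ≤ G.degree a := by
      rw [← card_nbrs]
      have hsub : ((L a).filter fun x => ∃ z ∈ I, H.Adj x z) ⊆
          (nbrs G a).biUnion fun b => (L a).filter fun x => ∃ z ∈ I ∩ L b, H.Adj x z := by
        intro x hx
        obtain ⟨hxa, z, hz, hxz⟩ := Finset.mem_filter.1 hx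
        obtain ⟨b, -, hzb⟩ := Finset.mem_biUnion.1 ((mem_ind.1 hI).1 hz)
        refine Finset.mem_biUnion.2 ⟨b, ?_, Finset.mem_filter.2 ⟨hxa, z,
          Finset.mem_inter.2 ⟨hz, hzb⟩, hxz⟩⟩
        rcases hL.edges a b x hxa z hzb hxz with rfl | h
        · exact absurd ⟨z, hzb, hz⟩ hcol
        · exact mem_nbrs.2 h
      refine (Finset.card_le_card hsub).trans
        ((Finset.card_biUnion_le_card_mul _ _ 1 fun b hb => ?_).trans (by rw [mul_one]))
      rw [Finset.card_le_one]
      intro x hx x' hx'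
      obtain ⟨hxa, z, hz, hxz⟩ := Finset.mem_filter.1 hx
      obtain ⟨hxa', z', hz', hxz'⟩ := Finset.mem_filter.1 hx'
      rw [Finset.mem_inter] at hz hz'
      have hzz : z = z' := by
        by_contra hne
        exact (mem_ind.1 hI).2 z hz.1 z' hz'.1 (hL.clique b z hz.2 z' hz'.2 hne)
      subst hzz
      exact hL.matching b a (mem_nbrs.1 hb).symm z hz.2 x hxa x' hxa' hxz.symm hxz'.symm
    obtain ⟨x, hxa, hx⟩ : ∃ x ∈ L a, ∀ z ∈ I, ¬ H.Adj x z := by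
      by_contra hcon
      push Not at hcon
      have h1 := hT a (Finset.mem_insert_self a T)
      rw [Finset.filter_true_of_mem hcon] at hblock
      omega
    refine ⟨insert x I, mem_ind.2 ⟨Finset.insert_subset (Finset.mem_biUnion.2
      ⟨a, Finset.mem_univ _, hxa⟩) (mem_ind.1 hI).1, ?_⟩, ?_⟩
    · intro c hc d hd
      rcases Finset.mem_insert.1 hc with hc' | hc' <;> rcases Finset.mem_insert.1 hd with hd' | hd'
      · rw [hc', hd']; exact H.loopless.irrefl _
      · rw [hc']; exact hx d hd'
      · rw [hd']; exact fun h => hx c hc' h.symm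
      · exact (mem_ind.1 hI).2 c hc' d hd'
    · intro b hb
      rw [Finset.union_insert, Finset.mem_insert] at hb
      rcases hb with rfl | hb
      · exact ⟨x, hxa, Finset.mem_insert_self _ _⟩
      · obtain ⟨y, hy, hyI⟩ := hIT b hb
        exact ⟨y, hy, Finset.mem_insert_of_mem hyI⟩

/-- If every vertex that cannot be coloured greedily is admissible, there is a colouring. -/
theorem ListSystem.exists_colouring (hL : ListSystem G H L) {k X Y : ℝ} (hk : 0 < k)
    (hp : 4 * (Real.exp (-X) + G.maxDegree * Real.exp (-Y)) * ((G.maxDegree : ℝ) + 1) ^ 3 ≤ 1)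
    (h : ∀ a, (L a).card ≤ G.degree a →
      ∃ r Z₀ η s, Admissible G H L (4 * k) k X Y a r Z₀ η s) :
    ∃ I ∈ ind H (Finset.univ.biUnion L), ∀ a, ∃ x ∈ L a, x ∈ I := by
  set S := Finset.univ.filter fun a => (L a).card ≤ G.degree a with hS
  -- Vertices with more colours than neighbours are set aside and coloured last. The other lists
  -- have at most Δ colours, which controls the union bound over a list.
  set L' : V → Finset W := fun a => if (L a).card ≤ G.degree a then L a else ∅ with hL'
  have hsub : ∀ a, L' a ⊆ L a := by
    intro a
    simp only [hL']
    split_ifs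
    · exact subset_rfl
    · exact Finset.empty_subset _
  have hLS : ∀ a ∈ S, L' a = L a := fun a ha => if_pos (Finset.mem_filter.1 ha).2
  have hLs' : ListSystem G H L' := by
    refine ⟨fun a b x hx hx' => hL.disj a b x (hsub a hx) (hsub b hx'),
      fun a x hx y hy => hL.clique a x (hsub a hx) y (hsub a hy),
      fun a b x hx y hy => hL.edges a b x (hsub a hx) y (hsub b hy),
      fun a b hab x hx y hy z hz => hL.matching a b hab x (hsub a hx) y (hsub b hy) z (hsub b hz)⟩
  obtain ⟨I, hI, hgood⟩ := hLs'.exists_forall_not_bad (ℓ := 4 * k) (k := k) (X := X) (Y := Y)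
    (S := S) (by positivity) hp (by
      intro a ha
      obtain ⟨r, Z₀, η, s, hadm⟩ := h a (Finset.mem_filter.1 ha).2
      exact ⟨r, Z₀, η, s, hadm.1, hadm.2, hadm.3, hadm.4, hadm.5, hadm.6, hadm.7, by
        rw [hLS a ha]; exact hadm.8⟩) (by
      intro a ha
      rw [hLS a ha]
      have : ((L a).card : ℝ) ≤ G.maxDegree := Nat.cast_le.2
        ((Finset.mem_filter.1 ha).2.trans (G.degree_le_maxDegree a))
      gcongr)
  obtain ⟨I, hI, hIS⟩ := hLs'.exists_partial_colouring hk hI hgood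
  have hIL : I ∈ ind H (Finset.univ.biUnion L) := mem_ind.2
    ⟨(mem_ind.1 hI).1.trans (Finset.biUnion_mono fun a _ => hsub a), (mem_ind.1 hI).2⟩
  obtain ⟨I, hI, hIT⟩ := hL.exists_extension hIL
    (fun a ha => (hIS a ha).imp fun x hx => ⟨hsub a hx.1, hx.2⟩)
    (Finset.univ.filter fun a => G.degree a < (L a).card)
    (fun a ha => (Finset.mem_filter.1 ha).2)
  refine ⟨I, hI, fun a => hIT a ?_⟩
  rw [Finset.mem_union, hS, Finset.mem_filter, Finset.mem_filter]
  rcases le_or_gt (L a).card (G.degree a) with h | h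
  · exact Or.inl ⟨Finset.mem_univ _, h⟩
  · exact Or.inr ⟨Finset.mem_univ _, h⟩

theorem Cover.listSystem (C : Cover G W) : ListSystem G C.H C.L :=
  ⟨fun _ _ x ha hb => (C.partition x).unique ha hb,
    fun a _ hx _ hy hxy => C.complete a hx hy hxy, C.edges, C.matching⟩

theorem Cover.colourable_of_mem_ind (C : Cover G W) {I : Finset W}
    (hI : I ∈ ind C.H (Finset.univ.biUnion C.L)) (h : ∀ a, ∃ x ∈ C.L a, x ∈ I) :
    C.Colourable := by
  choose g hg hgI using h
  refine ⟨Finset.univ.image g, ?_, ?_⟩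
  · rw [isIndepSet_iff_forall]
    intro a ha b hb
    obtain ⟨a, _, rfl⟩ := Finset.mem_image.1 ha
    obtain ⟨b, _, rfl⟩ := Finset.mem_image.1 hb
    exact (mem_ind.1 hI).2 _ (hgI a) _ (hgI b)
  · rw [Finset.card_image_of_injective, Finset.card_univ]
    intro a b hab
    exact C.listSystem.disj a b (g a) (hg a) (hab ▸ hg b)

theorem Cover.colourable_of_degree_lt (C : Cover G W) (h : ∀ a, G.degree a < (C.L a).card) :
    C.Colourable := by
  obtain ⟨I, hI, hIT⟩ := C.listSystem.exists_extension (S := ∅) (empty_mem_ind _)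
    (fun a ha => absurd ha (Finset.notMem_empty a)) Finset.univ fun a _ => h a
  exact C.colourable_of_mem_ind hI fun a => hIT a (by simp)

end Lists

/-! ### Correspondence colouring: numerical estimates and conclusions -/

section Correspondence

open Real Filter

theorem le_scale {ε D : ℝ} {om : ℕ} (hε : 0 < ε) (hom : 3 ≤ om) (hX : 1 ≤ log (8 * D ^ 4)) :
    log (8 * D ^ 4) ≤ scale ε om D := by
  set X := log (8 * D ^ 4) with hXdef
  have he : 1 ≤ exp 1 ^ 2 := one_le_pow₀ (one_le_exp zero_le_one)
  refine le_min ?_ ?_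
  · rw [← hXdef]
    have h1 : X ≤ exp 1 ^ 2 * X := le_mul_of_one_le_left (by linarith) he
    exact h1.trans (le_self_pow₀ (hX.trans h1) (by omega))
  · have hl2 : 0.69 < log 2 := by linarith [log_two_gt_d9]
    have hom' : (3 : ℝ) ≤ om := by exact_mod_cast hom
    have hlr : log 2 ≤ log ((om : ℝ) - 1) := log_le_log (by norm_num) (by linarith)
    rw [← hXdef]
    set q := √(4 * log ((om : ℝ) - 1) * ((1 + ε) * X)) with hq
    have hq2 : 2 * X ≤ q ^ 2 := by
      have hX0 : 0 < X := by linarith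
      have hlr0 : 0 < log ((om : ℝ) - 1) := by linarith
      rw [hq, sq_sqrt (by positivity)]
      have h1 : X ≤ (1 + ε) * X := by nlinarith
      have h2 : 2 ≤ 4 * log ((om : ℝ) - 1) := by linarith
      exact mul_le_mul h2 h1 (by linarith) (by linarith)
    have := quadratic_le_exp_of_nonneg (sqrt_nonneg (4 * log ((om : ℝ) - 1) * ((1 + ε) * X)))
    rw [← hq] at this
    have hq0 : 0 ≤ q := sqrt_nonneg _
    linarith

/-- This is what determines k. With X = log (8 D⁴), the first value in `scale` feeds `log_card_le`
and gives log Z / log 2 ≥ 7X - 1; the second feeds `exists_log_sq_le`, where 4 · 0.37 = 1.48. -/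
theorem exists_le_log_part_of_scale_le : ∃ y₀ : ℝ, ∀ (W : Type u) (H : SimpleGraph W)
    (F : Finset W) (ε D : ℝ) (om : ℕ), 0 < ε → 3 ≤ om → 1 ≤ log (8 * D ^ 4) →
      y₀ ≤ log (8 * D ^ 4) → CliqueLE H F (om - 1) → scale ε om D ≤ F.card →
      1.4 * log (8 * D ^ 4) ≤ log (part H F 1) := by
  obtain ⟨y₀, hy₀⟩ := exists_log_sq_le.{u} one_pos
  refine ⟨y₀, fun W H F ε D om hε hom hX hy hF hk => ?_⟩
  have hFX := (le_scale hε hom hX).trans hk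
  set X := log (8 * D ^ 4) with hXdef
  have hF0 : (0 : ℝ) < F.card := by linarith
  have hom' : (3 : ℝ) ≤ om := by exact_mod_cast hom
  have hrc : ((om - 1 : ℕ) : ℝ) = (om : ℝ) - 1 := by
    rw [Nat.cast_sub (by omega)]; simp
  have hl2 : 0.69 < log 2 := by linarith [log_two_gt_d9]
  have hz := log_nonneg (one_le_part (G := H) F zero_le_one)
  rcases min_le_iff.1 hk with hk | hk
  · rw [← hXdef] at hk
    have h1 := log_card_le one_pos hF (by exact_mod_cast hF0)
    have h2 := log_le_log (by positivity) hk
    rw [log_pow] at h2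
    have hr0 : (0 : ℝ) < ((om - 1 : ℕ) : ℝ) := by rw [hrc]; linarith
    have h3 := le_of_mul_le_mul_left (h2.trans h1) hr0
    rw [log_le_log_iff (by positivity) (by positivity), one_add_one_eq_two] at h3
    have he : (7 : ℝ) ≤ exp 1 ^ 2 := by nlinarith [exp_one_gt_d9]
    have h4 : 7 * X - 1 ≤ log (part H F 1) / log 2 := by nlinarith
    rw [le_div_iff₀ (by linarith)] at h4
    nlinarith
  · rw [← hXdef, ← le_log_iff_exp_le hF0] at hk
    have h1 := hy₀ W H F _ (by omega : 2 ≤ om - 1) hF (hy.trans hFX)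
    rw [hrc] at h1
    have hlr : log 2 ≤ log ((om : ℝ) - 1) := log_le_log (by norm_num) (by linarith)
    have h2 : 4 * log ((om : ℝ) - 1) * ((1 + ε) * X) ≤ log F.card ^ 2 :=
      sqrt_le_left (by linarith [sqrt_nonneg (4 * log ((om : ℝ) - 1) * ((1 + ε) * X))]) |>.1 hk
    have h3 : log ((om : ℝ) - 1) * (1.48 * ((1 + ε) * X)) ≤
        log ((om : ℝ) - 1) * log (part H F 1) := by linarith
    have h4 := le_of_mul_le_mul_left h3 (by linarith)
    nlinarith

theorem CliqueLE.mono_right {V : Type*} {G : SimpleGraph V} {S : Finset V} {r r' : ℕ}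
    (h : CliqueLE G S r) (hr : r ≤ r') : CliqueLE G S r' := fun Q hQ hc => (h Q hQ hc).trans hr

/-- The condition of the local lemma. The factor 1.4 in place of 1 absorbs constants: 4 (D + 1)⁴ ≤
64 D⁴, and the excess 0.4 log (8 D⁴) is at least log 8. -/
theorem four_mul_exp_mul_le_one {D : ℝ} (hD : 1 ≤ D) (hX : 6 ≤ log (8 * D ^ 4)) :
    4 * (exp (-(1.4 * log (8 * D ^ 4))) + D * exp (-(1.4 * log (8 * D ^ 4)))) * (D + 1) ^ 3 ≤ 1 := by
  set X := log (8 * D ^ 4) with hXdef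
  have hpos : 0 < 8 * D ^ 4 := by positivity
  have h8 : log 8 ≤ 0.4 * X := by
    have : log 8 = 3 * log 2 := by
      rw [show (8 : ℝ) = 2 ^ 3 by norm_num, log_pow]; norm_num
    linarith [log_two_lt_d9]
  have h1 : 8 * (8 * D ^ 4) ≤ exp (1.4 * X) := by
    calc 8 * (8 * D ^ 4) = exp (log 8) * exp X := by
          rw [exp_log (by norm_num), hXdef, exp_log hpos]
      _ = exp (log 8 + X) := (exp_add _ _).symm
      _ ≤ _ := exp_le_exp.2 (by linarith)
  have h2 : 4 * (D + 1) ^ 4 ≤ exp (1.4 * X) := by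
    refine le_trans ?_ h1
    have : (D + 1) ^ 4 ≤ (2 * D) ^ 4 := by gcongr; linarith
    linarith [show (2 * D) ^ 4 = 16 * D ^ 4 by ring]
  have e : 4 * (exp (-(1.4 * X)) + D * exp (-(1.4 * X))) * (D + 1) ^ 3 =
      4 * (D + 1) ^ 4 / exp (1.4 * X) := by
    rw [exp_neg]; field_simp; ring
  rw [e, div_le_one (exp_pos _)]
  exact h2

/-- After the losses d / s and 8 e n, the list still has an excess of ε / 4 times f m. What has to
be covered is at most 10 k · 4 Z₀ ≤ 40 e f m, as m = M k; this explains e = ε / 160. -/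
theorem list_inequality {ε e f m M k n d s Z₀ X : ℝ} (hε : 0 < ε) (hε1 : ε ≤ 1)
    (he : e = ε / 160) (hf : 0 < f) (hk : 0 < k) (hM : m = M * k) (hM0 : 0 < M)
    (hn : (1 + ε) * (f * m) ≤ n) (hd : d ≤ m) (hs : 0 < s)
    (hsf : 1 / s ≤ (1 + e) * f)
    (hZ₀ : 1 ≤ Z₀) (hZf : Z₀ ≤ e * f * M) (hX : X ≤ 2 * k) :
    2 * (4 * k) + X ≤ 1 / (4 * Z₀) * (n - d / s - 8 * e * n) := by
  have he0 : 0 < e := by rw [he]; positivity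
  have hm0 : 0 < m := by rw [hM]; positivity
  have hfm : 0 < f * m := mul_pos hf hm0
  have h1 : d / s ≤ (1 + e) * (f * m) := by
    calc d / s = d * (1 / s) := by ring
      _ ≤ m * ((1 + e) * f) := by gcongr
      _ = _ := by ring
  have h2 : ε / 4 * (f * m) ≤ n - d / s - 8 * e * n := by
    have h3 : (1 - 8 * e) * ((1 + ε) * (f * m)) ≤ (1 - 8 * e) * n :=
      mul_le_mul_of_nonneg_left hn (by linarith)
    have h4 : 1 + e + ε / 4 ≤ (1 - 8 * e) * (1 + ε) := by rw [he]; nlinarith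
    have h5 := mul_le_mul_of_nonneg_right h4 hfm.le
    linarith
  rw [one_div_mul_eq_div, le_div_iff₀ (by linarith)]
  refine le_trans ?_ h2
  calc (2 * (4 * k) + X) * (4 * Z₀) ≤ (10 * k) * (4 * (e * f * M)) := by
        have : 0 ≤ 4 * Z₀ := by linarith
        exact mul_le_mul (by linarith) (by linarith) this (by linarith)
    _ = ε / 4 * (f * m) := by rw [he, hM]; ring

theorem exists_correspondence_colouring {ε : ℝ} (hε : 0 < ε) :
    ∃ (δ₀ : ℝ) (Δ₀ : ℕ), Real.exp 1 < δ₀ ∧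
      ∀ (V : Type u) [Fintype V] (G : SimpleGraph V) (om : V → ℕ),
        LocalCliqueBound G om → Δ₀ ≤ G.maxDegree →
        let k : ℝ := scale ε (Finset.univ.sup om) (G.maxDegree : ℝ)
        let δ : ℝ := δ₀ * k
        ∀ (W : Type v) (C : Cover G W),
          (∀ a : V,
            let m : ℝ := max (G.degree a : ℝ) δ
            min ((1 + ε) * boundOne (om a) m (m / k)) ((1 + ε) * boundTwo 2 (om a) m (m / k))
              ≤ ((C.L a).card : ℝ)) →
          C.Colourable := by
  set ε₁ := min ε 1 with hε₁
  have hε₁0 : 0 < ε₁ := lt_min hε one_pos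
  obtain ⟨M₀, hM₀, hthr⟩ := exists_threshold.{v} one_pos (by positivity : 0 < ε₁ / 160)
  obtain ⟨y₀, hy₀⟩ := exists_le_log_part_of_scale_le.{v}
  refine ⟨M₀, ⌈exp (max y₀ 6)⌉₊, hM₀, fun V _ G om hom hΔ => ?_⟩
  intro k δ W C hC
  have hD : exp (max y₀ 6) ≤ G.maxDegree := (Nat.le_ceil _).trans (Nat.cast_le.2 hΔ)
  set D : ℝ := (G.maxDegree : ℝ) with hDdef
  have hD1 : 1 ≤ D := (one_le_exp (by positivity)).trans hD
  have hX : max y₀ 6 ≤ log (8 * D ^ 4) := by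
    rw [le_log_iff_exp_le (by positivity)]
    refine hD.trans ?_
    have : D ≤ D ^ 4 := le_self_pow₀ hD1 (by norm_num)
    linarith
  have hX6 := (le_max_right _ _).trans hX
  have hXy := (le_max_left _ _).trans hX
  rcases isEmpty_or_nonempty V with hV | ⟨⟨a₀⟩⟩
  · exact C.colourable_of_degree_lt fun a => (hV.false a).elim
  have hω3 : 3 ≤ Finset.univ.sup om :=
    (hom a₀).1.trans (Finset.le_sup (Finset.mem_univ _))
  have hkX : log (8 * D ^ 4) ≤ k := le_scale hε hω3 (by linarith)
  have hk : 0 < k := by linarith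
  obtain ⟨I, hI, hIT⟩ := C.listSystem.exists_colouring hk (four_mul_exp_mul_le_one hD1 hX6) (by
    intro a _
    set m : ℝ := max (G.degree a : ℝ) δ with hm
    have hmM : m = m / k * k := (div_mul_cancel₀ _ hk.ne').symm
    have hMM₀ : M₀ ≤ m / k := by
      rw [le_div_iff₀ hk]; exact le_max_right _ _
    have hM0 : 0 < m / k := (exp_pos 1).trans (hM₀.trans_le hMM₀)
    obtain ⟨f, hf, hfm⟩ := exists_isRatio_min (om a) m (m / k)
    obtain ⟨s, Z₀, hs, hZ₀, hf0, hsf, hZf, hsmall⟩ := hthr _ hMM₀ _ (hom a).1 f hf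
    have hn := hC a
    simp only at hn
    rw [← hm, ← mul_min_of_nonneg _ _ (by linarith : 0 ≤ 1 + ε), hfm] at hn
    have hm0 : 0 < m := by rw [hmM]; positivity
    refine ⟨om a - 1, Z₀, ε₁ / 160, s, hZ₀, by positivity, ?_, hs, hom.cliqueLE le_rfl,
      fun F => hsmall W C.H F, fun F hF hkF => ?_, ?_⟩
    · linarith [min_le_right ε 1]
    · rw [← le_log_iff_exp_le (part_pos F zero_le_one)]
      exact hy₀ W C.H F ε D _ hε hω3 (by linarith) hXy (hF.mono_right
        (Nat.sub_le_sub_right (Finset.le_sup (Finset.mem_univ a)) 1)) hkF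
    · refine list_inequality hε₁0 (min_le_right _ _) rfl hf0 hk hmM hM0 (le_trans ?_ hn)
        (le_max_left _ _) hs hsf hZ₀ hZf (by linarith)
      gcongr
      exact min_le_left _ _)
  exact C.colourable_of_mem_ind hI hIT

theorem div_log_le_div_log {y y' : ℝ} (hy : exp 1 ≤ y) (h : y ≤ y') :
    y / log y ≤ y' / log y' := by
  have hy0 : 0 < y := (exp_pos 1).trans_le hy
  have hl : 1 ≤ log y := (le_log_iff_exp_le hy0).2 hy
  have hl' : 1 ≤ log y' := hl.trans (log_le_log hy0 h)
  have := log_div_self_antitoneOn (Set.mem_Ici.2 hy) (Set.mem_Ici.2 (hy.trans h)) h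
  simp only at this
  rw [div_le_div_iff₀ (by linarith) hy0] at this
  rw [div_le_div_iff₀ (by linarith) (by linarith)]
  linarith

/-- With y = m / k the bound factors through y / log y and log log y, both nondecreasing from `exp
1` on. -/
theorem boundOne_mono {om om' m m' k : ℝ} (hom : 2 ≤ om) (homm : om ≤ om') (hk : 0 < k)
    (hm : exp 1 ≤ m / k) (hmm : m ≤ m') :
    boundOne om m (m / k) ≤ boundOne om' m' (m' / k) := by
  have hy : m / k ≤ m' / k := by gcongr
  have hy0 : 0 < m / k := (exp_pos 1).trans_le hm
  have hl : 1 ≤ log (m / k) := (le_log_iff_exp_le hy0).2 hm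
  have hll : log (m / k) ≤ log (m' / k) := log_le_log hy0 hy
  have e : ∀ o x : ℝ, boundOne o x (x / k) =
      (o - 2) * (k * (log (log (x / k)) * (x / k / log (x / k)))) := by
    intro o x
    rw [boundOne]
    field_simp
  rw [e, e]
  have h1 := div_log_le_div_log hm hy
  have h2 : 0 ≤ log (log (m / k)) := log_nonneg hl
  have h3 : log (log (m / k)) ≤ log (log (m' / k)) := log_le_log (by linarith) hll
  have h4 : 0 ≤ m / k / log (m / k) := by positivity
  have h5 : 0 ≤ log (log (m' / k)) := h2.trans h3
  gcongr
  linarith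

theorem boundTwo_mono {om om' m m' k : ℝ} (hom : 2 ≤ om) (homm : om ≤ om') (hk : 0 < k)
    (hm : exp 1 ≤ m / k) (hmm : m ≤ m') :
    boundTwo 2 om m (m / k) ≤ boundTwo 2 om' m' (m' / k) := by
  have hy : m / k ≤ m' / k := by gcongr
  have hy0 : 0 < m / k := (exp_pos 1).trans_le hm
  have hm0 : 0 < m := by have := mul_pos hy0 hk; rwa [div_mul_cancel₀ _ hk.ne'] at this
  have hl : 1 ≤ log (m / k) := (le_log_iff_exp_le hy0).2 hm
  have hll : log (m / k) ≤ log (m' / k) := log_le_log hy0 hy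
  have e : ∀ o x : ℝ, 0 ≤ x → boundTwo 2 o x (x / k) =
      2 * √(log (o - 1) * (k * x * (x / k / log (x / k)))) := by
    intro o x hx
    rw [boundTwo, mul_assoc]
    congr 1
    nth_rw 1 [← sqrt_sq hx]
    rw [← sqrt_mul (sq_nonneg x)]
    congr 1
    field_simp
  rw [e _ _ hm0.le, e _ _ (hm0.le.trans hmm)]
  have h1 := div_log_le_div_log hm hy
  have h2 : 0 ≤ log (om - 1) := log_nonneg (by linarith)
  have h4 : 0 ≤ m / k / log (m / k) := by positivity
  have h5 : log (om - 1) ≤ log (om' - 1) := log_le_log (by linarith) (by linarith)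
  have h2' : 0 ≤ log (om' - 1) := h2.trans h5
  have hm0' : 0 ≤ m' := hm0.le.trans hmm
  have h6 : k * m * (m / k / log (m / k)) ≤ k * m' * (m' / k / log (m' / k)) := by gcongr
  gcongr

/-- The bounds at the maximum degree are sufficient. -/
theorem correspondenceChromaticNumber_le_of_list {V : Type u} [Fintype V] {G : SimpleGraph V}
    {om : V → ℕ} (hom : LocalCliqueBound G om) {ε k δ₀ : ℝ} (hε : 0 < ε) (hk : 0 < k)
    (hδ₀ : exp 1 < δ₀) (hδk : δ₀ ≤ G.maxDegree / k)
    (h : ∀ (W : Type) (C : Cover G W),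
      (∀ a : V, min ((1 + ε) * boundOne (om a) (max (G.degree a : ℝ) (δ₀ * k))
          (max (G.degree a : ℝ) (δ₀ * k) / k))
        ((1 + ε) * boundTwo 2 (om a) (max (G.degree a : ℝ) (δ₀ * k))
          (max (G.degree a : ℝ) (δ₀ * k) / k)) ≤ ((C.L a).card : ℝ)) → C.Colourable) (n : ℕ)
    (hn : min ((1 + ε) * boundOne (Finset.univ.sup om : ℕ) G.maxDegree (G.maxDegree / k))
      ((1 + ε) * boundTwo 2 (Finset.univ.sup om : ℕ) G.maxDegree (G.maxDegree / k)) ≤ n) :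
    correspondenceChromaticNumber G ≤ n := by
  refine Nat.sInf_le fun W C hC => h W C fun a => le_trans ?_ (hn.trans (by rw [hC a]))
  have h1 : (2 : ℝ) ≤ om a := by exact_mod_cast (by have := (hom a).1; omega : 2 ≤ om a)
  have h2 : (om a : ℝ) ≤ (Finset.univ.sup om : ℕ) := Nat.cast_le.2
    (Finset.le_sup (Finset.mem_univ a))
  have h3 : exp 1 ≤ max (G.degree a : ℝ) (δ₀ * k) / k :=
    hδ₀.le.trans ((le_div_iff₀ hk).2 (le_max_right _ _))
  have h4 : max (G.degree a : ℝ) (δ₀ * k) ≤ G.maxDegree :=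
    max_le (Nat.cast_le.2 (G.degree_le_maxDegree a)) ((le_div_iff₀ hk).1 hδk)
  have h5 := boundOne_mono h1 h2 hk h3 h4
  have h6 := boundTwo_mono h1 h2 hk h3 h4
  exact min_le_min (by gcongr) (by gcongr)

theorem correspondenceChromaticNumber_le_succ {V : Type u} [Fintype V] (G : SimpleGraph V) :
    correspondenceChromaticNumber G ≤ G.maxDegree + 1 :=
  Nat.sInf_le fun W C hC => C.colourable_of_degree_lt fun a => by
    rw [hC a]; exact Nat.lt_succ_of_le (G.degree_le_maxDegree a)

theorem log_eight_mul_le {D : ℝ} (hD : 0 < D) : log (8 * D ^ 4) ≤ 2.1 + 4 * log D := by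
  rw [log_mul (by norm_num) (by positivity), log_pow]
  have : log 8 = 3 * log 2 := by
    rw [show (8 : ℝ) = 2 ^ 3 by norm_num, log_pow]; norm_num
  push_cast
  linarith [log_two_lt_d9]

theorem log_scale_le {ε D : ℝ} {om : ℕ} (hk : 0 < scale ε om D) :
    log (scale ε om D) ≤ √(4 * log ((om : ℝ) - 1) * ((1 + ε) * log (8 * D ^ 4))) := by
  rw [← log_exp (√(4 * log ((om : ℝ) - 1) * ((1 + ε) * log (8 * D ^ 4))))]
  exact log_le_log hk (min_le_right _ _)

/-- A bound below D forces ω - 2 ≤ log D. Then log k is of order at most √(log D log log D),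
negligible against log D. -/
theorem boundOne_scale_le {ε κ D : ℝ} {om : ℕ} (hε0 : 0 < ε) (hε1 : ε ≤ 1) (hκ : 0 < κ)
    (hκ1 : κ < 1) (hom : 3 ≤ om) (hD : 0 < D) (hq : exp 1 ≤ log D) (hX : 1 ≤ log (8 * D ^ 4))
    (hlog : 80 * log (log D) ≤ κ ^ 2 * log D) (hlt : boundOne om D D < D) :
    (1 - κ) * log D ≤ log (D / scale ε om D) ∧
      boundOne om D (D / scale ε om D) ≤ 1 / (1 - κ) * boundOne om D D := by
  have hk1 : 1 ≤ scale ε om D := hX.trans (le_scale hε0 hom hX)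
  set k := scale ε om D with hkdef
  have hk0 : 0 < k := by linarith
  have hX2 := log_eight_mul_le hD
  set q := log D with hqdef
  have hq0 : 0 < q := (exp_pos 1).trans_le hq
  have hlq : 1 ≤ log q := (le_log_iff_exp_le hq0).2 hq
  have hq2 : 2.7 ≤ q := by linarith [exp_one_gt_d9]
  have hom' : (3 : ℝ) ≤ om := by exact_mod_cast hom
  have hom2 : (om : ℝ) - 2 ≤ q := by
    rw [boundOne, ← hqdef] at hlt
    have h1 : ((om : ℝ) - 2) * (D * 1 / q) ≤ (om - 2) * (D * log q / q) := by
      have : (0 : ℝ) ≤ om - 2 := by linarith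
      gcongr
    have h2 := h1.trans_lt hlt
    rw [mul_one, mul_div_assoc', div_lt_iff₀ hq0, mul_comm] at h2
    exact (lt_of_mul_lt_mul_left h2 hD.le).le
  have hlom : log ((om : ℝ) - 1) ≤ 2 * log q := by
    have : log ((om : ℝ) - 1) ≤ log (q ^ 2) := log_le_log (by linarith) (by nlinarith)
    rwa [log_pow, Nat.cast_ofNat] at this
  have hlom0 : 0 ≤ log ((om : ℝ) - 1) := log_nonneg (by linarith)
  have hlk : log k ≤ κ * q := by
    refine (log_scale_le hk0).trans (sqrt_le_iff.2 ⟨by positivity, ?_⟩)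
    calc 4 * log ((om : ℝ) - 1) * ((1 + ε) * log (8 * D ^ 4))
        ≤ 4 * (2 * log q) * (2 * (5 * q)) := by
          have h1 : (1 + ε) * log (8 * D ^ 4) ≤ 2 * (5 * q) := by
            have : log (8 * D ^ 4) ≤ 5 * q := by linarith
            gcongr; linarith
          gcongr
      _ = (80 * log q) * q := by ring
      _ ≤ (κ ^ 2 * q) * q := by gcongr
      _ = (κ * q) ^ 2 := by ring
  have hldiv : log (D / k) = q - log k := log_div hD.ne' hk0.ne'
  have hlow : (1 - κ) * q ≤ log (D / k) := by rw [hldiv]; linarith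
  refine ⟨hlow, ?_⟩
  have hup : log (D / k) ≤ q := by rw [hldiv]; linarith [log_nonneg hk1]
  have hpos : 0 < (1 - κ) * q := mul_pos (by linarith) hq0
  have h1 : log (log (D / k)) ≤ log q := log_le_log (hpos.trans_le hlow) hup
  have h2 : D * log (log (D / k)) / log (D / k) ≤ D * log q / ((1 - κ) * q) := by
    have : 0 ≤ D * log q := by positivity
    gcongr
  rw [boundOne, boundOne, ← hqdef]
  have h3 : (0 : ℝ) ≤ om - 2 := by linarith
  have h4 : (1 - κ) ≠ 0 := by linarith
  calc ((om : ℝ) - 2) * (D * log (log (D / k)) / log (D / k))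
      ≤ (om - 2) * (D * log q / ((1 - κ) * q)) := by gcongr
    _ = _ := by field_simp

/-- Here log k can be comparable to log D. A bound below D forces log (ω - 1) ≤ log D / 25, hence
log k ≤ 0.82 log D. As 2 / √0.18 < 4.72, the constant 5 leaves room for 1 + ε and for rounding. -/
theorem boundTwo_scale_le {ε D : ℝ} {om : ℕ} (hε0 : 0 < ε) (hε1 : ε ≤ 1 / 40)
    (hom : 3 ≤ om) (hD : 0 < D) (hq : 22 ≤ log D) (hX : 1 ≤ log (8 * D ^ 4))
    (hlt : boundTwo 5 om D D < D) :
    0.18 * log D ≤ log (D / scale ε om D) ∧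
      (1 + ε) * boundTwo 2 om D (D / scale ε om D) ≤ 0.98 * boundTwo 5 om D D := by
  have hk1 : 1 ≤ scale ε om D := hX.trans (le_scale hε0 hom hX)
  set k := scale ε om D with hkdef
  have hk0 : 0 < k := by linarith
  have hX2 := log_eight_mul_le hD
  set q := log D with hqdef
  have hq0 : 0 < q := by linarith
  have hom' : (3 : ℝ) ≤ om := by exact_mod_cast hom
  have hlom0 : 0 ≤ log ((om : ℝ) - 1) := log_nonneg (by linarith)
  have hρ : 25 * log ((om : ℝ) - 1) ≤ q := by
    rw [boundTwo, ← hqdef] at hlt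
    have h1 : √(log ((om : ℝ) - 1) / q) < 1 / 5 := by
      have : D * (5 * √(log ((om : ℝ) - 1) / q)) < D * 1 := by linarith
      have := lt_of_mul_lt_mul_left this hD.le
      linarith
    rw [sqrt_lt' (by norm_num), div_lt_iff₀ hq0] at h1
    linarith
  have hlk : log k ≤ 0.82 * q := by
    refine (log_scale_le hk0).trans (sqrt_le_iff.2 ⟨by positivity, ?_⟩)
    calc 4 * log ((om : ℝ) - 1) * ((1 + ε) * log (8 * D ^ 4))
        ≤ 4 * (q / 25) * (4.2 * q) := by
          have h1 : (1 + ε) * log (8 * D ^ 4) ≤ 4.2 * q := by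
            calc (1 + ε) * log (8 * D ^ 4) ≤ (1 + 1 / 40) * (2.1 + 4 * q) := by gcongr
              _ ≤ _ := by linarith
          gcongr
          linarith
      _ ≤ (0.82 * q) ^ 2 := by nlinarith [sq_nonneg q]
  have hldiv : log (D / k) = q - log k := log_div hD.ne' hk0.ne'
  have hlow : 0.18 * q ≤ log (D / k) := by rw [hldiv]; linarith
  refine ⟨hlow, ?_⟩
  rw [boundTwo, boundTwo, ← hqdef]
  set ρ := log ((om : ℝ) - 1) / q with hρdef
  have hρ0 : 0 ≤ ρ := by positivity
  have h1 : √(log ((om : ℝ) - 1) / log (D / k)) ≤ 2.36 * √ρ := by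
    rw [sqrt_le_left (by positivity), mul_pow, sq_sqrt hρ0]
    calc log ((om : ℝ) - 1) / log (D / k) ≤ log ((om : ℝ) - 1) / (0.18 * q) := by gcongr
      _ = 1 / 0.18 * ρ := by rw [hρdef]; field_simp
      _ ≤ _ := by gcongr; norm_num
  have h0 : 0 ≤ D * √ρ := by positivity
  calc (1 + ε) * (2 * D * √(log ((om : ℝ) - 1) / log (D / k)))
      ≤ (1 + 1 / 40) * (2 * D * (2.36 * √ρ)) := by gcongr
    _ ≤ _ := by linarith

theorem exists_correspondenceChromaticNumber_le {ε : ℝ} (hε : 0 < ε) : ∃ Δ₀ : ℕ,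
    ∀ (V : Type u) [Fintype V] (G : SimpleGraph V) (om : V → ℕ),
      LocalCliqueBound G om → Δ₀ ≤ G.maxDegree →
        let Δ : ℝ := (G.maxDegree : ℝ)
        let ω : ℝ := ((Finset.univ.sup om : ℕ) : ℝ)
        (correspondenceChromaticNumber G : ℝ) ≤
          (1 + ε) * min (boundOne ω Δ Δ) (boundTwo 5 ω Δ Δ) := by
  obtain ⟨e, he0, he1, he2⟩ : ∃ e : ℝ, 0 < e ∧ 40 * e ≤ 1 ∧ 40 * e ≤ ε := by
    have hmin : 0 < min ε 1 := lt_min hε one_pos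
    exact ⟨min ε 1 / 40, by positivity, by linarith [min_le_right ε 1],
      by linarith [min_le_left ε 1]⟩
  obtain ⟨δ₀, Δ₁, hδ₀, h4⟩ := exists_correspondence_colouring.{u, 0} he0
  have hδ0 : 0 < δ₀ := (exp_pos 1).trans hδ₀
  obtain ⟨q₀, hq₀⟩ := eventually_atTop.1
    ((eventually_mul_log_add_le (c := e ^ 2) (by positivity) 80 0).and
      (eventually_ge_atTop (max (max 22 (log δ₀ / 0.18)) (2 * max 20 (2 / ε)))))
  refine ⟨max Δ₁ ⌈exp q₀⌉₊, fun V _ G om hom hΔ => ?_⟩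
  intro D ω
  have hexp : exp q₀ ≤ D := (Nat.le_ceil _).trans (Nat.cast_le.2 ((le_max_right _ _).trans hΔ))
  have hD0 : 0 < D := (exp_pos _).trans_le hexp
  obtain ⟨hlog, hq⟩ := hq₀ (log D) ((le_log_iff_exp_le hD0).2 hexp)
  have hq22 : 22 ≤ log D := (le_max_left _ _).trans ((le_max_left _ _).trans hq)
  have hqδ : log δ₀ ≤ 0.18 * log D := by
    have := (le_max_right _ _).trans ((le_max_left _ _).trans hq)
    rw [div_le_iff₀ (by norm_num)] at this
    linarith
  have hqC : 2 * max 20 (2 / ε) ≤ log D := (le_max_right _ _).trans hq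
  rw [add_zero] at hlog
  -- the degree is much larger than its logarithm
  have hDq : max 20 (2 / ε) * log D ≤ D := by
    have := quadratic_le_exp_of_nonneg (by linarith : 0 ≤ log D)
    rw [exp_log hD0] at this
    nlinarith
  have hD20 : 20 * log D ≤ D :=
    le_trans (by have := le_max_left 20 (2 / ε); gcongr) hDq
  have hDε : 2 / ε * log D ≤ D :=
    le_trans (by have := le_max_right 20 (2 / ε); gcongr) hDq
  rw [div_mul_eq_mul_div, div_le_iff₀ hε] at hDε
  have hX : 1 ≤ log (8 * D ^ 4) := by
    rw [log_mul (by norm_num) (by positivity), log_pow]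
    have : 0 ≤ log 8 := log_nonneg (by norm_num)
    push_cast
    linarith
  rcases isEmpty_or_nonempty V with hV | ⟨⟨a₀⟩⟩
  · have h0 : G.maxDegree = 0 := by simp [SimpleGraph.maxDegree]
    have : D = 0 := by simp only [D, h0, Nat.cast_zero]
    linarith
  have hω3 : 3 ≤ Finset.univ.sup om :=
    (hom a₀).1.trans (Finset.le_sup (Finset.mem_univ _))
  have hω3' : (3 : ℝ) ≤ ω := Nat.ofNat_le_cast.2 hω3
  have hk : 0 < scale e (Finset.univ.sup om) D := by linarith [le_scale he0 hω3 hX]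
  -- If a bound reaches D, colouring greedily with D + 1 colours is enough; only the opposite case
  -- needs the estimates of `scale`.
  have greedy : ∀ b : ℝ, D ≤ b → (correspondenceChromaticNumber G : ℝ) ≤ (1 + ε) * b := by
    intro b hb
    have h1 : (correspondenceChromaticNumber G : ℝ) ≤ D + 1 := by
      have := (Nat.cast_le (α := ℝ)).2 (correspondenceChromaticNumber_le_succ G)
      rwa [Nat.cast_succ] at this
    have h2 : (1 + ε) * D ≤ (1 + ε) * b := by gcongr
    nlinarith
  have hcol := h4 V G om hom ((le_max_left _ _).trans hΔ)
  have hδk : ∀ c : ℝ, 0.18 ≤ c → c * log D ≤ log (D / scale e (Finset.univ.sup om) D) →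
      δ₀ ≤ D / scale e (Finset.univ.sup om) D := by
    intro c hc h
    rw [← log_le_log_iff hδ0 (by positivity)]
    refine (hqδ.trans ?_).trans h
    gcongr
  -- The number of colours is t rounded up, whence the requirement on t + 1.
  have finish : ∀ b t : ℝ, δ₀ ≤ D / scale e (Finset.univ.sup om) D →
      min ((1 + e) * boundOne ω D (D / scale e (Finset.univ.sup om) D))
        ((1 + e) * boundTwo 2 ω D (D / scale e (Finset.univ.sup om) D)) ≤ t →
      t + 1 ≤ (1 + ε) * b → 0 ≤ t → (correspondenceChromaticNumber G : ℝ) ≤ (1 + ε) * b := by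
    intro b t h1 h2 h3 ht
    have h5 := correspondenceChromaticNumber_le_of_list hom he0 hk hδ₀ h1 hcol ⌈t⌉₊
      (h2.trans (Nat.le_ceil t))
    have h6 : (correspondenceChromaticNumber G : ℝ) ≤ ⌈t⌉₊ := Nat.cast_le.2 h5
    linarith [Nat.ceil_lt_add_one ht]
  rw [mul_min_of_nonneg _ _ (by linarith : 0 ≤ 1 + ε)]
  refine le_min ?_ ?_
  · rcases le_or_gt D (boundOne ω D D) with hge | hlt
    · exact greedy _ hge
    have hqe : exp 1 ≤ log D := by linarith [exp_one_lt_d9]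
    obtain ⟨h1, h2⟩ := boundOne_scale_le he0 (by linarith) he0 (by linarith) hω3 hD0 hqe hX hlog
      hlt
    have hb : D / log D ≤ boundOne ω D D := by
      rw [boundOne]
      have : 1 ≤ log (log D) := (le_log_iff_exp_le (by linarith)).2 hqe
      calc D / log D = 1 * (D * 1 / log D) := by ring
        _ ≤ _ := by gcongr <;> linarith
    have hb0 : 0 ≤ boundOne ω D D := le_trans (by positivity) hb
    have hb2 : 1 ≤ ε / 2 * boundOne ω D D := by
      have : 2 / ε ≤ D / log D := by
        rw [div_le_div_iff₀ hε (by linarith)]; linarith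
      have := this.trans hb
      rw [div_le_iff₀ hε] at this
      linarith
    have h1e : 0 < 1 - e := by linarith
    refine finish _ ((1 + e) * (1 / (1 - e) * boundOne ω D D)) (hδk _ (by linarith) h1)
      ((min_le_left _ _).trans (by gcongr)) ?_ (by positivity)
    have h3 : (1 + e) * (1 / (1 - e)) ≤ 1 + ε / 2 := by
      rw [mul_one_div, div_le_iff₀ h1e]
      nlinarith
    have h5 := mul_le_mul_of_nonneg_right h3 hb0
    linarith
  · rcases le_or_gt D (boundTwo 5 ω D D) with hge | hlt
    · exact greedy _ hge
    obtain ⟨h1, h2⟩ := boundTwo_scale_le he0 (by linarith) hω3 hD0 hq22 hX hlt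
    -- The 0.02 of the bound that `boundTwo_scale_le` leaves over is then at least 1 and pays for
    -- rounding.
    have hb : 50 ≤ boundTwo 5 ω D D := by
      rw [boundTwo]
      have hl2 : 0.69 < log 2 := by linarith [log_two_gt_d9]
      have hlr : log 2 ≤ log (ω - 1) := log_le_log (by norm_num) (by linarith)
      have h3 : 1 / (2 * log D) ≤ √(log (ω - 1) / log D) := by
        refine le_sqrt_of_sq_le ?_
        rw [div_pow, div_le_div_iff₀ (by positivity) (by linarith)]
        nlinarith
      calc (50 : ℝ) ≤ 5 * D * (1 / (2 * log D)) := by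
            rw [mul_one_div, le_div_iff₀ (by linarith)]; linarith
        _ ≤ _ := by gcongr
    refine finish _ (0.98 * boundTwo 5 ω D D) (hδk _ le_rfl h1)
      ((min_le_right _ _).trans h2) ?_ (by linarith)
    nlinarith

end Correspondence

end

end LocalOcc

open LocalOcc in
theorem theorem7p1 :
    -- the occupancy fraction of the hard-core model
    (∀ lam : ℝ, 0 < lam → ∀ ε : ℝ, 0 < ε → ∃ Δ₀ : ℕ,
      ∀ (V : Type u) [Fintype V] (G : SimpleGraph V) (om : V → ℕ),
        LocalCliqueBound G om → Δ₀ ≤ G.maxDegree →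
        let Δ : ℝ := (G.maxDegree : ℝ)
        let ω : ℝ := ((Finset.univ.sup om : ℕ) : ℝ)
        (1 - ε) * max (Real.log Δ / ((ω - 2) * Δ * Real.log (Real.log Δ)))
            (1 / (2 * Δ) * Real.sqrt (Real.log Δ / Real.log (ω - 1)))
          ≤ occupancyFraction G lam) ∧
    -- local fractional colouring
    (∀ ε : ℝ, 0 < ε → ∃ δ₀ : ℝ, Real.exp 1 < δ₀ ∧
      ∀ (V : Type u) [Fintype V] (G : SimpleGraph V) (om : V → ℕ),
        LocalCliqueBound G om →
        ∃ w : FractionalColouring G, ∀ a : V,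
          let m : ℝ := max (G.degree a : ℝ) δ₀
          w.colour a ⊆ Set.Ico 0
            (min ((1 + ε) * boundOne (om a) m m) ((1 + ε) * boundTwo 2 (om a) m m))) ∧
    -- the fractional chromatic number
    (∀ ε : ℝ, 0 < ε → ∃ Δ₀ : ℕ,
      ∀ (V : Type u) [Fintype V] (G : SimpleGraph V) (om : V → ℕ),
        LocalCliqueBound G om → Δ₀ ≤ G.maxDegree →
        let Δ : ℝ := (G.maxDegree : ℝ)
        let ω : ℝ := ((Finset.univ.sup om : ℕ) : ℝ)
        fractionalChromaticNumber G ≤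
          (1 + ε) * min (boundOne ω Δ Δ) (boundTwo 2 ω Δ Δ)) ∧
    -- local correspondence colouring
    (∀ ε : ℝ, 0 < ε → ∃ (δ₀ : ℝ) (Δ₀ : ℕ), Real.exp 1 < δ₀ ∧
      ∀ (V : Type u) [Fintype V] (G : SimpleGraph V) (om : V → ℕ),
        LocalCliqueBound G om → Δ₀ ≤ G.maxDegree →
        let k : ℝ := scale ε (Finset.univ.sup om) (G.maxDegree : ℝ)
        let δ : ℝ := δ₀ * k
        ∀ (W : Type v) (C : Cover G W),
          (∀ a : V,
            let m : ℝ := max (G.degree a : ℝ) δ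
            min ((1 + ε) * boundOne (om a) m (m / k)) ((1 + ε) * boundTwo 2 (om a) m (m / k))
              ≤ ((C.L a).card : ℝ)) →
          C.Colourable) ∧
    -- the correspondence chromatic number
    (∀ ε : ℝ, 0 < ε → ∃ Δ₀ : ℕ,
      ∀ (V : Type u) [Fintype V] (G : SimpleGraph V) (om : V → ℕ),
        LocalCliqueBound G om → Δ₀ ≤ G.maxDegree →
        let Δ : ℝ := (G.maxDegree : ℝ)
        let ω : ℝ := ((Finset.univ.sup om : ℕ) : ℝ)
        (correspondenceChromaticNumber G : ℝ) ≤
          (1 + ε) * min (boundOne ω Δ Δ) (boundTwo 5 ω Δ Δ)) :=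
  ⟨fun _ hlam _ hε => exists_le_occupancyFraction hlam hε,
    fun _ hε => exists_local_fractionalColouring hε,
    fun _ hε => exists_fractionalChromaticNumber_le hε,
    fun _ hε => exists_correspondence_colouring hε,
    fun _ hε => exists_correspondenceChromaticNumber_le hε⟩
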